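/- Let $X = x^2\,\partial_x + A(x,y)\,\partial_y$ with $A\in\mathbb{C}\{x,y\}$, $A(0,y)=y$ and $\frac{\partial^2 A}{\partial x\,\partial y}(0,0)=0$ (saddle-node). Write $A(x,y)=y+\sum_{\eta\ge -1}a_\eta(x)\,y^{\eta+1}$ and, for $\eta\in\mathbb{Z}$, $\eta\ge -1$, put $B_\eta=y^{\eta+1}\partial_y$. For a word $(\omega_1,\dots,\omega_r)$ in integers $\ge -1$, put $\mathbf{B}_{\omega_1,\dots,\omega_r}=B_{\omega_r}\cdots B_{\omega_1}$, $\mathbf{B}_\emptyset=\mathrm{Id}$, and let $\mathcal{V}^{\omega_1,\dots,\omega_r}\in x\mathbb{C}[[x]]$ ($r\ge 1$) be inductively determined by $$\Big(x^2\tfrac{d}{dx}+\omega_1+\dots+\omega_r\Big)\mathcal{V}^{\omega_1,\dots,\omega_r}=a_{\omega_1}\mathcal{V}^{\omega_2,\dots,\omega_r},\qquad \mathcal{V}^\emptyset=1.$$ The formally convergent series of operators $\Theta=\sum\mathcal{V}^{\omega_1,\dots,\omega_r}\mathbf{B}_{\omega_1,\dots,\omega_r}$ of $\mathbb{C}[[x,y]]$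 is the substitution operator $f\mapsto f\circ\theta$ of a formal transformation $\theta(x,y)=\big(x,\,y+\sum_{n\ge 0}\varphi_n(x)y^n\big)$ with $\varphi_n\in x\mathbb{C}[[x]]$, which has an inverse of the form $\theta^{-1}(x,y)=\big(x,\,y+\sum_{n\ge 0}\psi_n(x)y^n\big)$ with $\psi_n\in x\mathbb{C}[[x]]$. Put $\widetilde\varphi_n(z)=\varphi_n(-1/z)$, $\widetilde\psi_n(z)=\psi_n(-1/z)\in z^{-1}\mathbb{C}[[z^{-1}]]$, and let $\widehat\varphi_n,\widehat\psi_n\in\mathbb{C}[[\zeta]]$ be their formal Borel transforms, where $\sum_{k\ge 0} c_kz^{-k-1}\mapsto\sum_{k\ge 0} c_k\zeta^k/k!$. Let $\widetilde{\boldsymbol R}_{\mathbb{Z}}$ be the algebra of resurgent functions over $\mathbb{Z}$, in the formal model: the series $c+\widetilde\chi(z)$, $c\in\mathbb{C}$, $\widetilde\chi\in z^{-1}\mathbb{C}[[z^{-1}]]$, such that the formal Borel transform of $\widetilde\chi$ converges near $0$ and has an analytic continuation along every absolutely continuous path that starts from $0$ and then avoids $\mathbb{Z}$, i.e. every $\gamma\colon[0,1]\to\mathbb{C}\setminus\mathbb{Z}^*$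 with $\gamma(0)=0$ and $\gamma^{-1}(0)$ connected. For $\rho\in(0,\frac12)$, $N\in\mathbb{N}^*$ and $\mathscr{P}=n-\mathbb{N}^*=\{n-1,n-2,\dots\}$ (resp. $\mathscr{P}=\mathbb{N}$), an infinite $(\rho,N,\mathscr{P})$-adapted path issuing from the origin is an arc-length parametrised path $\gamma\colon[0,+\infty)\to\mathbb{C}$ (absolutely continuous, $|\dot\gamma(t)|=1$ for almost every $t$) with $\gamma(0)=0$, $|\gamma(t)|=t$ for $0\le t\le\rho$, and, for all $t>\rho$, $\operatorname{dist}(\gamma(t),\mathscr{P})\ge\rho$ and $\operatorname{dist}\big(-N,[0,\gamma(t)]\big)\ge\rho$ (resp. $\operatorname{dist}\big(N,[0,\gamma(t)]\big)\ge\rho$). **Theorem.** For each $n\in\mathbb{N}$, $\widetilde\varphi_n$ and $\widetilde\psi_n$ belong to $\widetilde{\boldsymbol R}_{\mathbb{Z}}$, and: 1. All the branches of the analytic continuation of $\widehat\varphi_n$ are regular at the points of $n+\mathbb{N}=\{n,n+1,\dots\}$. 2. All the branches of the analytic continuation of $\widehat\psi_n$ are regular at the points of $-\mathbb{N}^*=\{-1,-2,\dots\}$,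 with the sole exception that the branches of $\widehat\psi_0$ may have simple poles at $-1$. 3. Given any $\rho\in(0,\frac12)$ and $N\in\mathbb{N}^*$, there exist positive constants $K,L,C$ (depending on $A$, $\rho$, $N$, but not on $n$ nor on $\gamma$) such that the following holds. For every $n\in\mathbb{N}$ and every infinite $(\rho,N,n-\mathbb{N}^*)$-adapted path $\gamma$ issuing from the origin, $\widehat\varphi_n$ has an analytic continuation along $\gamma$, with $$\big|\widehat\varphi_n(\gamma(t))\big|\le K L^n e^{(n^2+1)Ct}\quad\text{for all } t\ge 0.$$ For every infinite $(\rho,N,\mathbb{N})$-adapted path $\gamma$ issuing from the origin, $\widehat\psi_n$ ($n\ge 1$) and $(\zeta+1)\widehat\psi_0(\zeta)$ have analytic continuations along $\gamma$, with, for all $t\ge 0$, $$\big|\widehat\psi_n(\gamma(t))\big|\le K L^n e^{Ct}\ \ (n\ge 1),\qquad \big|(\gamma(t)+1)\,\widehat\psi_0(\gamma(t))\big|\le K e^{Ct}.$$ -/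

import Mathlib

open Filter Topology MeasureTheory

noncomputable section

namespace SaddleNode

/-! ### Formal series in two variables

`MvPowerSeries (Fin 2) ℂ` is `ℂ[[x, y]]`, with `x = X 0` and `y = X 1`;
`PowerSeries ℂ` is used for `ℂ[[x]]`, for `ℂ[[ζ]]` and for `ℂ[[z⁻¹]]`. -/

/-- `ℂ[[x, y]]`. -/
abbrev Ser2 : Type := MvPowerSeries (Fin 2) ℂ

/-- The exponent of the monomial `x ^ m * y ^ k`. -/
def expo (m k : ℕ) : Fin 2 →₀ ℕ := Finsupp.single 0 m + Finsupp.single 1 k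

/-- The coefficient of `y ^ k` in `A`, as a series in `x`. -/
def yCoeff (k : ℕ) (A : Ser2) : PowerSeries ℂ :=
  PowerSeries.mk fun m => MvPowerSeries.coeff (expo m k) A

/-- The series `∑ₖ cₖ(x) yᵏ`. -/
def ySeries (c : ℕ → PowerSeries ℂ) : Ser2 :=
  fun d => PowerSeries.coeff (d 0) (c (d 1))

/-- A series `v(x)` viewed as an element of `ℂ[[x, y]]`. -/
def inX (v : PowerSeries ℂ) : Ser2 := ySeries fun k => if k = 0 then v else 0

/-- `A ∈ ℂ{x, y}`: absolute convergence on some polydisc. -/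
def IsConvergent (A : Ser2) : Prop :=
  ∃ r : ℝ, 0 < r ∧
    Summable fun d : Fin 2 →₀ ℕ => ‖MvPowerSeries.coeff d A‖ * r ^ (d 0 + d 1)

/-- The hypotheses on the vector field `x² ∂/∂x + A(x,y) ∂/∂y`:
`A ∈ ℂ{x,y}`, `A(0,y) = y` and `∂²A/∂x∂y (0,0) = 0`. -/
structure IsSaddleNode (A : Ser2) : Prop where
  convergent : IsConvergent A
  at_zero : ∀ k : ℕ, MvPowerSeries.coeff (expo 0 k) A = if k = 1 then 1 else 0
  mixed : MvPowerSeries.coeff (expo 1 1) A = 0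

/-! ### Letters, words, and the mould-comould expansion -/

/-- The alphabet `{η ∈ ℤ | η ≥ -1}`. -/
abbrev Letter : Type := {η : ℤ // -1 ≤ η}

/-- The natural number `η + 1`. -/
def Letter.succ (η : Letter) : ℕ := (η.1 + 1).toNat

/-- The series `a_η(x)` determined by `A(x,y) = y + ∑_{η ≥ -1} a_η(x) y^(η+1)`. -/
def aCoeff (A : Ser2) (η : Letter) : PowerSeries ℂ :=
  yCoeff η.succ (A - MvPowerSeries.X 1)

/-- `B_η = y^(η+1) ∂/∂y`. -/
def opB (η : Letter) (f : Ser2) : Ser2 :=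
  MvPowerSeries.X 1 ^ η.succ * MvPowerSeries.pderiv ℂ 1 f

/-- `B_{ω₁,…,ω_r} = B_{ω_r} ⋯ B_{ω₁}` (so `B_{ω₁}` acts first), and `B_∅ = Id`. -/
def opBWord : List Letter → Ser2 → Ser2
  | [], f => f
  | η :: w, f => opBWord w (opB η f)

/-- `ω₁ + ⋯ + ω_r`. -/
def wordSum (w : List Letter) : ℤ := (w.map Subtype.val).sum

/-- The derivation `x² d/dx` of `ℂ[[x]]`. -/
def xxD (v : PowerSeries ℂ) : PowerSeries ℂ :=
  PowerSeries.X ^ 2 * PowerSeries.derivative ℂ v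

/-- The coefficients `c₀ = f₀ / μ`, `c_{k+1} = (f_{k+1} - k c_k) / μ`. -/
def solveCoeff (μ : ℂ) (f : PowerSeries ℂ) : ℕ → ℂ
  | 0 => PowerSeries.coeff 0 f / μ
  | k + 1 => (PowerSeries.coeff (k + 1) f - (k : ℂ) * solveCoeff μ f k) / μ

/-- The solution `v` without constant term of `(x² d/dx + μ) v = f`, for `f ∈ xℂ[[x]]`
(and `f ∈ x²ℂ[[x]]` if `μ = 0`); see `solve_spec` and `solve_unique`. -/
def solve (μ : ℂ) (f : PowerSeries ℂ) : PowerSeries ℂ :=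
  if μ = 0 then PowerSeries.mk fun k => if k = 0 then 0 else PowerSeries.coeff (k + 1) f / (k : ℂ)
  else PowerSeries.mk (solveCoeff μ f)

/-- The mould `𝒱^{ω₁,…,ω_r}(x)`: `𝒱^∅ = 1`, and, for non-empty words, the solution without
constant term of `(x² d/dx + ω₁ + ⋯ + ω_r) 𝒱^{ω₁,…,ω_r} = a_{ω₁} 𝒱^{ω₂,…,ω_r}`. -/
def mouldV (A : Ser2) : List Letter → PowerSeries ℂ
  | [] => 1
  | η :: w => solve ((wordSum (η :: w) : ℤ) : ℂ) (aCoeff A η * mouldV A w)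

theorem coeff_zero_xxD (v : PowerSeries ℂ) : PowerSeries.coeff 0 (xxD v) = 0 := by
  simp [xxD]

theorem coeff_succ_xxD (v : PowerSeries ℂ) (k : ℕ) :
    PowerSeries.coeff (k + 1) (xxD v) = (k : ℂ) * PowerSeries.coeff k v := by
  cases k with
  | zero => simp [xxD, PowerSeries.coeff_X_pow_mul']
  | succ k =>
    simp [xxD, PowerSeries.coeff_X_pow_mul', PowerSeries.coeff_derivative]
    ring

theorem solve_spec (μ : ℂ) (f : PowerSeries ℂ) (h0 : PowerSeries.coeff 0 f = 0)
    (h1 : μ = 0 → PowerSeries.coeff 1 f = 0) :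
    PowerSeries.coeff 0 (solve μ f) = 0 ∧
      xxD (solve μ f) + PowerSeries.C μ * solve μ f = f := by
  by_cases hμ : μ = 0
  · subst hμ
    refine ⟨by simp [solve], ?_⟩
    ext k
    rcases k with _ | k
    · simp only [map_zero, zero_mul, add_zero, coeff_zero_xxD, h0]
    · rw [map_zero, zero_mul, add_zero, coeff_succ_xxD]
      rcases k with _ | k
      · simp [h1 rfl]
      · have : ((k : ℂ) + 1) ≠ 0 := by exact_mod_cast Nat.succ_ne_zero k
        simp only [solve, if_true, PowerSeries.coeff_mk, Nat.succ_ne_zero, if_false]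
        push_cast
        field_simp
  · refine ⟨?_, ?_⟩
    · simp only [solve, hμ, if_false, PowerSeries.coeff_mk, solveCoeff, h0, zero_div]
    · ext k
      rw [map_add, PowerSeries.coeff_C_mul]
      rcases k with _ | k
      · rw [coeff_zero_xxD]
        simp only [solve, hμ, if_false, PowerSeries.coeff_mk, solveCoeff, h0, zero_div, mul_zero,
          add_zero]
      · rw [coeff_succ_xxD]
        simp only [solve, hμ, if_false, PowerSeries.coeff_mk, solveCoeff]
        field_simp
        ring

theorem solve_unique (μ : ℂ) (u v : PowerSeries ℂ) (hu : PowerSeries.coeff 0 u = 0)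
    (hv : PowerSeries.coeff 0 v = 0)
    (h : xxD u + PowerSeries.C μ * u = xxD v + PowerSeries.C μ * v) : u = v := by
  have key : ∀ k : ℕ, (k : ℂ) * PowerSeries.coeff k u + μ * PowerSeries.coeff (k + 1) u =
      (k : ℂ) * PowerSeries.coeff k v + μ * PowerSeries.coeff (k + 1) v := by
    intro k
    have := congrArg (PowerSeries.coeff (k + 1)) h
    simpa only [map_add, PowerSeries.coeff_C_mul, coeff_succ_xxD] using this
  ext k
  by_cases hμ : μ = 0
  · rcases k with _ | k
    · rw [hu, hv]
    · have hk := key (k + 1)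
      have : ((k : ℂ) + 1) ≠ 0 := by exact_mod_cast Nat.succ_ne_zero k
      rw [hμ] at hk
      push_cast at hk
      simpa [this] using hk
  · induction k with
    | zero => rw [hu, hv]
    | succ k ih =>
      have hk := key k
      rw [ih] at hk
      exact mul_left_cancel₀ hμ (add_left_cancel hk)

/-- The defining equations of the mould `𝒱`. -/
theorem mouldV_spec (A : Ser2) (hA : IsSaddleNode A) (η : Letter) (w : List Letter) :
    PowerSeries.coeff 0 (mouldV A (η :: w)) = 0 ∧
      xxD (mouldV A (η :: w)) +
          PowerSeries.C ((wordSum (η :: w) : ℤ) : ℂ) * mouldV A (η :: w) =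
        aCoeff A η * mouldV A w := by
  have ha0 : ∀ η : Letter, PowerSeries.coeff 0 (aCoeff A η) = 0 := by
    intro η
    have h := hA.at_zero η.succ
    simp only [aCoeff, yCoeff, PowerSeries.coeff_mk, map_sub, h, MvPowerSeries.coeff_X]
    by_cases hs : η.succ = 1
    · simp [hs, expo]
    · have : expo 0 η.succ ≠ Finsupp.single 1 1 := by
        intro he
        apply hs
        simpa [expo] using DFunLike.congr_fun he 1
      simp [hs, this]
  have ha1 : ∀ η : Letter, η.1 = 0 → PowerSeries.coeff 1 (aCoeff A η) = 0 := by
    intro η hη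
    have hs : η.succ = 1 := by simp [Letter.succ, hη]
    have : expo 1 1 ≠ Finsupp.single 1 1 := by
      intro he
      simpa [expo] using DFunLike.congr_fun he 0
    simp only [aCoeff, yCoeff, PowerSeries.coeff_mk, map_sub, hs, hA.mixed, MvPowerSeries.coeff_X]
    simp [this]
  induction w generalizing η with
  | nil =>
    refine solve_spec _ _ ?_ ?_
    · simpa [mouldV] using ha0 η
    · intro h
      have : η.1 = 0 := by simpa [wordSum] using h
      simpa [mouldV] using ha1 η this
  | cons ξ w ih =>
    have hV : PowerSeries.coeff 0 (mouldV A (ξ :: w)) = 0 := (ih ξ).1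
    refine solve_spec _ _ ?_ ?_
    · rw [PowerSeries.coeff_mul]
      simp [hV]
    · intro _
      rw [PowerSeries.coeff_mul]
      rw [Finset.Nat.antidiagonal_succ]
      simp [hV, ha0 η]

/-- `g` is the sum of the formally convergent series `∑ i, T i` in `ℂ[[x, y]]`: only finitely many
terms contribute to any given monomial. -/
def HasFormalSum {ι : Type} (T : ι → Ser2) (g : Ser2) : Prop :=
  ∀ d : Fin 2 →₀ ℕ, {i | MvPowerSeries.coeff d (T i) ≠ 0}.Finite ∧
    MvPowerSeries.coeff d g = ∑ᶠ i, MvPowerSeries.coeff d (T i)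

/-- `Θ f = g`, where `Θ = ∑ 𝒱^{ω₁,…,ω_r}(x) B_{ω₁,…,ω_r}`, summed over all words. -/
def IsThetaValue (A : Ser2) (f g : Ser2) : Prop :=
  HasFormalSum (fun w : List Letter => inX (mouldV A w) * opBWord w f) g

/-- The pair of components of `(x, y) ↦ (x, y + ∑ₙ cₙ(x) yⁿ)`. -/
def transf (c : ℕ → PowerSeries ℂ) : Fin 2 → Ser2 :=
  ![MvPowerSeries.X 0, MvPowerSeries.X 1 + ySeries c]

/-- The composition `θ ∘ τ` of formal transformations. -/
def compTransf (θ τ : Fin 2 → Ser2) : Fin 2 → Ser2 := fun i => MvPowerSeries.subst τ (θ i)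

/-! ### Borel transform and resurgence -/

/-- The formal Borel transform `∑ cₙ z^(-n-1) ↦ ∑ cₙ ζⁿ / n!`; series in `z⁻¹` are power series in
the variable `z⁻¹`, and a possible constant term `c` (with transform `c δ`) is ignored. -/
def borel (f : PowerSeries ℂ) : PowerSeries ℂ :=
  PowerSeries.mk fun n => PowerSeries.coeff (n + 1) f / (n.factorial : ℂ)

/-- `φ(x) ↦ φ(-1/z)`, as a series in `z⁻¹`. -/
def tilde (φ : PowerSeries ℂ) : PowerSeries ℂ := PowerSeries.rescale (-1) φ

/-- The formal Borel transform of `φ(-1/z)`. -/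
def hat (φ : PowerSeries ℂ) : PowerSeries ℂ := borel (tilde φ)

/-- `F` is an analytic continuation of the convergent series `φ ∈ ℂ{ζ}` along the path `γ`
(parametrised by `I`, issuing from `γ 0 = 0`): `F t` is a holomorphic germ at `γ t`, the germ `F 0`
has Taylor series `φ`, and for `s` close to `t` the germs `F s` and `F t` are continuations of
each other. The value at `γ t` of the continuation is `F t (γ t)`. -/
structure IsContinuation (φ : PowerSeries ℂ) (γ : ℝ → ℂ) (I : Set ℝ) (F : ℝ → ℂ → ℂ) : Prop where
  analytic : ∀ t ∈ I, AnalyticAt ℂ (F t) (γ t)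
  initial : HasFPowerSeriesAt (F 0)
    (FormalMultilinearSeries.ofScalars ℂ fun n => PowerSeries.coeff n φ) 0
  compat : ∀ t ∈ I, ∀ᶠ s in 𝓝[I] t, F s =ᶠ[𝓝 (γ s)] F t

/-- The paths that start from the origin and then avoid `ℤ`: absolutely continuous
`γ : [0,1] → ℂ \ ℤ^*` with `γ 0 = 0` and `γ⁻¹(0)` connected. -/
structure IsZPath (γ : ℝ → ℂ) : Prop where
  abs_cont : AbsolutelyContinuousOnInterval γ 0 1
  start : γ 0 = 0
  avoid : ∀ t ∈ Set.Icc (0 : ℝ) 1, ∀ m : ℤ, m ≠ 0 → γ t ≠ (m : ℂ)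
  conn : IsConnected {t ∈ Set.Icc (0 : ℝ) 1 | γ t = 0}

/-- The convergent series that have an analytic continuation along every path that starts from the
origin and then avoids `ℤ`. (Convergence is the case of the constant path.) -/
def holR : Set (PowerSeries ℂ) :=
  {φ | ∀ γ : ℝ → ℂ, IsZPath γ → ∃ F, IsContinuation φ γ (Set.Icc 0 1) F}

/-- The formal model of the algebra of resurgent functions over `ℤ`: the series
`c + ∑ cₙ z^(-n-1)` whose formal Borel transform is of the form `c δ + φ` with `φ ∈ holR`. -/
def resurgentZ : Set (PowerSeries ℂ) := {f | borel f ∈ holR}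

/-- All the branches of the analytic continuation of `φ` are regular at the integer `m`: every
branch that is defined near some point of the disc `|ζ - m| < 1` is the germ there of a function
which is holomorphic in the whole disc. -/
def BranchesRegularAt (φ : PowerSeries ℂ) (m : ℤ) : Prop :=
  ∀ γ : ℝ → ℂ, IsZPath γ → ‖γ 1 - (m : ℂ)‖ < 1 →
    ∀ F, IsContinuation φ γ (Set.Icc 0 1) F →
      ∃ g : ℂ → ℂ, DifferentiableOn ℂ g (Metric.ball (m : ℂ) 1) ∧ F 1 =ᶠ[𝓝 (γ 1)] g

/-- All the branches of the analytic continuation of `φ` have at most a simple pole at `m`. -/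
def BranchesSimplePoleAt (φ : PowerSeries ℂ) (m : ℤ) : Prop :=
  ∀ γ : ℝ → ℂ, IsZPath γ → ‖γ 1 - (m : ℂ)‖ < 1 →
    ∀ F, IsContinuation φ γ (Set.Icc 0 1) F →
      ∃ g : ℂ → ℂ, DifferentiableOn ℂ g (Metric.ball (m : ℂ) 1) ∧
        (fun ζ => (ζ - (m : ℂ)) * F 1 ζ) =ᶠ[𝓝 (γ 1)] g

/-! ### Adapted paths -/

/-- The points at distance `≥ ρ` from `P` such that the segment from the origin stays at distance
`≥ ρ` from the point `c`. -/
def region (ρ : ℝ) (c : ℂ) (P : Set ℤ) : Set ℂ :=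
  {ζ | (∀ m ∈ P, ρ ≤ ‖ζ - (m : ℂ)‖) ∧ ∀ w ∈ segment ℝ 0 ζ, ρ ≤ ‖w - c‖}

/-- The region for `P = n - ℕ^*`. -/
def regionMinus (ρ : ℝ) (N n : ℕ) : Set ℂ := region ρ (-(N : ℂ)) {m | m < (n : ℤ)}

/-- The region for `P = ℕ`. -/
def regionPlus (ρ : ℝ) (N : ℕ) : Set ℂ := region ρ (N : ℂ) {m | 0 ≤ m}

/-- Infinite arc-length parametrised paths issuing from the origin, starting by a segment of
length `ρ` and staying in `R` afterwards. -/
structure IsAdapted (ρ : ℝ) (R : Set ℂ) (γ : ℝ → ℂ) : Prop where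
  start : γ 0 = 0
  abs_cont : ∀ T : ℝ, 0 < T → AbsolutelyContinuousOnInterval γ 0 T
  unit_speed : ∀ᵐ t ∂(volume.restrict (Set.Ioi (0 : ℝ))), ‖deriv γ t‖ = 1
  initial : ∀ t : ℝ, 0 ≤ t → t ≤ ρ → ‖γ t‖ = t
  after : ∀ t : ℝ, ρ < t → γ t ∈ R

end SaddleNode

end

/-!
# Resurgence of the formal normalisation of a saddle-node

The vector field is `X = x² ∂/∂x + A ∂/∂y`, its formal normal form is `X₀ = x² ∂/∂x + y ∂/∂y`, and
`α_p` denotes the coefficient of `y ^ p` in `A - y`.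

*Formal part.* The valuation of `𝒱^ω` in `x` is at least half the length of `ω`
(`X_pow_dvd_mouldV`), so that the series `Θ (y ^ k)` converge formally. Summing the equations of the
mould gives the conjugacy `X₀ Θ = Θ X`, which is an infinite linear system for the coefficients of
the `Θ (y ^ k)` (`hasSum_thetaPow_system`). The solutions of such systems are unique
(`eq_zero_of_system`). Hence `Θ` is multiplicative (`thetaPow_mul`), without any use of the symmetry
of the mould, and it is the substitution operator of `θ` (`isThetaValue_subst`). The second
component `g = y + ∑ ψₙ yⁿ` of the inverse is the solution of `X g = g` with `g = y` at `x = 0`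
(`subst_transf_phi_of_system`).

*Analytic part.* Both `φ` and `ψ` are thus obtained from linear systems
`(x² d/dx + dₖ) Qₖ = x sₖ + ∑ⱼ x cₖⱼ Qⱼ` with convergent data and integers `dₖ`. After the Borel
transform, `x² d/dx + dₖ` becomes the multiplication by `dₖ - ζ`, and the multiplication by `-x`
becomes the integration from the origin. Analytic continuation along a path is encoded by a chain of
discs. On the Banach space `DiscChain.Fun` of the functions on the chain with a bound of exponential
type `lam` in the length travelled, the integration has norm at most `1 / lam`, and the division by
`dₖ - ζ` is bounded as long as the chain avoids `dₖ`. For large `lam` the system is therefore solved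
by a Neumann series in a weighted supremum norm (`DiscChain.exists_solution_of_system`). A resonant
equation, with `dₖ = 0`, needs some care: there the operator is `f ↦ ζ⁻¹ ∫₀^ζ f`, without a small
norm, and the hypothesis on `∂²A/∂x∂y` is used.

For `φₙ` the divisors are `dₖ = n - 1 - k`, and for `ψₙ`, `n ≥ 1`, they are `dₖ = k`. This explains
the singular points, and the constants of `exists_phi_hat` and `exists_psi_hat` give the bounds. The
series `ψ₀` is obtained from `ψ₁` by a division by `-1 - ζ`, which accounts for the simple pole. It
remains to cover the given paths by chains of discs (`IsAdapted.exists_chain`,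
`IsZPath.exists_chain`).
-/

namespace SaddleNode

open scoped PowerSeries.WithPiTopology

noncomputable section

/-! ### Valuations of the mould -/

/-- The coefficient of `y ^ p` in `A - y`. -/
def alpha (A : Ser2) (p : ℕ) : PowerSeries ℂ := yCoeff p (A - MvPowerSeries.X 1)

theorem expo_inj {m k m' k' : ℕ} : expo m k = expo m' k' ↔ m = m' ∧ k = k' := by
  constructor
  · intro h
    have h0 := DFunLike.congr_fun h 0
    have h1 := DFunLike.congr_fun h 1
    simpa [expo] using And.intro h0 h1
  · rintro ⟨rfl, rfl⟩; rfl

theorem expo_eta (d : Fin 2 →₀ ℕ) : expo (d 0) (d 1) = d := by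
  ext i; fin_cases i <;> simp [expo]

@[simp] theorem expo_apply_zero (m k : ℕ) : expo m k 0 = m := by simp [expo]

@[simp] theorem expo_apply_one (m k : ℕ) : expo m k 1 = k := by simp [expo]

theorem single_one_eq_expo : (Finsupp.single 1 1 : Fin 2 →₀ ℕ) = expo 0 1 := by
  simp [expo]

theorem coeff_alpha (A : Ser2) (p m : ℕ) :
    PowerSeries.coeff m (alpha A p) =
      MvPowerSeries.coeff (expo m p) A - if m = 0 ∧ p = 1 then 1 else 0 := by
  classical
  simp only [alpha, yCoeff, PowerSeries.coeff_mk, map_sub, MvPowerSeries.coeff_X,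
    single_one_eq_expo, expo_inj]

theorem X_dvd_alpha {A : Ser2} (hA : IsSaddleNode A) (p : ℕ) :
    (PowerSeries.X : PowerSeries ℂ) ∣ alpha A p := by
  rw [PowerSeries.X_dvd_iff, ← PowerSeries.coeff_zero_eq_constantCoeff_apply, coeff_alpha,
    hA.at_zero]
  simp

theorem X_sq_dvd_alpha_one {A : Ser2} (hA : IsSaddleNode A) :
    (PowerSeries.X : PowerSeries ℂ) ^ 2 ∣ alpha A 1 := by
  rw [PowerSeries.X_pow_dvd_iff]
  intro m hm
  interval_cases m
  · simp [coeff_alpha, hA.at_zero]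
  · simp [coeff_alpha, hA.mixed]

theorem xxD_add (u v : PowerSeries ℂ) : xxD (u + v) = xxD u + xxD v := by
  simp [xxD, mul_add]

theorem xxD_sub (u v : PowerSeries ℂ) : xxD (u - v) = xxD u - xxD v := by
  simp [xxD, mul_sub]

theorem xxD_mul (u v : PowerSeries ℂ) : xxD (u * v) = xxD u * v + u * xxD v := by
  simp only [xxD, Derivation.leibniz, smul_eq_mul]
  ring

theorem xxD_smul (c : ℂ) (u : PowerSeries ℂ) : xxD (c • u) = c • xxD u := by
  simp [xxD]

@[simp] theorem xxD_zero : xxD 0 = 0 := by simp [xxD]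

@[simp] theorem xxD_one : xxD 1 = 0 := by simp [xxD]

/-- For `μ ≠ 0`, the operator `x² d/dx + μ` preserves the valuation. -/
theorem X_pow_dvd_of_xxD_add {μ : ℂ} (hμ : μ ≠ 0) {v : PowerSeries ℂ} {k : ℕ}
    (h : PowerSeries.X ^ k ∣ xxD v + PowerSeries.C μ * v) : PowerSeries.X ^ k ∣ v := by
  rw [PowerSeries.X_pow_dvd_iff] at h ⊢
  intro m
  induction m with
  | zero =>
    intro hm
    have := h 0 hm
    rw [map_add, coeff_zero_xxD, PowerSeries.coeff_C_mul, zero_add] at this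
    exact (mul_eq_zero.mp this).resolve_left hμ
  | succ m ih =>
    intro hm
    have := h (m + 1) hm
    rw [map_add, coeff_succ_xxD, PowerSeries.coeff_C_mul, ih (by lia), mul_zero, zero_add] at this
    exact (mul_eq_zero.mp this).resolve_left hμ

/-- Inverting `x² d/dx` on series without constant term costs one unit of valuation. -/
theorem X_pow_dvd_of_xxD {v : PowerSeries ℂ} {k : ℕ} (h0 : PowerSeries.coeff 0 v = 0)
    (h : PowerSeries.X ^ (k + 1) ∣ xxD v) : PowerSeries.X ^ k ∣ v := by
  rw [PowerSeries.X_pow_dvd_iff] at h ⊢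
  intro m hm
  rcases m with _ | m
  · exact h0
  · have := h (m + 1 + 1) (by lia)
    rw [coeff_succ_xxD] at this
    exact (mul_eq_zero.mp this).resolve_left (by exact_mod_cast Nat.succ_ne_zero m)

theorem wordSum_cons (η : Letter) (w : List Letter) : wordSum (η :: w) = η.1 + wordSum w := by
  simp [wordSum]

theorem Letter.coe_succ (η : Letter) : (η.succ : ℤ) = η.1 + 1 := by
  have := η.2
  simp only [Letter.succ]
  lia

/-- The valuation of `𝒱^ω` is at least half the length of `ω`: a vanishing sum `ω₁ + ⋯ + ω_r` costs
one unit, but two vanishing suffix sums in a row force the letter `0`, whose coefficient `a₀` has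
valuation at least `2`. -/
theorem X_pow_dvd_mouldV {A : Ser2} (hA : IsSaddleNode A) (w : List Letter) :
    PowerSeries.X ^ ((w.length + 1) / 2) ∣ mouldV A w ∧
      (wordSum w ≠ 0 → PowerSeries.X ^ (w.length / 2 + 1) ∣ mouldV A w) := by
  induction w with
  | nil => simp [wordSum]
  | cons η w ih =>
    obtain ⟨h0, hV⟩ := mouldV_spec A hA η w
    have ha : (PowerSeries.X : PowerSeries ℂ) ^ 1 ∣ aCoeff A η := by
      rw [pow_one]
      exact X_dvd_alpha hA η.succ
    by_cases hσ : wordSum (η :: w) = 0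
    · refine ⟨?_, fun h => absurd hσ h⟩
      rw [hσ] at hV
      simp only [Int.cast_zero, map_zero, zero_mul, add_zero] at hV
      apply X_pow_dvd_of_xxD h0
      rw [hV]
      by_cases hη : η.1 = 0
      · have ha2 : (PowerSeries.X : PowerSeries ℂ) ^ 2 ∣ aCoeff A η := by
          have : η.succ = 1 := by simp [Letter.succ, hη]
          have := X_sq_dvd_alpha_one hA
          simpa [alpha, aCoeff, *] using this
        have := mul_dvd_mul ha2 ih.1
        rw [← pow_add] at this
        refine (pow_dvd_pow _ ?_).trans this
        simp only [List.length_cons]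
        lia
      · have hw : wordSum w ≠ 0 := by
          rw [wordSum_cons] at hσ
          lia
        have := mul_dvd_mul ha (ih.2 hw)
        rw [← pow_add] at this
        refine (pow_dvd_pow _ ?_).trans this
        simp only [List.length_cons]
        lia
    · have key : PowerSeries.X ^ ((η :: w).length / 2 + 1) ∣ mouldV A (η :: w) := by
        refine X_pow_dvd_of_xxD_add (μ := ((wordSum (η :: w) : ℤ) : ℂ)) (by exact_mod_cast hσ) ?_
        rw [hV]
        have := mul_dvd_mul ha ih.1
        rw [← pow_add] at this
        refine (pow_dvd_pow _ ?_).trans this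
        simp only [List.length_cons]
        lia
      refine ⟨(pow_dvd_pow _ ?_).trans key, fun _ => key⟩
      lia

theorem coeff_mouldV_eq_zero {A : Ser2} (hA : IsSaddleNode A) {w : List Letter} {m : ℕ}
    (h : 2 * m < w.length) : PowerSeries.coeff m (mouldV A w) = 0 :=
  PowerSeries.X_pow_dvd_iff.mp (X_pow_dvd_mouldV hA w).1 m (by lia)

/-! ### The comould -/

/-- The coefficient of `y ^ n` in `B_ω (y ^ k)`. -/
def comouldB : List Letter → ℕ → ℕ → ℂ
  | [], k, n => if k = n then 1 else 0
  | η :: w, k, n => k * comouldB w (k + η.succ - 1) n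

theorem eq_add_wordSum_of_comouldB_ne_zero {w : List Letter} {k n : ℕ}
    (h : comouldB w k n ≠ 0) : (n : ℤ) = k + wordSum w := by
  induction w generalizing k with
  | nil =>
    have : k = n := by
      by_contra hk
      simp [comouldB, hk] at h
    simp [wordSum, this]
  | cons η w ih =>
    simp only [comouldB] at h
    have hk : k ≠ 0 := by rintro rfl; simp at h
    have := ih (right_ne_zero_of_mul h)
    have h2 := η.coe_succ
    rw [wordSum_cons]
    lia

theorem coeff_opB_of_lt (η : Letter) (f : Ser2) {m j : ℕ} (h : j < η.succ) :
    MvPowerSeries.coeff (expo m j) (opB η f) = 0 := by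
  classical
  rw [opB, MvPowerSeries.X_pow_eq, MvPowerSeries.coeff_monomial_mul, if_neg]
  intro hle
  have := hle 1
  simp at this
  lia

theorem coeff_opB_add (η : Letter) (f : Ser2) (m j : ℕ) :
    MvPowerSeries.coeff (expo m (j + η.succ)) (opB η f) =
      ((j + 1 : ℕ) : ℂ) * MvPowerSeries.coeff (expo m (j + 1)) f := by
  classical
  have h : expo m (j + η.succ) = Finsupp.single 1 η.succ + expo m j := by
    ext i; fin_cases i <;> simp [add_comm]
  have h' : expo m j + Finsupp.single 1 1 = expo m (j + 1) := by
    ext i; fin_cases i <;> simp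
  rw [opB, MvPowerSeries.X_pow_eq, h, MvPowerSeries.coeff_add_monomial_mul,
    MvPowerSeries.coeff_pderiv, h']
  simp [mul_comm]

theorem hasSum_coeff_opBWord (w : List Letter) (f : Ser2) (m n : ℕ) :
    HasSum (fun k => MvPowerSeries.coeff (expo m k) f * comouldB w k n)
      (MvPowerSeries.coeff (expo m n) (opBWord w f)) := by
  induction w generalizing f with
  | nil =>
    have := hasSum_single (f := fun k => MvPowerSeries.coeff (expo m k) f * comouldB [] k n) n
      (fun k hk => by simp [comouldB, hk])
    simpa [comouldB, opBWord] using this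
  | cons η w ih =>
    have h1 := ih (opB η f)
    have hinj : Function.Injective fun j : ℕ => j + η.succ := add_left_injective _
    rw [← hinj.hasSum_iff] at h1
    · rw [← hasSum_nat_add_iff' 1]
      simp only [opBWord, Finset.range_one, Finset.sum_singleton]
      convert! h1 using 1
      · ext j
        simp only [Function.comp, coeff_opB_add, comouldB]
        rw [show j + 1 + η.succ - 1 = j + η.succ by lia]
        ring
      · simp [comouldB]
    · intro j hj
      have : j < η.succ := by
        by_contra hle
        exact hj ⟨j - η.succ, by simp; lia⟩
      rw [coeff_opB_of_lt η f this, zero_mul]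

/-! ### The series `Θ (y ^ k)` -/

theorem finite_words (L b : ℕ) : {w : List Letter | w.length ≤ L ∧ ∀ η ∈ w, η.succ ≤ b}.Finite := by
  induction L with
  | zero =>
    refine (Set.finite_singleton []).subset ?_
    rintro w ⟨hw, -⟩
    simpa using hw
  | succ L ih =>
    have hfin : {η : Letter | η.succ ≤ b}.Finite := by
      refine Set.Finite.of_finite_image (f := Letter.succ) ((Set.finite_Iic b).subset ?_) ?_
      · rintro _ ⟨η, hη, rfl⟩; exact hη
      · intro η _ ξ _ h
        have h1 := η.coe_succ
        have h2 := ξ.coe_succ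
        exact Subtype.ext (by rw [h] at h1; lia)
    refine ((hfin.image2 List.cons ih).insert []).subset ?_
    rintro (_ | ⟨η, w⟩) ⟨hw, hb⟩
    · exact Or.inl rfl
    · exact Or.inr
        ⟨η, hb η (by simp), w, ⟨by simpa using hw, fun ξ hξ => hb ξ (by simp [hξ])⟩, rfl⟩

theorem neg_length_le_wordSum (w : List Letter) : -(w.length : ℤ) ≤ wordSum w := by
  induction w with
  | nil => simp [wordSum]
  | cons η w ih =>
    have := η.2
    rw [wordSum_cons, List.length_cons]
    push_cast
    lia

theorem succ_le_of_mem (w : List Letter) : ∀ η ∈ w, (η.succ : ℤ) ≤ wordSum w + w.length := by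
  induction w with
  | nil => simp
  | cons ξ w ih =>
    intro η hη
    have h1 := neg_length_le_wordSum w
    have h2 := ξ.2
    have h3 := η.coe_succ
    rw [wordSum_cons, List.length_cons]
    push_cast
    rcases List.mem_cons.mp hη with rfl | h
    · lia
    · have := ih η h
      lia

theorem finite_words_of_wordSum (L : ℕ) (s : ℤ) :
    {w : List Letter | w.length ≤ L ∧ wordSum w ≤ s}.Finite := by
  refine (finite_words L (s + L).toNat).subset ?_
  rintro w ⟨h1, h2⟩
  refine ⟨h1, fun η hη => ?_⟩
  have := succ_le_of_mem w η hη
  lia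

/-- The coefficient of `y ^ n` in `Θ (y ^ k)`, as the sum of a series that converges formally in
`x` (see `hasSum_thetaPow`). -/
def thetaPow (A : Ser2) (k n : ℕ) : PowerSeries ℂ :=
  ∑' w : List Letter, comouldB w k n • mouldV A w

theorem hasSum_thetaPow {A : Ser2} (hA : IsSaddleNode A) (k n : ℕ) :
    HasSum (fun w : List Letter => comouldB w k n • mouldV A w) (thetaPow A k n) := by
  refine Summable.hasSum ?_
  rw [PowerSeries.WithPiTopology.summable_iff_summable_coeff]
  intro m
  refine summable_of_hasFiniteSupport ((finite_words_of_wordSum (2 * m) n).subset ?_)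
  intro w hw
  simp only [map_smul, smul_eq_mul, Function.mem_support] at hw
  refine ⟨?_, ?_⟩
  · by_contra h
    exact hw (by rw [coeff_mouldV_eq_zero hA (by lia), mul_zero])
  · have := eq_add_wordSum_of_comouldB_ne_zero (left_ne_zero_of_mul hw)
    lia

theorem hasSum_coeff_thetaPow {A : Ser2} (hA : IsSaddleNode A) (k n m : ℕ) :
    HasSum (fun w : List Letter => comouldB w k n * PowerSeries.coeff m (mouldV A w))
      (PowerSeries.coeff m (thetaPow A k n)) := by
  have := (PowerSeries.WithPiTopology.hasSum_iff_hasSum_coeff ℂ).mp (hasSum_thetaPow hA k n) m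
  simpa using this

theorem coeff_thetaPow_eq_zero {A : Ser2} (hA : IsSaddleNode A) {k n m : ℕ}
    (h : n + 2 * m < k) : PowerSeries.coeff m (thetaPow A k n) = 0 := by
  refine (hasSum_coeff_thetaPow hA k n m).unique ?_
  convert! (hasSum_zero : HasSum (fun _ : List Letter => (0 : ℂ)) 0) with w
  by_contra hw
  have h1 := eq_add_wordSum_of_comouldB_ne_zero (left_ne_zero_of_mul hw)
  have h2 := neg_length_le_wordSum w
  have h3 : ¬ 2 * m < w.length := fun h => hw (by rw [coeff_mouldV_eq_zero hA h, mul_zero])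
  lia

theorem thetaPow_zero {A : Ser2} (hA : IsSaddleNode A) (n : ℕ) :
    thetaPow A 0 n = if n = 0 then 1 else 0 := by
  refine (hasSum_thetaPow hA 0 n).unique ?_
  convert! hasSum_single (f := fun w : List Letter => comouldB w 0 n • mouldV A w) [] ?_ using 1
  · by_cases h : n = 0
    · simp [comouldB, mouldV, h]
    · simp [comouldB, h, Ne.symm h]
  · rintro (_ | ⟨η, w⟩) h
    · exact absurd rfl h
    · simp [comouldB]

theorem coeff_zero_thetaPow {A : Ser2} (hA : IsSaddleNode A) (k n : ℕ) :
    PowerSeries.coeff 0 (thetaPow A k n) = if k = n then 1 else 0 := by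
  refine (hasSum_coeff_thetaPow hA k n 0).unique ?_
  convert! hasSum_single
    (f := fun w : List Letter => comouldB w k n * PowerSeries.coeff 0 (mouldV A w)) [] ?_ using 1
  · simp [comouldB, mouldV]
  · rintro (_ | ⟨η, w⟩) h
    · exact absurd rfl h
    · simp [(mouldV_spec A hA η w).1]

theorem hasSum_xxD_add {ι : Type*} {f : ι → PowerSeries ℂ} {g : PowerSeries ℂ} (h : HasSum f g)
    (μ : ℂ) : HasSum (fun i => xxD (f i) + PowerSeries.C μ * f i)
      (xxD g + PowerSeries.C μ * g) := by
  refine HasSum.add ?_ (h.mul_left _)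
  rw [PowerSeries.WithPiTopology.hasSum_iff_hasSum_coeff] at h ⊢
  rintro (_ | k)
  · simpa only [coeff_zero_xxD] using hasSum_zero
  · simpa only [coeff_succ_xxD] using (h k).mul_left _

/-- The bijection `η ↦ η + 1` between letters and natural numbers. -/
def letterEquiv : Letter ≃ ℕ where
  toFun := Letter.succ
  invFun p := ⟨(p : ℤ) - 1, by lia⟩
  left_inv η := Subtype.ext (by have := η.coe_succ; lia)
  right_inv p := by simp [Letter.succ]

/-- The conjugacy `X₀ Θ = Θ X` on `y ^ k`, where `X₀ = x² ∂/∂x + y ∂/∂y`: it is the sum over all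
words of the equations that define the mould. -/
theorem hasSum_thetaPow_system {A : Ser2} (hA : IsSaddleNode A) (k n : ℕ) :
    HasSum (fun p : ℕ => (k : ℂ) • (alpha A p * thetaPow A (k + p - 1) n))
      (xxD (thetaPow A k n) + PowerSeries.C ((n : ℂ) - k) * thetaPow A k n) := by
  have h := hasSum_xxD_add (hasSum_thetaPow hA k n) ((n : ℂ) - k)
  let c : Letter × List Letter → List Letter := fun x => x.1 :: x.2
  have hinj : Function.Injective c := by
    rintro ⟨a, b⟩ ⟨a', b'⟩ h
    simpa [c] using h
  have hterm : ∀ (η : Letter) (w : List Letter),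
      xxD (comouldB (η :: w) k n • mouldV A (η :: w)) + PowerSeries.C ((n : ℂ) - k) *
        (comouldB (η :: w) k n • mouldV A (η :: w)) =
      (k : ℂ) • (aCoeff A η * (comouldB w (k + η.succ - 1) n • mouldV A w)) := by
    intro η w
    by_cases h0 : comouldB (η :: w) k n = 0
    · rw [h0]
      simp only [zero_smul, xxD_zero, mul_zero, add_zero]
      rw [comouldB] at h0
      rw [mul_smul_comm, smul_smul, h0, zero_smul]
    · have hs := eq_add_wordSum_of_comouldB_ne_zero h0
      have : ((n : ℂ) - k) = ((wordSum (η :: w) : ℤ) : ℂ) := by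
        have : (wordSum (η :: w)) = (n : ℤ) - k := by lia
        rw [this]; push_cast; ring
      rw [this, xxD_smul, mul_smul_comm, ← smul_add, (mouldV_spec A hA η w).2, comouldB,
        mul_smul_comm, smul_smul]
  rw [← hinj.hasSum_iff] at h
  · have h2 := h.prod_fiberwise (g := fun η : Letter =>
      (k : ℂ) • (aCoeff A η * thetaPow A (k + η.succ - 1) n)) (fun η => by
        simp only [Function.comp, c, hterm]
        exact ((hasSum_thetaPow hA (k + η.succ - 1) n).mul_left (aCoeff A η)).const_smul _)
    rw [← letterEquiv.hasSum_iff]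
    exact h2
  · rintro (_ | ⟨η, w⟩) hw
    · by_cases hk : k = n
      · simp [comouldB, hk, mouldV]
      · simp [comouldB, hk]
    · exact absurd ⟨(η, w), rfl⟩ hw

/-! ### Uniqueness for the formal systems -/

theorem dvd_smul_of_dvd {f g : PowerSeries ℂ} (h : f ∣ g) (c : ℂ) : f ∣ c • g := by
  rw [PowerSeries.smul_eq_C_mul]
  exact h.mul_left _

theorem X_pow_dvd_of_hasSum {ι : Type*} {F : ι → PowerSeries ℂ} {g : PowerSeries ℂ} {k : ℕ}
    (h : HasSum F g) (hF : ∀ i, PowerSeries.X ^ k ∣ F i) : PowerSeries.X ^ k ∣ g := by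
  rw [PowerSeries.X_pow_dvd_iff]
  intro m hm
  refine ((PowerSeries.WithPiTopology.hasSum_iff_hasSum_coeff ℂ).mp h m).unique ?_
  convert! (hasSum_zero : HasSum (fun _ : ι => (0 : ℂ)) 0) with i
  exact PowerSeries.X_pow_dvd_iff.mp (hF i) m hm

/-- Uniqueness for linear systems `(x² d/dx + dᵢ) Qᵢ = ∑ Fᵢₗ(Q)` whose right-hand sides gain one
unit of valuation, and a further one, relative to the unknowns with `dⱼ = 0`, in the resonant
equations `dᵢ = 0`. -/
theorem eq_zero_of_system {ι Λ : Type*} (d : ι → ℂ) (Q : ι → PowerSeries ℂ)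
    (F : ι → Λ → PowerSeries ℂ) (h0 : ∀ i, PowerSeries.coeff 0 (Q i) = 0)
    (hsum : ∀ i, HasSum (F i) (xxD (Q i) + PowerSeries.C (d i) * Q i))
    (h1 : ∀ m, (∀ i, PowerSeries.X ^ m ∣ Q i) → ∀ i l, PowerSeries.X ^ (m + 1) ∣ F i l)
    (h2 : ∀ m i, d i = 0 → (∀ j, PowerSeries.X ^ m ∣ Q j) →
      (∀ j, d j ≠ 0 → PowerSeries.X ^ (m + 1) ∣ Q j) → ∀ l, PowerSeries.X ^ (m + 2) ∣ F i l)
    (i : ι) : Q i = 0 := by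
  have key : ∀ m i, PowerSeries.X ^ m ∣ Q i := by
    intro m
    induction m with
    | zero => simp
    | succ m ih =>
      have hne : ∀ i, d i ≠ 0 → PowerSeries.X ^ (m + 1) ∣ Q i := fun i hi =>
        X_pow_dvd_of_xxD_add hi (X_pow_dvd_of_hasSum (hsum i) (h1 m ih i))
      intro i
      by_cases hi : d i = 0
      · have := X_pow_dvd_of_hasSum (hsum i) (h2 m i hi ih hne)
        rw [hi, map_zero, zero_mul, add_zero] at this
        exact X_pow_dvd_of_xxD (h0 i) this
      · exact hne i hi
  ext m
  exact PowerSeries.X_pow_dvd_iff.mp (key (m + 1) i) m (Nat.lt_succ_self m)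

/-! ### Multiplicativity of `Θ` -/

/-- `Θ (y ^ j) Θ (y ^ k) = Θ (y ^ (j + k))`: the difference of the two sides solves a homogeneous
system to which uniqueness applies. -/
theorem thetaPow_mul {A : Ser2} (hA : IsSaddleNode A) (j k n : ℕ) :
    ∑ a ∈ Finset.HasAntidiagonal.antidiagonal n, thetaPow A j a.1 * thetaPow A k a.2 =
      thetaPow A (j + k) n := by
  let Q : ℕ × ℕ × ℕ → PowerSeries ℂ := fun i =>
    ∑ a ∈ Finset.HasAntidiagonal.antidiagonal i.2.2, thetaPow A i.1 a.1 * thetaPow A i.2.1 a.2 -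
      thetaPow A (i.1 + i.2.1) i.2.2
  let F : ℕ × ℕ × ℕ → ℕ → PowerSeries ℂ := fun i p =>
    alpha A p * ((i.1 : ℂ) • Q (i.1 + p - 1, i.2.1, i.2.2) +
      (i.2.1 : ℂ) • Q (i.1, i.2.1 + p - 1, i.2.2))
  suffices h : ∀ i, Q i = 0 from sub_eq_zero.mp (h (j, k, n))
  refine eq_zero_of_system (fun i => (i.2.2 : ℂ) - i.1 - i.2.1) Q F ?_ ?_ ?_ ?_
  · rintro ⟨j, k, n⟩
    simp only [Q, map_sub, map_sum, PowerSeries.coeff_mul,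
      Finset.Nat.antidiagonal_zero, Finset.sum_singleton, coeff_zero_thetaPow hA]
    rw [sub_eq_zero]
    simp only [mul_ite, mul_one, mul_zero]
    by_cases hjk : j + k = n
    · rw [if_pos hjk, Finset.sum_eq_single (j, k)]
      · simp
      · rintro ⟨a, b⟩ - hab
        have : ¬ (k = b ∧ j = a) := fun h => hab (by rw [h.1, h.2])
        simp only
        split_ifs <;> tauto
      · simp [hjk]
    · rw [if_neg hjk]
      refine Finset.sum_eq_zero ?_
      rintro ⟨a, b⟩ hab
      rw [Finset.HasAntidiagonal.mem_antidiagonal] at hab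
      simp only at hab ⊢
      split_ifs <;> first | rfl | lia
  · rintro ⟨j, k, n⟩
    have h1 : ∀ a ∈ Finset.HasAntidiagonal.antidiagonal n, HasSum (fun p : ℕ =>
        (j : ℂ) • (alpha A p * thetaPow A (j + p - 1) a.1) * thetaPow A k a.2 +
          thetaPow A j a.1 * ((k : ℂ) • (alpha A p * thetaPow A (k + p - 1) a.2)))
        ((xxD (thetaPow A j a.1) + PowerSeries.C ((a.1 : ℂ) - j) * thetaPow A j a.1) *
            thetaPow A k a.2 +
          thetaPow A j a.1 * (xxD (thetaPow A k a.2) +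
            PowerSeries.C ((a.2 : ℂ) - k) * thetaPow A k a.2)) := fun a _ =>
      ((hasSum_thetaPow_system hA j a.1).mul_right _).add
        ((hasSum_thetaPow_system hA k a.2).mul_left _)
    have h2 := (hasSum_sum h1).sub (hasSum_thetaPow_system hA (j + k) n)
    convert! h2 using 1
    · ext1 p
      have e1 : (j : ℂ) • thetaPow A (j + p - 1 + k) n =
          (j : ℂ) • thetaPow A (j + k + p - 1) n := by
        rcases j with _ | j
        · simp
        · rw [show j + 1 + p - 1 + k = j + 1 + k + p - 1 by lia]
      have e2 : (k : ℂ) • thetaPow A (j + (k + p - 1)) n =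
          (k : ℂ) • thetaPow A (j + k + p - 1) n := by
        rcases k with _ | k
        · simp
        · rw [show j + (k + 1 + p - 1) = j + (k + 1) + p - 1 by lia]
      simp only [F, Q, smul_sub, e1, e2, Finset.sum_add_distrib]
      push_cast
      simp only [smul_mul_assoc, mul_smul_comm, ← Finset.smul_sum, add_smul, mul_assoc,
        ← Finset.mul_sum, mul_left_comm _ (alpha A p)]
      simp only [mul_add, mul_sub, mul_smul_comm]
      abel
    · have e : ∀ a ∈ Finset.HasAntidiagonal.antidiagonal n,
          (xxD (thetaPow A j a.1) + PowerSeries.C ((a.1 : ℂ) - j) * thetaPow A j a.1) *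
            thetaPow A k a.2 +
          thetaPow A j a.1 * (xxD (thetaPow A k a.2) +
            PowerSeries.C ((a.2 : ℂ) - k) * thetaPow A k a.2) =
          xxD (thetaPow A j a.1 * thetaPow A k a.2) +
            PowerSeries.C ((n : ℂ) - j - k) * (thetaPow A j a.1 * thetaPow A k a.2) := by
        intro a ha
        rw [Finset.HasAntidiagonal.mem_antidiagonal] at ha
        have : (n : ℂ) - j - k = ((a.1 : ℂ) - j) + ((a.2 : ℂ) - k) := by
          rw [← ha]; push_cast; ring
        rw [this, map_add, xxD_mul]
        ring
      have e3 : ∀ (s : Finset (ℕ × ℕ)) (f : ℕ × ℕ → PowerSeries ℂ),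
          ∑ a ∈ s, xxD (f a) = xxD (∑ a ∈ s, f a) := by
        intro s f
        simp only [xxD, map_sum, Finset.mul_sum]
      rw [Finset.sum_congr rfl e, Finset.sum_add_distrib, e3, ← Finset.mul_sum]
      simp only [Q, xxD_sub]
      have : (n : ℂ) - ((j + k : ℕ) : ℂ) = (n : ℂ) - j - k := by push_cast; ring
      rw [this]
      ring
  · intro m hm i p
    rw [pow_succ']
    exact mul_dvd_mul (X_dvd_alpha hA p)
      (dvd_add (dvd_smul_of_dvd (hm _) _) (dvd_smul_of_dvd (hm _) _))
  · rintro m ⟨j, k, n⟩ hd hm hm' p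
    have hn : (n : ℤ) = j + k := by
      have : ((n : ℤ) : ℂ) = ((j + k : ℤ) : ℂ) := by
        push_cast
        linear_combination hd
      exact_mod_cast this
    -- only `p = 1` couples two resonant unknowns, and `alpha A 1` has valuation at least `2`
    by_cases hp : p = 1
    · rw [add_comm, pow_add]
      subst hp
      exact mul_dvd_mul (X_sq_dvd_alpha_one hA)
        (dvd_add (dvd_smul_of_dvd (hm _) _) (dvd_smul_of_dvd (hm _) _))
    · rw [show m + 2 = (m + 1) + 1 from rfl, pow_succ']
      refine mul_dvd_mul (X_dvd_alpha hA p) (dvd_add ?_ ?_)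
      · rcases j with _ | j
        · simp
        · refine dvd_smul_of_dvd (hm' _ ?_) _
          intro h
          have : ((n : ℤ) : ℂ) = ((j + 1 + p - 1 + k : ℕ) : ℤ) := by
            push_cast at h ⊢
            linear_combination h
          have : (n : ℤ) = ((j + 1 + p - 1 + k : ℕ) : ℤ) := by exact_mod_cast this
          lia
      · rcases k with _ | k
        · simp
        · refine dvd_smul_of_dvd (hm' _ ?_) _
          intro h
          have : ((n : ℤ) : ℂ) = ((j + (k + 1 + p - 1) : ℕ) : ℤ) := by
            push_cast at h ⊢
            linear_combination h
          have : (n : ℤ) = ((j + (k + 1 + p - 1) : ℕ) : ℤ) := by exact_mod_cast this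
          lia

/-! ### The substitution operator -/

theorem coeff_expo_mul (f g : Ser2) (m n : ℕ) :
    MvPowerSeries.coeff (expo m n) (f * g) =
      ∑ a ∈ Finset.HasAntidiagonal.antidiagonal m, ∑ b ∈ Finset.HasAntidiagonal.antidiagonal n,
        MvPowerSeries.coeff (expo a.1 b.1) f * MvPowerSeries.coeff (expo a.2 b.2) g := by
  classical
  rw [MvPowerSeries.coeff_mul, ← Finset.sum_product']
  symm
  refine Finset.sum_nbij' (fun x => (expo x.1.1 x.2.1, expo x.1.2 x.2.2))
    (fun y => ((y.1 0, y.2 0), (y.1 1, y.2 1))) ?_ ?_ ?_ ?_ ?_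
  · rintro ⟨⟨a, b⟩, c, d⟩ h
    simp only [Finset.mem_product, Finset.HasAntidiagonal.mem_antidiagonal] at h ⊢
    ext i; fin_cases i <;> simp [h.1, h.2]
  · rintro ⟨u, v⟩ h
    simp only [Finset.mem_product, Finset.HasAntidiagonal.mem_antidiagonal] at h ⊢
    have h0 := DFunLike.congr_fun h 0
    have h1 := DFunLike.congr_fun h 1
    simpa using And.intro h0 h1
  · rintro ⟨⟨a, b⟩, c, d⟩ -
    simp
  · rintro ⟨u, v⟩ -
    simp only [expo_eta]
  · rintro ⟨⟨a, b⟩, c, d⟩ -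
    rfl

theorem coeff_ySeries (c : ℕ → PowerSeries ℂ) (m n : ℕ) :
    MvPowerSeries.coeff (expo m n) (ySeries c) = PowerSeries.coeff m (c n) := by
  change ySeries c (expo m n) = _
  simp [ySeries]

theorem ext_expo {f g : Ser2}
    (h : ∀ m n, MvPowerSeries.coeff (expo m n) f = MvPowerSeries.coeff (expo m n) g) : f = g := by
  ext d
  rw [← expo_eta d]
  exact h _ _

theorem ySeries_mul (c c' : ℕ → PowerSeries ℂ) :
    ySeries c * ySeries c' =
      ySeries fun n => ∑ a ∈ Finset.HasAntidiagonal.antidiagonal n, c a.1 * c' a.2 := by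
  refine ext_expo fun m n => ?_
  rw [coeff_expo_mul, coeff_ySeries, map_sum, Finset.sum_comm]
  refine Finset.sum_congr rfl fun b _ => ?_
  rw [PowerSeries.coeff_mul]
  simp only [coeff_ySeries]

theorem coeff_inX_mul (v : PowerSeries ℂ) (g : Ser2) (m n : ℕ) :
    MvPowerSeries.coeff (expo m n) (inX v * g) =
      ∑ a ∈ Finset.HasAntidiagonal.antidiagonal m,
        PowerSeries.coeff a.1 v * MvPowerSeries.coeff (expo a.2 n) g := by
  rw [coeff_expo_mul]
  refine Finset.sum_congr rfl fun a _ => ?_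
  rw [Finset.sum_eq_single (0, n)]
  · simp [inX, coeff_ySeries]
  · rintro ⟨b, c⟩ h hb
    have : b ≠ 0 := by
      rintro rfl
      simp at h
      exact hb (by rw [h])
    simp [inX, coeff_ySeries, this]
  · simp

theorem X_one_add_ySeries (c : ℕ → PowerSeries ℂ) :
    MvPowerSeries.X 1 + ySeries c = ySeries fun n => (if n = 1 then 1 else 0) + c n := by
  classical
  refine ext_expo fun m n => ?_
  rw [map_add, coeff_ySeries, coeff_ySeries, map_add, MvPowerSeries.coeff_X, single_one_eq_expo]
  congr 1
  by_cases hn : n = 1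
  · simp [hn, expo_inj, PowerSeries.coeff_one]
  · simp [hn, expo_inj]

/-- The series `φₙ`, that is, the coefficient of `y ^ n` in `Θ y - y`. -/
def phi (A : Ser2) (n : ℕ) : PowerSeries ℂ := thetaPow A 1 n - if n = 1 then 1 else 0

theorem transf_phi_one (A : Ser2) : transf (phi A) 1 = ySeries (thetaPow A 1) := by
  simp [transf, X_one_add_ySeries, phi]

theorem coeff_zero_phi {A : Ser2} (hA : IsSaddleNode A) (n : ℕ) :
    PowerSeries.constantCoeff (phi A n) = 0 := by
  rw [← PowerSeries.coeff_zero_eq_constantCoeff_apply, phi, map_sub, coeff_zero_thetaPow hA]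
  by_cases hn : n = 1
  · simp [hn]
  · simp [hn, Ne.symm hn]

theorem ySeries_thetaPow_pow {A : Ser2} (hA : IsSaddleNode A) (k : ℕ) :
    ySeries (thetaPow A 1) ^ k = ySeries (thetaPow A k) := by
  induction k with
  | zero =>
    refine ext_expo fun m n => ?_
    classical
    rw [pow_zero, coeff_ySeries, thetaPow_zero hA, MvPowerSeries.coeff_one,
      show (0 : Fin 2 →₀ ℕ) = expo 0 0 by simp [expo]]
    by_cases hn : n = 0
    · simp [hn, expo_inj, PowerSeries.coeff_one]
    · simp [hn, expo_inj]
  | succ k ih =>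
    rw [pow_succ, ih, ySeries_mul]
    congr 1
    ext1 n
    exact thetaPow_mul hA k 1 n

theorem hasSubst_transf {c : ℕ → PowerSeries ℂ}
    (hc : ∀ n, PowerSeries.constantCoeff (c n) = 0) : MvPowerSeries.HasSubst (transf c) := by
  refine MvPowerSeries.hasSubst_of_constantCoeff_zero fun i => ?_
  fin_cases i
  · simp [transf]
  · have : MvPowerSeries.constantCoeff (ySeries c) = PowerSeries.coeff 0 (c 0) := by
      rw [← MvPowerSeries.coeff_zero_eq_constantCoeff_apply,
        show (0 : Fin 2 →₀ ℕ) = expo 0 0 by simp [expo], coeff_ySeries]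
    simp [transf, this, hc]

theorem coeff_X_zero_pow_mul_ySeries (c : ℕ → PowerSeries ℂ) (i m n : ℕ) :
    MvPowerSeries.coeff (expo m n) (MvPowerSeries.X 0 ^ i * ySeries c) =
      if i ≤ m then PowerSeries.coeff (m - i) (c n) else 0 := by
  classical
  rw [MvPowerSeries.X_pow_eq, MvPowerSeries.coeff_monomial_mul]
  have : (Finsupp.single 0 i ≤ expo m n) ↔ i ≤ m := by
    rw [Finsupp.single_le_iff, expo_apply_zero]
  have h2 : expo m n - Finsupp.single 0 i = expo (m - i) n := by
    ext j; fin_cases j <;> simp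
  simp only [this, h2, coeff_ySeries, one_mul]

/-- The coefficients of `f ∘ θ`; the sum is finite because `Θ (y ^ k)` has high valuation in `x`
for large `k`. -/
theorem coeff_subst_transf {A : Ser2} (hA : IsSaddleNode A) (f : Ser2) (m n : ℕ) :
    MvPowerSeries.coeff (expo m n) (MvPowerSeries.subst (transf (phi A)) f) =
      ∑ a ∈ Finset.HasAntidiagonal.antidiagonal m, ∑ k ∈ Finset.range (n + 2 * m + 1),
        MvPowerSeries.coeff (expo a.2 k) f * PowerSeries.coeff a.1 (thetaPow A k n) := by
  classical
  rw [MvPowerSeries.coeff_subst (hasSubst_transf (coeff_zero_phi hA))]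
  have hterm : ∀ d : Fin 2 →₀ ℕ, MvPowerSeries.coeff (expo m n)
      (d.prod fun s e => transf (phi A) s ^ e) =
        if d 0 ≤ m then PowerSeries.coeff (m - d 0) (thetaPow A (d 1) n) else 0 := by
    intro d
    rw [Finsupp.prod_fintype _ _ (by simp), Fin.prod_univ_two, transf_phi_one,
      ySeries_thetaPow_pow hA, ← coeff_X_zero_pow_mul_ySeries]
    rfl
  simp only [hterm, smul_eq_mul]
  let s : Finset (Fin 2 →₀ ℕ) :=
    (Finset.HasAntidiagonal.antidiagonal m ×ˢ Finset.range (n + 2 * m + 1)).image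
      fun x => expo x.1.2 x.2
  rw [finsum_eq_sum_of_support_subset (s := s)]
  · rw [Finset.sum_image, Finset.sum_product]
    · refine Finset.sum_congr rfl fun a ha => Finset.sum_congr rfl fun k _ => ?_
      rw [Finset.HasAntidiagonal.mem_antidiagonal] at ha
      simp only [expo_apply_zero, expo_apply_one]
      rw [if_pos (by lia), show m - a.2 = a.1 by lia]
    · rintro ⟨⟨a, b⟩, k⟩ h ⟨⟨a', b'⟩, k'⟩ h' he
      simp only [Finset.coe_product, Set.mem_prod, Finset.mem_coe,
        Finset.HasAntidiagonal.mem_antidiagonal] at h h'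
      simp only [expo_inj] at he
      simp only [Prod.mk.injEq]
      lia
  · intro d hd
    rw [Function.mem_support] at hd
    have h1 : d 0 ≤ m := by
      by_contra h
      exact hd (by rw [if_neg h, mul_zero])
    rw [if_pos h1] at hd
    have h2 : d 1 ≤ n + 2 * m := by
      by_contra h
      exact hd (by rw [coeff_thetaPow_eq_zero hA (by lia), mul_zero])
    simp only [s, Finset.coe_image, Set.mem_image, Finset.mem_coe, Finset.mem_product,
      Finset.HasAntidiagonal.mem_antidiagonal, Finset.mem_range]
    exact ⟨((m - d 0, d 0), d 1), ⟨by simp only; lia, by simp only; lia⟩, expo_eta d⟩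

/-- `Θ` is the substitution operator of `θ`. -/
theorem isThetaValue_subst {A : Ser2} (hA : IsSaddleNode A) (f : Ser2) :
    IsThetaValue A f (MvPowerSeries.subst (transf (phi A)) f) := by
  intro d
  obtain ⟨m, n, rfl⟩ : ∃ m n, d = expo m n := ⟨d 0, d 1, (expo_eta d).symm⟩
  have hcoef : ∀ w : List Letter,
      MvPowerSeries.coeff (expo m n) (inX (mouldV A w) * opBWord w f) =
        ∑ a ∈ Finset.HasAntidiagonal.antidiagonal m, ∑ k ∈ Finset.range (n + 2 * m + 1),
          MvPowerSeries.coeff (expo a.2 k) f *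
            (comouldB w k n * PowerSeries.coeff a.1 (mouldV A w)) := by
    intro w
    rw [coeff_inX_mul]
    refine Finset.sum_congr rfl fun a ha => ?_
    rw [Finset.HasAntidiagonal.mem_antidiagonal] at ha
    by_cases hw : 2 * a.1 < w.length
    · simp [coeff_mouldV_eq_zero hA hw]
    · have h : MvPowerSeries.coeff (expo a.2 n) (opBWord w f) =
          ∑ k ∈ Finset.range (n + 2 * m + 1),
            MvPowerSeries.coeff (expo a.2 k) f * comouldB w k n := by
        refine (hasSum_coeff_opBWord w f a.2 n).unique (hasSum_sum_of_ne_finset_zero ?_)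
        intro k hk
        by_contra hne
        have h1 := eq_add_wordSum_of_comouldB_ne_zero (right_ne_zero_of_mul hne)
        have h2 := neg_length_le_wordSum w
        rw [Finset.mem_range] at hk
        lia
      rw [h, Finset.mul_sum]
      exact Finset.sum_congr rfl fun k _ => by ring
  have hsum : HasSum (fun w : List Letter =>
      MvPowerSeries.coeff (expo m n) (inX (mouldV A w) * opBWord w f))
      (MvPowerSeries.coeff (expo m n) (MvPowerSeries.subst (transf (phi A)) f)) := by
    simp only [hcoef, coeff_subst_transf hA]
    exact hasSum_sum fun a _ => hasSum_sum fun k _ => (hasSum_coeff_thetaPow hA k n a.1).mul_left _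
  have hfin : {w : List Letter |
      MvPowerSeries.coeff (expo m n) (inX (mouldV A w) * opBWord w f) ≠ 0}.Finite := by
    refine (finite_words_of_wordSum (2 * m) n).subset ?_
    intro w hw
    rw [Set.mem_ofPred_eq, hcoef] at hw
    obtain ⟨a, ha, h⟩ := Finset.exists_ne_zero_of_sum_ne_zero hw
    obtain ⟨k, -, h⟩ := Finset.exists_ne_zero_of_sum_ne_zero h
    have h' := right_ne_zero_of_mul h
    rw [Finset.HasAntidiagonal.mem_antidiagonal] at ha
    have h1 := eq_add_wordSum_of_comouldB_ne_zero (left_ne_zero_of_mul h')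
    have h2 : ¬ 2 * a.1 < w.length := fun h =>
      right_ne_zero_of_mul h' (coeff_mouldV_eq_zero hA h)
    constructor <;> lia
  exact ⟨hfin, by rw [← hsum.tsum_eq, tsum_eq_finsum hfin]⟩

/-- `Θ` is unitriangular for the filtration by powers of `x`, hence injective. -/
theorem subst_transf_phi_injective {A : Ser2} (hA : IsSaddleNode A) {f : Ser2}
    (hf : MvPowerSeries.subst (transf (phi A)) f = 0) : f = 0 := by
  refine ext_expo fun m => ?_
  induction m using Nat.strong_induction_on with
  | _ m ih =>
    intro n
    have h := coeff_subst_transf hA f m n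
    rw [hf, map_zero, Finset.sum_eq_single (0, m)] at h
    · simp only [coeff_zero_thetaPow hA, mul_ite, mul_one, mul_zero] at h
      rw [Finset.sum_ite_eq', if_pos (by simp)] at h
      simpa using h.symm
    · rintro ⟨a, b⟩ hab hne
      rw [Finset.HasAntidiagonal.mem_antidiagonal] at hab
      simp only at hab
      have : b < m := by
        rcases Nat.eq_zero_or_pos a with rfl | ha
        · exact absurd (by simpa using hab) (fun h : b = m => hne (by rw [h]))
        · lia
      refine Finset.sum_eq_zero fun k _ => ?_
      rw [ih b this k, map_zero, zero_mul]
    · simp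

theorem hasSum_subst_ySeries {A : Ser2} (hA : IsSaddleNode A) (G : ℕ → PowerSeries ℂ) (n : ℕ) :
    HasSum (fun k => G k * thetaPow A k n)
      (yCoeff n (MvPowerSeries.subst (transf (phi A)) (ySeries G))) := by
  rw [PowerSeries.WithPiTopology.hasSum_iff_hasSum_coeff]
  intro m
  rw [yCoeff, PowerSeries.coeff_mk, coeff_subst_transf hA, Finset.sum_comm]
  have h : ∀ k, PowerSeries.coeff m (G k * thetaPow A k n) =
      ∑ a ∈ Finset.HasAntidiagonal.antidiagonal m,
        MvPowerSeries.coeff (expo a.2 k) (ySeries G) * PowerSeries.coeff a.1 (thetaPow A k n) := by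
    intro k
    rw [mul_comm, PowerSeries.coeff_mul]
    exact Finset.sum_congr rfl fun a _ => by rw [coeff_ySeries, mul_comm]
  simp only [h]
  refine hasSum_sum_of_ne_finset_zero fun k hk => Finset.sum_eq_zero fun a ha => ?_
  rw [Finset.HasAntidiagonal.mem_antidiagonal] at ha
  rw [Finset.mem_range] at hk
  rw [coeff_thetaPow_eq_zero hA (by lia), mul_zero]

/-! ### The inverse transformation -/

/-- The system satisfied by the coefficients of `y ^ n` in the series `Θ (y ^ k)`, with the
right-hand side indexed by the unknowns. -/
theorem hasSum_thetaPow_system' {A : Ser2} (hA : IsSaddleNode A) (k n : ℕ) :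
    HasSum (fun j : ℕ => if k ≤ j + 1 then (k : ℂ) • (alpha A (j + 1 - k) * thetaPow A j n) else 0)
      (xxD (thetaPow A k n) + PowerSeries.C ((n : ℂ) - k) * thetaPow A k n) := by
  have h := hasSum_thetaPow_system hA k n
  rcases k with _ | k
  · simpa using h
  · have hinj : Function.Injective fun p : ℕ => k + p := add_right_injective k
    rw [← hinj.hasSum_iff]
    · convert! h using 2 with p
      simp only [Function.comp]
      rw [if_pos (by lia), show k + p + 1 - (k + 1) = p by lia, show k + 1 + p - 1 = k + p by lia]
    · intro j hj
      rw [if_neg]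
      intro hle
      exact hj ⟨j - k, by simp only; lia⟩

/-- If `g = ∑ₖ Gₖ yᵏ`, with `Gₖ ≡ δₖ₁` modulo `x`, satisfies `X g = g`, then `g ∘ θ = y`: by the
conjugacy, `g ∘ θ` is a solution of `X₀ h = h`, and `y` is the only one with the same restriction to
`x = 0`. -/
theorem subst_transf_phi_of_system {A : Ser2} (hA : IsSaddleNode A) (G : ℕ → PowerSeries ℂ)
    (h0 : ∀ n, PowerSeries.coeff 0 (G n) = if n = 1 then 1 else 0)
    (hG : ∀ n : ℕ, xxD (G n) + PowerSeries.C ((n : ℂ) - 1) * G n =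
      -∑ k ∈ Finset.range (n + 2), (k : ℂ) • (alpha A (n + 1 - k) * G k)) :
    MvPowerSeries.subst (transf (phi A)) (ySeries G) = MvPowerSeries.X 1 := by
  have key : ∀ n, yCoeff n (MvPowerSeries.subst (transf (phi A)) (ySeries G)) =
      if n = 1 then 1 else 0 := by
    intro n
    set H := yCoeff n (MvPowerSeries.subst (transf (phi A)) (ySeries G)) with hH
    have h1 : HasSum (fun k => G k * thetaPow A k n) H := hasSum_subst_ySeries hA G n
    -- summing this double series in both orders gives `(x² d/dx + n - 1) H = 0`
    let F : ℕ × ℕ → PowerSeries ℂ := fun x =>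
      if x.1 ≤ x.2 + 1 then (x.1 : ℂ) • (alpha A (x.2 + 1 - x.1) * thetaPow A x.2 n) * G x.1 else 0
    have hF : Summable F := by
      rw [PowerSeries.WithPiTopology.summable_iff_summable_coeff]
      intro m
      refine summable_of_hasFiniteSupport
        (((Set.finite_Iic (n + 2 * m + 1)).prod (Set.finite_Iic (n + 2 * m))).subset ?_)
      rintro ⟨k, j⟩ hx
      rw [Function.mem_support] at hx
      simp only [F] at hx
      split_ifs at hx with hkj
      · have hj : j ≤ n + 2 * m := by
          by_contra hj
          apply hx
          have hT : PowerSeries.X ^ (m + 1) ∣ thetaPow A j n := by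
            rw [PowerSeries.X_pow_dvd_iff]
            intro i hi
            exact coeff_thetaPow_eq_zero hA (by lia)
          have : PowerSeries.X ^ (m + 1) ∣
              (k : ℂ) • (alpha A (j + 1 - k) * thetaPow A j n) * G k :=
            Dvd.dvd.mul_right (dvd_smul_of_dvd (hT.mul_left _) _) _
          exact PowerSeries.X_pow_dvd_iff.mp this m (Nat.lt_succ_self m)
        simp only [Set.mem_prod, Set.mem_Iic]
        lia
      · simp at hx
    have hF1 := hF.hasSum.prod_fiberwise (g := fun k =>
        (xxD (thetaPow A k n) + PowerSeries.C ((n : ℂ) - k) * thetaPow A k n) * G k) (fun k => by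
      have := (hasSum_thetaPow_system' hA k n).mul_right (G k)
      convert! this using 2 with j
      simp only [F]
      split_ifs <;> simp)
    have hF2 := ((Equiv.prodComm ℕ ℕ).hasSum_iff.mpr hF.hasSum).prod_fiberwise
      (g := fun k => -((xxD (G k) + PowerSeries.C ((k : ℂ) - 1) * G k) * thetaPow A k n))
      (fun j => by
        rw [hG j, neg_mul, neg_neg, Finset.sum_mul]
        have : ∀ k ∈ Finset.range (j + 2), (k : ℂ) • (alpha A (j + 1 - k) * G k) * thetaPow A j n =
            (F ∘ Equiv.prodComm ℕ ℕ) (j, k) := by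
          intro k hk
          rw [Finset.mem_range] at hk
          simp only [F, Function.comp, Equiv.prodComm_apply, Prod.swap]
          rw [if_pos (by lia)]
          simp only [smul_mul_assoc]
          congr 1
          ring
        rw [Finset.sum_congr rfl this]
        refine hasSum_sum_of_ne_finset_zero fun k hk => ?_
        rw [Finset.mem_range] at hk
        simp only [F, Function.comp, Equiv.prodComm_apply, Prod.swap]
        rw [if_neg (by lia)])
    have h2 : xxD H + PowerSeries.C ((n : ℂ) - 1) * H = 0 := by
      refine (hasSum_xxD_add h1 ((n : ℂ) - 1)).unique ?_
      have := hF1.sub hF2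
      rw [sub_self] at this
      convert! this using 2 with k
      have hs : ((n : ℂ) - 1) = ((n : ℂ) - k) + ((k : ℂ) - 1) := by ring
      rw [hs, map_add, xxD_mul]
      ring
    have h3 : PowerSeries.coeff 0 H = if n = 1 then 1 else 0 := by
      have := (PowerSeries.WithPiTopology.hasSum_iff_hasSum_coeff ℂ).mp h1 0
      refine this.unique ?_
      convert! hasSum_single
        (f := fun k => PowerSeries.coeff 0 (G k * thetaPow A k n)) n ?_ using 1
      · simp [PowerSeries.coeff_mul, h0, coeff_zero_thetaPow hA]
      · intro k hk
        simp [PowerSeries.coeff_mul, coeff_zero_thetaPow hA, hk]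
    rw [← sub_eq_zero]
    refine solve_unique ((n : ℂ) - 1) _ 0 ?_ (map_zero _) ?_
    · rw [map_sub, h3]
      split_ifs <;> simp
    · rw [xxD_sub, mul_sub, xxD_zero, mul_zero, add_zero]
      have : xxD (if n = 1 then 1 else 0) = 0 ∧
          PowerSeries.C ((n : ℂ) - 1) * (if n = 1 then 1 else 0) = 0 := by
        split_ifs with hn <;> simp [hn]
      rw [this.1, this.2, sub_zero, sub_zero, h2]
  classical
  refine ext_expo fun m n => ?_
  have := congrArg (PowerSeries.coeff m) (key n)
  rw [yCoeff, PowerSeries.coeff_mk] at this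
  rw [this, MvPowerSeries.coeff_X, single_one_eq_expo]
  by_cases hn : n = 1
  · simp [hn, expo_inj, PowerSeries.coeff_one]
  · simp [hn, expo_inj]

/-- A left inverse of `θ` of the form `(x, y + ∑ ψₙ(x) yⁿ)` is a two-sided inverse, because the
substitution of `θ` is injective. -/
theorem compTransf_eq_X {A : Ser2} (hA : IsSaddleNode A) (ψ : ℕ → PowerSeries ℂ)
    (h0 : ∀ n, PowerSeries.constantCoeff (ψ n) = 0)
    (hψ : MvPowerSeries.subst (transf (phi A)) (transf ψ 1) = MvPowerSeries.X 1) :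
    compTransf (transf (phi A)) (transf ψ) = MvPowerSeries.X ∧
      compTransf (transf ψ) (transf (phi A)) = MvPowerSeries.X := by
  have hφ := hasSubst_transf (coeff_zero_phi hA)
  have hψ' := hasSubst_transf h0
  have h1 : compTransf (transf ψ) (transf (phi A)) = MvPowerSeries.X := by
    funext i
    fin_cases i
    · exact MvPowerSeries.subst_X hφ 0
    · exact hψ
  refine ⟨?_, h1⟩
  funext i
  have hcomp : MvPowerSeries.subst (transf (phi A))
      (MvPowerSeries.subst (transf ψ) (transf (phi A) i)) = transf (phi A) i := by
    rw [MvPowerSeries.subst_comp_subst_apply hψ' hφ]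
    have : (fun s => MvPowerSeries.subst (transf (phi A)) (transf ψ s)) =
        (MvPowerSeries.X : Fin 2 → Ser2) := h1
    rw [this, MvPowerSeries.subst_self]
    rfl
  have : MvPowerSeries.subst (transf (phi A))
      (MvPowerSeries.subst (transf ψ) (transf (phi A) i) - MvPowerSeries.X i) = 0 := by
    rw [← MvPowerSeries.coe_substAlgHom hφ, map_sub, MvPowerSeries.coe_substAlgHom hφ, hcomp,
      MvPowerSeries.subst_X hφ, sub_self]
  exact sub_eq_zero.mp (subst_transf_phi_injective hA this)

/-! ### Chains of discs -/

/-- A chain of discs `D₀, D₁, …` with centres `o i` and radii `r i`, starting with a disc centred at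
the origin, and a polygonal line with vertices `b i`, such that the side from `b i` to `b (i + 1)`
lies in `Dᵢ`. It serves to encode analytic continuation along a path. -/
structure DiscChain where
  /-- the centres -/
  o : ℕ → ℂ
  /-- the radii -/
  r : ℕ → ℝ
  /-- the vertices of the polygonal line -/
  b : ℕ → ℂ
  o_zero : o 0 = 0
  b_zero : b 0 = 0
  b_mem : ∀ i, b i ∈ Metric.ball (o i) (r i)
  b_succ_mem : ∀ i, b (i + 1) ∈ Metric.ball (o i) (r i)

namespace DiscChain

variable (C : DiscChain)

/-- The disc `Dᵢ`. -/
def disc (i : ℕ) : Set ℂ := Metric.ball (C.o i) (C.r i)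

/-- The length of the polygonal line up to the vertex `b i`. -/
def len : ℕ → ℝ
  | 0 => 0
  | i + 1 => len i + ‖C.b (i + 1) - C.b i‖

/-- The length of the polygonal line up to `b i`, continued by the segment from `b i` to `z`. -/
def ell (i : ℕ) (z : ℂ) : ℝ := C.len i + ‖z - C.b i‖

theorem isOpen_disc (i : ℕ) : IsOpen (C.disc i) := Metric.isOpen_ball

theorem convex_disc (i : ℕ) : Convex ℝ (C.disc i) := convex_ball _ _

theorem r_pos (i : ℕ) : 0 < C.r i := dist_nonneg.trans_lt (C.b_mem i)

theorem zero_mem_disc : (0 : ℂ) ∈ C.disc 0 := by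
  have := C.b_mem 0
  rwa [C.b_zero] at this

theorem len_nonneg (i : ℕ) : 0 ≤ C.len i := by
  induction i with
  | zero => exact le_rfl
  | succ i ih => exact add_nonneg ih (norm_nonneg _)

theorem ell_nonneg (i : ℕ) (z : ℂ) : 0 ≤ C.ell i z := add_nonneg (C.len_nonneg i) (norm_nonneg _)

theorem ell_zero (z : ℂ) : C.ell 0 z = ‖z‖ := by simp [ell, len, C.b_zero]

theorem exists_ell_le (i : ℕ) : ∃ M, ∀ z ∈ C.disc i, C.ell i z ≤ M := by
  refine ⟨C.len i + (C.r i + C.r i), fun z hz => ?_⟩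
  have h1 : ‖z - C.b i‖ ≤ dist z (C.o i) + dist (C.o i) (C.b i) := by
    rw [← dist_eq_norm]; exact dist_triangle _ _ _
  have h2 : dist z (C.o i) < C.r i := hz
  have h3 : dist (C.b i) (C.o i) < C.r i := C.b_mem i
  rw [dist_comm] at h3
  simp only [ell]
  linarith

/-- A holomorphic function on the chain: holomorphic functions on the discs which agree on the
intersections of consecutive discs. -/
structure IsHolo (f : ℕ → ℂ → ℂ) : Prop where
  diff : ∀ i, DifferentiableOn ℂ (f i) (C.disc i)
  compat : ∀ i, ∀ z ∈ C.disc i, z ∈ C.disc (i + 1) → f i z = f (i + 1) z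

variable {C}

theorem IsHolo.congr {f g : ℕ → ℂ → ℂ} (hf : C.IsHolo f) (h : ∀ i, ∀ z ∈ C.disc i, g i z = f i z) :
    C.IsHolo g where
  diff i := (hf.diff i).congr (h i)
  compat i z h1 h2 := by rw [h i z h1, h (i + 1) z h2, hf.compat i z h1 h2]

variable (C)

/-- The factor by which a function on the chain is divided in the weighted norm. -/
def weight (lam : ℝ) (i : ℕ) (z : ℂ) : ℝ := Real.exp (lam * C.ell i z)

theorem weight_pos (lam : ℝ) (i : ℕ) (z : ℂ) : 0 < C.weight lam i z := Real.exp_pos _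

/-- The holomorphic functions on the chain which are bounded by a multiple of
`exp (lam * C.ell i z)`; an element stores the quotient of the function by this weight, so that the
supremum norm of `lp` is the weighted norm. -/
def space (lam : ℝ) : Submodule ℂ (lp (fun _ : ℕ × ℂ => ℂ) ⊤) where
  carrier := {x | (∀ i, ∀ z, z ∉ C.disc i → x (i, z) = 0) ∧
    C.IsHolo fun i z => x (i, z) * (C.weight lam i z : ℂ)}
  zero_mem' := ⟨fun _ _ _ => rfl, ⟨fun i => by simp, fun _ _ _ _ => by simp⟩⟩
  add_mem' := by
    rintro x y ⟨hx, hx'⟩ ⟨hy, hy'⟩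
    refine ⟨fun i z hz => by simp [hx i z hz, hy i z hz], ?_⟩
    refine IsHolo.congr (f := fun i z => x (i, z) * (C.weight lam i z : ℂ) +
      y (i, z) * (C.weight lam i z : ℂ)) ⟨fun i => (hx'.diff i).add (hy'.diff i), ?_⟩ ?_
    · intro i z h1 h2
      simp only [hx'.compat i z h1 h2, hy'.compat i z h1 h2]
    · intro i z _
      simp [add_mul]
  smul_mem' := by
    rintro c x ⟨hx, hx'⟩
    refine ⟨fun i z hz => by simp [hx i z hz], ?_⟩
    refine IsHolo.congr (f := fun i z => c * (x (i, z) * (C.weight lam i z : ℂ)))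
      ⟨fun i => (hx'.diff i).const_mul c, ?_⟩ ?_
    · intro i z h1 h2
      simp only [hx'.compat i z h1 h2]
    · intro i z _
      simp [mul_assoc]

variable {C} {lam : ℝ}

theorem isClosed_space : IsClosed (C.space lam : Set (lp (fun _ : ℕ × ℂ => ℂ) ⊤)) := by
  refine isClosed_of_closure_subset fun x hx => ?_
  obtain ⟨u, hu, hux⟩ := mem_closure_iff_seq_limit.mp hx
  have hpt : ∀ p : ℕ × ℂ, Tendsto (fun n => u n p) atTop (𝓝 (x p)) := by
    intro p
    rw [tendsto_iff_norm_sub_tendsto_zero] at hux ⊢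
    exact squeeze_zero (fun _ => norm_nonneg _)
      (fun n => lp.norm_apply_le_norm (by simp) (u n - x) p) hux
  refine ⟨fun i z hz => ?_, ⟨fun i => ?_, fun i z h1 h2 => ?_⟩⟩
  · refine tendsto_nhds_unique (hpt (i, z)) ?_
    simp only [(hu _).1 i z hz]
    exact tendsto_const_nhds
  · have hunif : TendstoUniformlyOn (fun n z => u n (i, z) * (C.weight lam i z : ℂ))
        (fun z => x (i, z) * (C.weight lam i z : ℂ)) atTop (C.disc i) := by
      obtain ⟨M, hM⟩ := C.exists_ell_le i
      rw [Metric.tendstoUniformlyOn_iff]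
      intro ε hε
      have hux' : Tendsto (fun n => ‖u n - x‖ * Real.exp (|lam| * |M|)) atTop (𝓝 0) := by
        have := (tendsto_iff_norm_sub_tendsto_zero.mp hux).mul_const (Real.exp (|lam| * |M|))
        rwa [zero_mul] at this
      filter_upwards [hux'.eventually (gt_mem_nhds hε)] with n hn z hz
      refine lt_of_le_of_lt ?_ hn
      rw [dist_comm, dist_eq_norm, ← sub_mul, norm_mul, Complex.norm_real,
        Real.norm_of_nonneg (C.weight_pos lam i z).le]
      refine mul_le_mul (lp.norm_apply_le_norm (by simp) (u n - x) (i, z)) ?_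
        (C.weight_pos lam i z).le (norm_nonneg _)
      refine Real.exp_le_exp.mpr ?_
      calc lam * C.ell i z ≤ |lam| * C.ell i z :=
            mul_le_mul_of_nonneg_right (le_abs_self _) (C.ell_nonneg i z)
        _ ≤ |lam| * |M| :=
            mul_le_mul_of_nonneg_left ((hM z hz).trans (le_abs_self _)) (abs_nonneg _)
    exact hunif.tendstoLocallyUniformlyOn.differentiableOn
      (Eventually.of_forall fun n => (hu n).2.diff i) (C.isOpen_disc i)
  · refine tendsto_nhds_unique ((hpt (i, z)).mul_const _) ?_
    have : ∀ n, u n (i, z) * (C.weight lam i z : ℂ) =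
        u n (i + 1, z) * (C.weight lam (i + 1) z : ℂ) :=
      fun n => (hu n).2.compat i z h1 h2
    simp only [this]
    exact (hpt (i + 1, z)).mul_const _

variable (C) (lam)

/-- The Banach space of the functions in `C.space lam`, as a type of its own. -/
def Fun : Type := C.space lam

instance : NormedAddCommGroup (C.Fun lam) := inferInstanceAs (NormedAddCommGroup (C.space lam))

instance : NormedSpace ℂ (C.Fun lam) := inferInstanceAs (NormedSpace ℂ (C.space lam))

instance : CompleteSpace (C.Fun lam) := isClosed_space.completeSpace_coe

variable {C} {lam}

/-- The function on the chain represented by an element of `C.Fun lam`. -/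
def val (x : C.Fun lam) (i : ℕ) (z : ℂ) : ℂ := x.1 (i, z) * (C.weight lam i z : ℂ)

theorem isHolo_val (x : C.Fun lam) : C.IsHolo (val x) := x.2.2

theorem val_add (x y : C.Fun lam) (i : ℕ) (z : ℂ) : val (x + y) i z = val x i z + val y i z :=
  add_mul (x.1 (i, z)) (y.1 (i, z)) _

theorem val_smul (c : ℂ) (x : C.Fun lam) (i : ℕ) (z : ℂ) : val (c • x) i z = c * val x i z :=
  mul_assoc c (x.1 (i, z)) _

theorem norm_val_le (x : C.Fun lam) (i : ℕ) (z : ℂ) :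
    ‖val x i z‖ ≤ ‖x‖ * Real.exp (lam * C.ell i z) := by
  rw [val, norm_mul, Complex.norm_real, Real.norm_of_nonneg (C.weight_pos lam i z).le]
  exact mul_le_mul_of_nonneg_right (lp.norm_apply_le_norm (by simp) x.1 (i, z))
    (C.weight_pos lam i z).le

theorem space_ext {x y : C.Fun lam} (h : ∀ i, ∀ z ∈ C.disc i, val x i z = val y i z) :
    x = y := by
  apply Subtype.ext
  apply lp.ext
  funext ⟨i, z⟩
  by_cases hz : z ∈ C.disc i
  · have := h i z hz
    simp only [val] at this
    exact mul_right_cancel₀ (by exact_mod_cast (C.weight_pos lam i z).ne') this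
  · rw [x.2.1 i z hz, y.2.1 i z hz]

theorem exists_mem_space {f : ℕ → ℂ → ℂ} (hf : C.IsHolo f) {B : ℝ} (hB : 0 ≤ B)
    (hfB : ∀ i, ∀ z ∈ C.disc i, ‖f i z‖ ≤ B * Real.exp (lam * C.ell i z)) :
    ∃ x : C.Fun lam, (∀ i, ∀ z ∈ C.disc i, val x i z = f i z) ∧ ‖x‖ ≤ B := by
  classical
  let u : ℕ × ℂ → ℂ := fun p =>
    if p.2 ∈ C.disc p.1 then f p.1 p.2 / (C.weight lam p.1 p.2 : ℂ) else 0
  have hu : ∀ p, ‖u p‖ ≤ B := by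
    rintro ⟨i, z⟩
    simp only [u]
    split_ifs with h
    · rw [norm_div, Complex.norm_real, Real.norm_of_nonneg (C.weight_pos lam i z).le,
        div_le_iff₀ (C.weight_pos lam i z)]
      exact hfB i z h
    · simpa using hB
  have hmem : Memℓp u ⊤ := memℓp_infty ⟨B, by rintro _ ⟨p, rfl⟩; exact hu p⟩
  have hval : ∀ i, ∀ z ∈ C.disc i, u (i, z) * (C.weight lam i z : ℂ) = f i z := by
    intro i z h
    simp only [u, if_pos h]
    exact div_mul_cancel₀ _ (by exact_mod_cast (C.weight_pos lam i z).ne')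
  refine ⟨⟨⟨u, hmem⟩, fun i z h => if_neg h, hf.congr hval⟩, hval, ?_⟩
  exact lp.norm_le_of_forall_le hB hu

theorem norm_le_of_val {x : C.Fun lam} {B : ℝ} (hB : 0 ≤ B)
    (h : ∀ i, ∀ z ∈ C.disc i, ‖val x i z‖ ≤ B * Real.exp (lam * C.ell i z)) : ‖x‖ ≤ B := by
  obtain ⟨y, hy, hyB⟩ := exists_mem_space (isHolo_val x) hB h
  rwa [space_ext hy] at hyB


/-! ### Operators on the space of a chain -/

/-- A bounded operator is determined by a linear relation which is uniquely solvable with a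
bound. -/
theorem exists_clm {R : C.Fun lam → C.Fun lam → Prop} {c : ℝ} (hc : 0 ≤ c)
    (hex : ∀ x, ∃ y, R x y ∧ ‖y‖ ≤ c * ‖x‖) (huniq : ∀ x y y', R x y → R x y' → y = y')
    (hadd : ∀ x y x' y', R x y → R x' y' → R (x + x') (y + y'))
    (hsmul : ∀ (a : ℂ) x y, R x y → R (a • x) (a • y)) :
    ∃ T : C.Fun lam →L[ℂ] C.Fun lam, (∀ x, R x (T x)) ∧ ‖T‖ ≤ c := by
  choose t ht htc using hex
  let T₀ : C.Fun lam →ₗ[ℂ] C.Fun lam :=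
    { toFun := t
      map_add' := fun x y => huniq _ _ _ (ht _) (hadd _ _ _ _ (ht x) (ht y))
      map_smul' := fun a x => huniq _ _ _ (ht _) (hsmul a _ _ (ht x)) }
  exact ⟨T₀.mkContinuous c htc, ht, T₀.mkContinuous_norm_le hc htc⟩

/-- The growth of a primitive along a segment, for an integrand of exponential growth. -/
theorem norm_primitive_le {f g : ℂ → ℂ} {U : Set ℂ} (hU : Convex ℝ U)
    (hg : ∀ z ∈ U, HasDerivAt g (f z) z) {p z : ℂ} (hp : p ∈ U) (hz : z ∈ U) {B L : ℝ}
    (hlam : 0 < lam) (hgp : ‖g p‖ ≤ B / lam * (Real.exp (lam * L) - 1))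
    (hf : ∀ w ∈ U, ‖f w‖ ≤ B * Real.exp (lam * (L + ‖w - p‖))) :
    ‖g z‖ ≤ B / lam * (Real.exp (lam * (L + ‖z - p‖)) - 1) := by
  let l : ℝ → ℂ := fun t => p + t * (z - p)
  have hl : ∀ t ∈ Set.Icc (0 : ℝ) 1, l t ∈ U := by
    intro t ht
    have := hU.add_smul_sub_mem hp hz ht
    simpa [l] using this
  have hld : ∀ t : ℝ, HasDerivAt l (z - p) t := by
    intro t
    have := ((Complex.ofRealCLM.hasDerivAt (x := t)).mul_const (z - p)).const_add p
    simpa [l] using this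
  have hgl : ∀ t ∈ Set.Icc (0 : ℝ) 1,
      HasDerivAt (fun t => g (l t)) (f (l t) * (z - p)) t := fun t ht =>
    (hg _ (hl t ht)).comp t (hld t)
  have hB : ∀ t : ℝ, HasDerivAt (fun t : ℝ => B / lam * (Real.exp (lam * (L + t * ‖z - p‖)) - 1))
      (B * Real.exp (lam * (L + t * ‖z - p‖)) * ‖z - p‖) t := by
    intro t
    have h1 : HasDerivAt (fun t : ℝ => lam * (L + t * ‖z - p‖)) (lam * ‖z - p‖) t := by
      have := (((hasDerivAt_id t).mul_const ‖z - p‖).const_add L).const_mul lam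
      simpa using this
    exact ((h1.exp.sub_const 1).const_mul (B / lam)).congr_deriv (by field_simp)
  have := image_norm_le_of_norm_deriv_right_le_deriv_boundary (a := 0) (b := 1)
    (f := fun t => g (l t)) (f' := fun t => f (l t) * (z - p))
    (fun t ht => (hgl t ht).continuousAt.continuousWithinAt)
    (fun t ht => (hgl t ⟨ht.1, ht.2.le⟩).hasDerivWithinAt) (by simpa [l] using hgp) hB
    (fun t ht => by
      rw [norm_mul]
      refine mul_le_mul_of_nonneg_right ?_ (norm_nonneg _)
      have := hf _ (hl t ⟨ht.1, ht.2.le⟩)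
      simpa [l, norm_mul, abs_of_nonneg ht.1] using this)
    (Set.right_mem_Icc.mpr zero_le_one)
  simpa [l] using this

theorem exists_primitive (hlam : 0 < lam) (x : C.Fun lam) :
    ∃ y : C.Fun lam, (val y 0 0 = 0 ∧
      ∀ i, ∀ z ∈ C.disc i, HasDerivAt (val y i) (val x i z) z) ∧
      (∀ i, ∀ z ∈ C.disc i, ‖val y i z‖ ≤ ‖x‖ / lam * (Real.exp (lam * C.ell i z) - 1)) := by
  have hx := isHolo_val x
  choose G hG using fun i => (hx.diff i).isExactOn_ball
  -- the constants of integration, which make the primitives agree at the vertices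
  let k : ℕ → ℂ := fun i => Nat.rec (-G 0 0) (fun i ki => G i (C.b (i + 1)) + ki -
    G (i + 1) (C.b (i + 1))) i
  let g : ℕ → ℂ → ℂ := fun i z => G i z + k i
  have hg : ∀ i, ∀ z ∈ C.disc i, HasDerivAt (g i) (val x i z) z := fun i z hz =>
    (hG i z hz).add_const _
  have hg0 : g 0 0 = 0 := by simp [g, k]
  have hgb : ∀ i, g (i + 1) (C.b (i + 1)) = g i (C.b (i + 1)) := by
    intro i
    simp only [g, k]
    ring
  have hdiff : ∀ i, DifferentiableOn ℂ (g i) (C.disc i) := fun i z hz =>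
    (hg i z hz).differentiableAt.differentiableWithinAt
  have hholo : C.IsHolo g := by
    refine ⟨hdiff, fun i z h1 h2 => ?_⟩
    have hU : Convex ℝ (C.disc i ∩ C.disc (i + 1)) := (C.convex_disc i).inter (C.convex_disc _)
    refine ((C.isOpen_disc i).inter (C.isOpen_disc (i + 1))).eqOn_of_deriv_eq
      hU.isPreconnected ((hdiff i).mono Set.inter_subset_left)
      ((hdiff (i + 1)).mono Set.inter_subset_right) ?_
      (⟨C.b_succ_mem i, C.b_mem (i + 1)⟩ : C.b (i + 1) ∈ C.disc i ∩ C.disc (i + 1)) (hgb i).symm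
      ⟨h1, h2⟩
    rintro w ⟨hw1, hw2⟩
    rw [(hg i w hw1).deriv, (hg (i + 1) w hw2).deriv, hx.compat i w hw1 hw2]
  have hbound : ∀ i, ∀ z ∈ C.disc i,
      ‖g i z‖ ≤ ‖x‖ / lam * (Real.exp (lam * C.ell i z) - 1) := by
    intro i
    have step : ∀ i, ‖g i (C.b i)‖ ≤ ‖x‖ / lam * (Real.exp (lam * C.len i) - 1) →
        ∀ z ∈ C.disc i, ‖g i z‖ ≤ ‖x‖ / lam * (Real.exp (lam * C.ell i z) - 1) :=
      fun i hi z hz => norm_primitive_le (C.convex_disc i) (hg i) (C.b_mem i) hz hlam hi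
        fun w _ => norm_val_le x i w
    induction i with
    | zero => exact step 0 (by simp [C.b_zero, hg0, len])
    | succ i ih =>
      refine step (i + 1) ?_
      rw [hgb]
      exact ih _ (C.b_succ_mem i)
  obtain ⟨y, hy, -⟩ := exists_mem_space (lam := lam) hholo (B := ‖x‖ / lam) (by positivity)
    (fun i z hz => (hbound i z hz).trans (by
      refine mul_le_mul_of_nonneg_left ?_ (by positivity)
      linarith))
  refine ⟨y, ⟨by rw [hy 0 0 C.zero_mem_disc, hg0], fun i z hz => ?_⟩, fun i z hz => ?_⟩
  · exact (hg i z hz).congr_of_eventuallyEq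
      (eventually_of_mem ((C.isOpen_disc i).mem_nhds hz) (hy i))
  · rw [hy i z hz]
    exact hbound i z hz

theorem primitive_unique {x y y' : C.Fun lam}
    (h : val y 0 0 = 0 ∧ ∀ i, ∀ z ∈ C.disc i, HasDerivAt (val y i) (val x i z) z)
    (h' : val y' 0 0 = 0 ∧ ∀ i, ∀ z ∈ C.disc i, HasDerivAt (val y' i) (val x i z) z) :
    y = y' := by
  have hy := isHolo_val y
  have hy' := isHolo_val y'
  refine space_ext fun i => ?_
  have step : ∀ i, ∀ p ∈ C.disc i, val y i p = val y' i p →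
      ∀ z ∈ C.disc i, val y i z = val y' i z := by
    intro i p hp hpe z hz
    refine (C.isOpen_disc i).eqOn_of_deriv_eq (C.convex_disc i).isPreconnected (hy.diff i)
      (hy'.diff i) ?_ hp hpe hz
    intro w hw
    rw [(h.2 i w hw).deriv, (h'.2 i w hw).deriv]
  induction i with
  | zero => exact step 0 0 C.zero_mem_disc (by rw [h.1, h'.1])
  | succ i ih =>
    refine step (i + 1) _ (C.b_mem (i + 1)) ?_
    rw [← hy.compat i _ (C.b_succ_mem i) (C.b_mem _), ← hy'.compat i _ (C.b_succ_mem i) (C.b_mem _)]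
    exact ih _ (C.b_succ_mem i)

/-- Integration from the origin along the chain, which is the Borel counterpart of the
multiplication by `-x`; its norm is at most `1 / lam`. -/
theorem exists_integration (hlam : 0 < lam) : ∃ J : C.Fun lam →L[ℂ] C.Fun lam,
    (∀ x, val (J x) 0 0 = 0 ∧ ∀ i, ∀ z ∈ C.disc i, HasDerivAt (val (J x) i) (val x i z) z) ∧
    ‖J‖ ≤ 1 / lam := by
  refine exists_clm (R := fun x y => val y 0 0 = 0 ∧
    ∀ i, ∀ z ∈ C.disc i, HasDerivAt (val y i) (val x i z) z) (by positivity) ?_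
    (fun x y y' h h' => primitive_unique h h') ?_ ?_
  · intro x
    obtain ⟨y, hy, hb⟩ := exists_primitive hlam x
    refine ⟨y, hy, norm_le_of_val (by positivity) fun i z hz => (hb i z hz).trans ?_⟩
    rw [one_div_mul_eq_div]
    refine mul_le_mul_of_nonneg_left ?_ (by positivity)
    linarith
  · intro x y x' y' h h'
    refine ⟨by rw [val_add, h.1, h'.1, add_zero], fun i z hz => ?_⟩
    rw [val_add, show val (y + y') i = val y i + val y' i from funext fun z => val_add y y' i z]
    exact (h.2 i z hz).add (h'.2 i z hz)
  · intro a x y h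
    refine ⟨by rw [val_smul, h.1, mul_zero], fun i z hz => ?_⟩
    rw [val_smul, show val (a • y) i = fun z => a * val y i z from funext fun z => val_smul a y i z]
    exact (h.2 i z hz).const_mul a

/-- Integration from the origin along the chain, with the value `0` at the origin. -/
def integ (hlam : 0 < lam) : C.Fun lam →L[ℂ] C.Fun lam := (exists_integration hlam).choose

theorem val_integ_zero (hlam : 0 < lam) (x : C.Fun lam) : val (integ hlam x) 0 0 = 0 :=
  ((exists_integration hlam).choose_spec.1 x).1

theorem hasDerivAt_integ (hlam : 0 < lam) (x : C.Fun lam) {i : ℕ} {z : ℂ} (hz : z ∈ C.disc i) :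
    HasDerivAt (val (integ hlam x) i) (val x i z) z :=
  ((exists_integration hlam).choose_spec.1 x).2 i z hz

theorem norm_integ_le (hlam : 0 < lam) : ‖(integ hlam : C.Fun lam →L[ℂ] C.Fun lam)‖ ≤ 1 / lam :=
  (exists_integration hlam).choose_spec.2

theorem norm_val_integ_le (hlam : 0 < lam) (x : C.Fun lam) {i : ℕ} {z : ℂ} (hz : z ∈ C.disc i) :
    ‖val (integ hlam x) i z‖ ≤ ‖x‖ / lam * (Real.exp (lam * C.ell i z) - 1) := by
  obtain ⟨y, hy, hb⟩ := exists_primitive hlam x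
  have : integ hlam x = y := primitive_unique ((exists_integration hlam).choose_spec.1 x) hy
  rw [this]
  exact hb i z hz

/-- Division by `d - ζ`. -/
theorem exists_divSub (d : ℂ) {δ : ℝ} (hδ : 0 < δ) (hd : ∀ i, ∀ z ∈ C.disc i, δ ≤ ‖d - z‖) :
    ∃ M : C.Fun lam →L[ℂ] C.Fun lam,
      (∀ x, ∀ i, ∀ z ∈ C.disc i, (d - z) * val (M x) i z = val x i z) ∧ ‖M‖ ≤ 1 / δ := by
  have hne : ∀ i, ∀ z ∈ C.disc i, d - z ≠ 0 := fun i z hz h => by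
    have := hd i z hz
    rw [h, norm_zero] at this
    linarith
  refine exists_clm (R := fun x y => ∀ i, ∀ z ∈ C.disc i, (d - z) * val y i z = val x i z)
    (by positivity) ?_ ?_ ?_ ?_
  · intro x
    have hx := isHolo_val x
    obtain ⟨y, hy, hyb⟩ := exists_mem_space (C := C) (lam := lam)
      (f := fun i z => val x i z / (d - z)) (B := 1 / δ * ‖x‖)
      ⟨fun i => (hx.diff i).div (by fun_prop) (hne i), fun i z h1 h2 => by
        simp only [hx.compat i z h1 h2]⟩ (by positivity) (fun i z hz => by
        rw [norm_div, div_le_iff₀ (hδ.trans_le (hd i z hz))]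
        refine (norm_val_le x i z).trans ?_
        have h1 := hd i z hz
        have h2 : 1 ≤ 1 / δ * ‖d - z‖ := by rw [one_div_mul_eq_div, le_div_iff₀ hδ]; linarith
        calc ‖x‖ * Real.exp (lam * C.ell i z) = 1 * (‖x‖ * Real.exp (lam * C.ell i z)) := by ring
          _ ≤ (1 / δ * ‖d - z‖) * (‖x‖ * Real.exp (lam * C.ell i z)) :=
              mul_le_mul_of_nonneg_right h2 (by positivity)
          _ = _ := by ring)
    exact ⟨y, fun i z hz => by rw [hy i z hz, mul_div_cancel₀ _ (hne i z hz)], hyb⟩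
  · intro x y y' h h'
    exact space_ext fun i z hz => mul_left_cancel₀ (hne i z hz) (by rw [h i z hz, h' i z hz])
  · intro x y x' y' h h' i z hz
    rw [val_add, val_add, mul_add, h i z hz, h' i z hz]
  · intro a x y h i z hz
    rw [val_smul, val_smul, ← h i z hz]
    ring

/-- The operator `f ↦ ζ⁻¹ ∫₀^ζ f`. On the first disc the factor `ζ⁻¹` absorbs the integration, and
the norm of the operator does not tend to `0` as `lam` grows. -/
theorem exists_average (hlam : 0 < lam) {c : ℝ} (hc : 0 < c) (hcl : 1 / c ≤ lam)
    (hd : ∀ i, ∀ z ∈ C.disc (i + 1), c ≤ ‖z‖) :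
    ∃ E : C.Fun lam →L[ℂ] C.Fun lam,
      (∀ x, ∀ i, ∀ z ∈ C.disc i, z * val (E x) i z = val (integ hlam x) i z) ∧ ‖E‖ ≤ 1 := by
  suffices h : ∃ E : C.Fun lam →L[ℂ] C.Fun lam,
      (∀ x, ∀ i, ∀ z ∈ C.disc i, z * val (E x) i z = val (integ hlam x) i z ∧
        (z = 0 → val (E x) i z = val x i z)) ∧ ‖E‖ ≤ 1 by
    obtain ⟨E, h1, h2⟩ := h
    exact ⟨E, fun x i z hz => (h1 x i z hz).1, h2⟩
  refine exists_clm (R := fun x y => ∀ i, ∀ z ∈ C.disc i, z * val y i z = val (integ hlam x) i z ∧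
        (z = 0 → val y i z = val x i z)) zero_le_one ?_ ?_ ?_ ?_
  · intro x
    set h := val (integ hlam x) with hh
    have hholo : C.IsHolo h := isHolo_val _
    have hne : ∀ i, ∀ z ∈ C.disc (i + 1), z ≠ 0 := fun i z hz h0 => by
      have := hd i z hz
      rw [h0, norm_zero] at this
      linarith
    have hds : ∀ z : ℂ, dslope (h 0) 0 z = if z = 0 then val x 0 0 else h 0 z / z := by
      intro z
      split_ifs with hz
      · rw [hz, dslope_same, (hasDerivAt_integ hlam x C.zero_mem_disc).deriv]
      · rw [dslope_of_ne _ hz, slope_def_field, show h 0 0 = 0 from val_integ_zero hlam x]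
        simp
    let F : ℕ → ℂ → ℂ := fun i z => if z = 0 then val x i z else h i z / z
    have hF : C.IsHolo F := by
      refine ⟨?_, ?_⟩
      · rintro (_ | i)
        · have := (Complex.differentiableOn_dslope
            ((C.isOpen_disc 0).mem_nhds C.zero_mem_disc)).mpr (hholo.diff 0)
          refine this.congr fun z _ => ?_
          rw [hds]
          by_cases h0 : z = 0 <;> simp [F, h0]
        · refine ((hholo.diff (i + 1)).div differentiableOn_id (hne i)).congr fun z hz => ?_
          simp [F, hne i z hz]
      · intro i z h1 h2
        simp only [F, if_neg (hne i z h2), hholo.compat i z h1 h2]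
    have hFb : ∀ i, ∀ z ∈ C.disc i, ‖F i z‖ ≤ ‖x‖ * Real.exp (lam * C.ell i z) := by
      intro i z hz
      have hb := norm_val_integ_le hlam x hz
      have hx : ‖x‖ / lam * (Real.exp (lam * C.ell i z) - 1) ≤
          ‖x‖ / lam * Real.exp (lam * C.ell i z) :=
        mul_le_mul_of_nonneg_left (by linarith) (by positivity)
      rcases i with _ | i
      · by_cases h0 : z = 0
        · simp only [F, if_pos h0]
          exact norm_val_le x 0 z
        · simp only [F, if_neg h0]
          rw [norm_div, div_le_iff₀ (norm_pos_iff.mpr h0)]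
          refine hb.trans ?_
          rw [C.ell_zero]
          have : Real.exp (lam * ‖z‖) - 1 ≤ lam * ‖z‖ * Real.exp (lam * ‖z‖) := by
            have h1 := Real.add_one_le_exp (-(lam * ‖z‖))
            have h2 : Real.exp (-(lam * ‖z‖)) * Real.exp (lam * ‖z‖) = 1 := by
              rw [← Real.exp_add]; simp
            nlinarith [Real.exp_pos (lam * ‖z‖)]
          calc ‖x‖ / lam * (Real.exp (lam * ‖z‖) - 1) ≤
              ‖x‖ / lam * (lam * ‖z‖ * Real.exp (lam * ‖z‖)) :=
                mul_le_mul_of_nonneg_left this (by positivity)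
            _ = _ := by field_simp
      · simp only [F, if_neg (hne i z hz)]
        rw [norm_div, div_le_iff₀ (norm_pos_iff.mpr (hne i z hz))]
        refine (hb.trans hx).trans ?_
        have h1 : 1 ≤ lam * ‖z‖ := by
          have := hd i z hz
          calc 1 = 1 / c * c := by field_simp
            _ ≤ lam * ‖z‖ := mul_le_mul hcl this hc.le hlam.le
        rw [div_mul_eq_mul_div, div_le_iff₀ hlam]
        have : 0 ≤ ‖x‖ * Real.exp (lam * C.ell (i + 1) z) := by positivity
        nlinarith
    obtain ⟨y, hy, hyb⟩ := exists_mem_space hF (norm_nonneg x) hFb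
    refine ⟨y, fun i z hz => ?_, by rwa [one_mul]⟩
    rw [hy i z hz]
    refine ⟨?_, fun h0 => if_pos h0⟩
    simp only [F]
    split_ifs with h0
    · rcases i with _ | i
      · rw [h0, hh, val_integ_zero, zero_mul]
      · exact absurd h0 (hne i z hz)
    · exact mul_div_cancel₀ _ h0
  · intro x y y' h h'
    refine space_ext fun i z hz => ?_
    by_cases h0 : z = 0
    · rw [(h i z hz).2 h0, (h' i z hz).2 h0]
    · exact mul_left_cancel₀ h0 (by rw [(h i z hz).1, (h' i z hz).1])
  · intro x y x' y' h h' i z hz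
    rw [map_add, val_add, val_add, val_add, mul_add, (h i z hz).1, (h' i z hz).1]
    exact ⟨rfl, fun h0 => by rw [(h i z hz).2 h0, (h' i z hz).2 h0]⟩
  · intro a x y h i z hz
    rw [map_smul, val_smul, val_smul, val_smul, ← (h i z hz).1]
    exact ⟨by ring, fun h0 => by rw [(h i z hz).2 h0]⟩

/-! ### The inverse Borel transform of the germ at the origin -/

theorem analyticAt_val (x : C.Fun lam) {i : ℕ} {z : ℂ} (hz : z ∈ C.disc i) :
    AnalyticAt ℂ (val x i) z :=
  ((isHolo_val x).diff i).analyticAt ((C.isOpen_disc i).mem_nhds hz)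

theorem contDiffAt_val (x : C.Fun lam) (n : ℕ) : ContDiffAt ℂ n (val x 0) 0 :=
  (analyticAt_val x C.zero_mem_disc).contDiffAt

/-- The series `v(x)`, without constant term, such that the Borel transform of `v(-1/z)` is the
Taylor series at the origin of a function on the chain. -/
def unborel : C.Fun lam →ₗ[ℂ] PowerSeries ℂ where
  toFun x := PowerSeries.mk fun n =>
    if n = 0 then 0 else (-1) ^ n * iteratedDeriv (n - 1) (val x 0) 0
  map_add' x y := by
    ext n
    simp only [PowerSeries.coeff_mk, map_add]
    split_ifs
    · simp
    · rw [show val (x + y) 0 = val x 0 + val y 0 from funext fun z => val_add x y 0 z,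
        iteratedDeriv_add (contDiffAt_val x _) (contDiffAt_val y _)]
      ring
  map_smul' c x := by
    ext n
    simp only [PowerSeries.coeff_mk, RingHom.id_apply, map_smul, smul_eq_mul]
    split_ifs
    · simp
    · rw [show val (c • x) 0 = fun z => c * val x 0 z from funext fun z => val_smul c x 0 z,
        iteratedDeriv_const_mul c (contDiffAt_val x _)]
      ring

@[simp] theorem coeff_zero_unborel (x : C.Fun lam) : PowerSeries.coeff 0 (unborel x) = 0 := by
  simp [unborel]

theorem coeff_succ_unborel (x : C.Fun lam) (n : ℕ) : PowerSeries.coeff (n + 1) (unborel x) =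
    (-1) ^ (n + 1) * iteratedDeriv n (val x 0) 0 := by
  simp [unborel]

theorem norm_coeff_unborel_le (C : DiscChain) (lam : ℝ) (n : ℕ) :
    ∃ K, ∀ x : C.Fun lam, ‖PowerSeries.coeff n (unborel x)‖ ≤ K * ‖x‖ := by
  rcases n with _ | n
  · exact ⟨0, fun x => by simp⟩
  · have hr : 0 < C.r 0 / 2 := half_pos (C.r_pos 0)
    have hsub : Metric.closedBall (0 : ℂ) (C.r 0 / 2) ⊆ C.disc 0 := by
      rw [disc, C.o_zero]
      exact Metric.closedBall_subset_ball (half_lt_self (C.r_pos 0))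
    refine ⟨n.factorial * Real.exp (lam * (C.r 0 / 2)) / (C.r 0 / 2) ^ n, fun x => ?_⟩
    have := Complex.norm_iteratedDeriv_le_of_forall_mem_sphere_norm_le (c := 0) (f := val x 0)
      (C := ‖x‖ * Real.exp (lam * (C.r 0 / 2))) n hr
      (((isHolo_val x).diff 0).mono (closure_ball (0 : ℂ) hr.ne' ▸ hsub)).diffContOnCl
      (fun z hz => by
        have h := norm_val_le x 0 z
        rw [C.ell_zero] at h
        rw [mem_sphere_zero_iff_norm] at hz
        rwa [hz] at h)
    rw [coeff_succ_unborel, norm_mul, norm_pow, norm_neg, norm_one, one_pow, one_mul]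
    refine this.trans (le_of_eq ?_)
    ring

theorem hasSum_unborel {ι : Type*} {f : ι → C.Fun lam} {a : C.Fun lam} (h : HasSum f a) :
    HasSum (fun i => unborel (f i)) (unborel a) := by
  rw [PowerSeries.WithPiTopology.hasSum_iff_hasSum_coeff]
  intro n
  obtain ⟨K, hK⟩ := norm_coeff_unborel_le C lam n
  exact h.mapL (((PowerSeries.coeff n).comp unborel).mkContinuous K hK)

theorem iteratedDeriv_id_mul {g : ℂ → ℂ} (hg : AnalyticAt ℂ g 0) (n : ℕ) :
    iteratedDeriv n (fun z => z * g z) 0 = n * iteratedDeriv (n - 1) g 0 := by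
  rw [iteratedDeriv_fun_mul (f := fun z => z) contDiffAt_id hg.contDiffAt]
  simp only [iteratedDeriv_fun_id_zero]
  rcases n with _ | n
  · simp
  · rw [Finset.sum_eq_single 1]
    · simp
    · intro b _ hb
      simp [hb]
    · simp

theorem unborel_integ (hlam : 0 < lam) (x : C.Fun lam) :
    unborel (integ hlam x) = -PowerSeries.X * unborel x := by
  ext n
  rcases n with _ | n
  · simp
  rw [neg_mul, map_neg, PowerSeries.coeff_succ_X_mul, coeff_succ_unborel]
  rcases n with _ | n
  · simp [val_integ_zero]
  · have h : deriv (val (integ hlam x) 0) =ᶠ[𝓝 0] val x 0 :=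
      eventually_of_mem ((C.isOpen_disc 0).mem_nhds C.zero_mem_disc)
        fun z hz => (hasDerivAt_integ hlam x hz).deriv
    rw [coeff_succ_unborel, iteratedDeriv_succ', h.iteratedDeriv_eq]
    ring

theorem unborel_divSub {d : ℂ} {x y : C.Fun lam}
    (h : ∀ z ∈ C.disc 0, (d - z) * val y 0 z = val x 0 z) :
    xxD (unborel y) + PowerSeries.C d * unborel y = unborel x := by
  have h' : val x 0 =ᶠ[𝓝 0] fun z => d * val y 0 z - z * val y 0 z :=
    eventually_of_mem ((C.isOpen_disc 0).mem_nhds C.zero_mem_disc) fun z hz => by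
      simp only [← h z hz]; ring
  ext n
  rcases n with _ | n
  · rw [map_add, PowerSeries.coeff_C_mul, coeff_zero_xxD]
    simp only [coeff_zero_unborel, mul_zero, add_zero]
  rw [map_add, coeff_succ_xxD, PowerSeries.coeff_C_mul, coeff_succ_unborel, coeff_succ_unborel,
    h'.iteratedDeriv_eq]
  have hy := analyticAt_val y C.zero_mem_disc
  rw [iteratedDeriv_fun_sub (f := fun z => d * val y 0 z) (g := fun z => z * val y 0 z)
    (analyticAt_const.mul hy).contDiffAt (analyticAt_id.mul hy).contDiffAt,
    iteratedDeriv_const_mul d (contDiffAt_val y _), iteratedDeriv_id_mul hy]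
  rcases n with _ | n
  · simp
  · rw [coeff_succ_unborel, Nat.add_sub_cancel]
    ring

theorem unborel_average (hlam : 0 < lam) {x y : C.Fun lam}
    (h : ∀ z ∈ C.disc 0, z * val y 0 z = val (integ hlam x) 0 z) :
    xxD (unborel y) = PowerSeries.X * unborel x := by
  have := unborel_divSub (d := 0) (x := -integ hlam x) (y := y) (fun z hz => by
    have e : val (-integ hlam x) 0 z = -val (integ hlam x) 0 z := by
      have := val_smul (-1) (integ hlam x) 0 z
      simpa using this
    rw [e, ← h z hz]
    ring)
  rw [map_zero, zero_mul, add_zero, map_neg, unborel_integ] at this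
  rw [this]
  ring

theorem hasFPowerSeriesAt_val (x : C.Fun lam) :
    HasFPowerSeriesAt (val x 0) (FormalMultilinearSeries.ofScalars ℂ fun n =>
      PowerSeries.coeff n (hat (unborel x))) 0 := by
  have h := (analyticAt_val x C.zero_mem_disc).hasFPowerSeriesAt
  have hn : ∀ n, PowerSeries.coeff n (hat (unborel x)) =
      iteratedDeriv n (val x 0) 0 / n.factorial := by
    intro n
    simp only [hat, borel, PowerSeries.coeff_mk, tilde, PowerSeries.coeff_rescale,
      coeff_succ_unborel]
    rw [← mul_assoc, ← mul_pow]
    simp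
  simpa only [hn] using h

theorem exists_one (C : DiscChain) (hlam : 0 < lam) :
    ∃ x : C.Fun lam, ‖x‖ ≤ 1 ∧ unborel x = -PowerSeries.X := by
  obtain ⟨x, hx, hxn⟩ := exists_mem_space (C := C) (lam := lam) (f := fun _ _ => 1)
    ⟨fun i => differentiableOn_const 1, fun _ _ _ _ => rfl⟩ zero_le_one (fun i z _ => by
      rw [norm_one, one_mul]
      exact Real.one_le_exp (mul_nonneg hlam.le (C.ell_nonneg i z)))
  refine ⟨x, hxn, ?_⟩
  have h' : val x 0 =ᶠ[𝓝 0] fun _ => 1 :=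
    eventually_of_mem ((C.isOpen_disc 0).mem_nhds C.zero_mem_disc) (hx 0)
  ext n
  rcases n with _ | n
  · simp
  rw [coeff_succ_unborel, h'.iteratedDeriv_eq, iteratedDeriv_const, map_neg,
    PowerSeries.coeff_X]
  rcases n with _ | n <;> simp

/-! ### Convergent series of integrations -/

/-- The operator `b(-J)`, where `J` is the integration from the origin and `b(x)` is a convergent
series: the Borel counterpart of the multiplication by `b(x)`. -/
def opSeries (hlam : 0 < lam) (b : PowerSeries ℂ) : C.Fun lam →L[ℂ] C.Fun lam :=
  ∑' m, PowerSeries.coeff m b • (-integ hlam) ^ m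

section opSeries

variable {b : PowerSeries ℂ} {γ R : ℝ}

theorem norm_opSeries_term_le (hlam : 0 < lam)
    (hb : ∀ m, ‖PowerSeries.coeff m b‖ ≤ γ * R ^ m) (m : ℕ) :
    ‖PowerSeries.coeff m b • (-integ hlam : C.Fun lam →L[ℂ] C.Fun lam) ^ m‖ ≤
      γ * (R / lam) ^ m := by
  have hJ : ‖(-integ hlam : C.Fun lam →L[ℂ] C.Fun lam) ^ m‖ ≤ (1 / lam) ^ m := by
    rcases m with _ | m
    · rw [pow_zero, pow_zero]
      exact ContinuousLinearMap.norm_id_le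
    · refine (norm_pow_le' _ m.succ_pos).trans ?_
      rw [norm_neg]
      exact pow_le_pow_left₀ (norm_nonneg _) (norm_integ_le hlam) _
  rw [norm_smul]
  calc _ ≤ (γ * R ^ m) * (1 / lam) ^ m :=
        mul_le_mul (hb m) hJ (norm_nonneg _) ((norm_nonneg _).trans (hb m))
    _ = _ := by rw [mul_assoc, ← mul_pow, mul_one_div]

theorem hasSum_opSeries (hlam : 0 < lam) (hR : 0 ≤ R) (hRl : 2 * R ≤ lam)
    (hb : ∀ m, ‖PowerSeries.coeff m b‖ ≤ γ * R ^ m) :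
    HasSum (fun m => PowerSeries.coeff m b • (-integ hlam : C.Fun lam →L[ℂ] C.Fun lam) ^ m)
      (opSeries hlam b) := by
  have h1 : R / lam ≤ 1 / 2 := by rw [div_le_iff₀ hlam]; linarith
  have h0 : 0 ≤ R / lam := by positivity
  exact (Summable.of_norm_bounded ((summable_geometric_of_lt_one h0 (by linarith)).mul_left γ)
    (norm_opSeries_term_le hlam hb)).hasSum

theorem norm_opSeries_le (hlam : 0 < lam) (hR : 0 ≤ R) (hRl : 2 * R ≤ lam)
    (hb : ∀ m, ‖PowerSeries.coeff m b‖ ≤ γ * R ^ m) :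
    ‖(opSeries hlam b : C.Fun lam →L[ℂ] C.Fun lam)‖ ≤ 2 * γ := by
  have h1 : R / lam ≤ 1 / 2 := by rw [div_le_iff₀ hlam]; linarith
  have h0 : 0 ≤ R / lam := by positivity
  have hγ : 0 ≤ γ := by simpa using (norm_nonneg _).trans (hb 0)
  refine (tsum_of_norm_bounded (hasSum_geometric_two.mul_left γ) fun m =>
    (norm_opSeries_term_le hlam hb m).trans ?_).trans (le_of_eq (mul_comm _ _))
  exact mul_le_mul_of_nonneg_left (pow_le_pow_left₀ h0 h1 m) hγ

/-- A series without constant term gains a factor `1 / lam`. -/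
theorem norm_opSeries_le_of_coeff_zero (hlam : 0 < lam) (hR : 0 ≤ R) (hRl : 2 * R ≤ lam)
    (hb : ∀ m, ‖PowerSeries.coeff m b‖ ≤ γ * R ^ m) (hb0 : PowerSeries.coeff 0 b = 0) :
    ‖(opSeries hlam b : C.Fun lam →L[ℂ] C.Fun lam)‖ ≤ 2 * γ * (R / lam) := by
  have h1 : R / lam ≤ 1 / 2 := by rw [div_le_iff₀ hlam]; linarith
  have h0 : 0 ≤ R / lam := by positivity
  have hγ : 0 ≤ γ := by simpa using (norm_nonneg _).trans (hb 0)
  have hs := (hasSum_nat_add_iff' 1).mpr (hasSum_opSeries (C := C) hlam hR hRl hb)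
  simp only [Finset.range_one, Finset.sum_singleton, hb0, zero_smul, sub_zero] at hs
  rw [← hs.tsum_eq]
  refine (tsum_of_norm_bounded (hasSum_geometric_two.mul_left (γ * (R / lam))) fun m =>
    (norm_opSeries_term_le hlam hb (m + 1)).trans ?_).trans (le_of_eq (by ring))
  rw [pow_succ', ← mul_assoc]
  exact mul_le_mul_of_nonneg_left (pow_le_pow_left₀ h0 h1 m) (by positivity)

theorem unborel_neg_integ_pow (hlam : 0 < lam) (m : ℕ) (x : C.Fun lam) :
    unborel (((-integ hlam : C.Fun lam →L[ℂ] C.Fun lam) ^ m) x) =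
      PowerSeries.X ^ m * unborel x := by
  induction m with
  | zero => simp
  | succ m ih =>
    rw [pow_succ', mul_apply_eq_comp, neg_apply, map_neg,
      unborel_integ, ih]
    ring

theorem unborel_opSeries (hlam : 0 < lam) (hR : 0 ≤ R) (hRl : 2 * R ≤ lam)
    (hb : ∀ m, ‖PowerSeries.coeff m b‖ ≤ γ * R ^ m) (x : C.Fun lam) :
    unborel (opSeries hlam b x) = b * unborel x := by
  have h1 := hasSum_unborel ((hasSum_opSeries hlam hR hRl hb).mapL
    (ContinuousLinearMap.apply ℂ (C.Fun lam) x))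
  refine h1.unique ?_
  convert! (PowerSeries.hasSum_of_monomials_self b).mul_right (unborel x) using 2 with m
  rw [ContinuousLinearMap.apply_apply, smul_apply, map_smul,
    unborel_neg_integ_pow, ← smul_mul_assoc]
  congr 1
  ext k
  simp [PowerSeries.coeff_monomial, PowerSeries.coeff_X_pow]

end opSeries

end DiscChain

/-! ### Infinite linear systems -/

/-- Neumann series for an infinite system `fₖ = sₖ + ∑ⱼ Oₖⱼ fⱼ` in a Banach space which is a
contraction by `1/2` in a weighted supremum norm. -/
theorem exists_solution_of_contraction {E : Type*} [NormedAddCommGroup E] [NormedSpace ℂ E]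
    [CompleteSpace E] (O : ℕ → ℕ → E →L[ℂ] E) (s : ℕ → E) (o : ℕ → ℕ → ℝ) (W : ℕ → ℝ) (S : ℝ)
    (hO : ∀ k j, ‖O k j‖ ≤ o k j) (hW : ∀ k, 0 ≤ W k) (hS : 0 ≤ S) (hs : ∀ k, ‖s k‖ ≤ S * W k)
    (hoW : ∀ k, ∀ F : Finset ℕ, ∑ j ∈ F, o k j * W j ≤ W k / 2) :
    ∃ f : ℕ → E, (∀ k, ‖f k‖ ≤ 2 * S * W k) ∧ ∀ k, HasSum (fun j => O k j (f j)) (f k - s k) := by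
  have ho : ∀ k j, 0 ≤ o k j := fun k j => (norm_nonneg _).trans (hO k j)
  have hsum : ∀ k, Summable fun j => o k j * W j := fun k =>
    summable_of_sum_le (fun j => mul_nonneg (ho k j) (hW j)) (hoW k)
  have htsum : ∀ k, ∑' j, o k j * W j ≤ W k / 2 := fun k => (hsum k).tsum_le_of_sum_le (hoW k)
  -- the terms of the Neumann series
  let u : ℕ → ℕ → E := fun p => Nat.rec s (fun _ v k => ∑' j, O k j (v j)) p
  have hu : ∀ p k, ‖u p k‖ ≤ S * W k * (1 / 2) ^ p := by
    intro p
    induction p with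
    | zero => intro k; simpa [u] using hs k
    | succ p ih =>
      intro k
      have h1 : ∀ j, ‖O k j (u p j)‖ ≤ o k j * W j * (S * (1 / 2) ^ p) := fun j => by
        refine ((O k j).le_of_opNorm_le_of_le (hO k j) (ih j)).trans (le_of_eq (by ring))
      refine (tsum_of_norm_bounded ((hsum k).hasSum.mul_right _) h1).trans ?_
      calc _ ≤ W k / 2 * (S * (1 / 2) ^ p) :=
            mul_le_mul_of_nonneg_right (htsum k) (by positivity)
        _ = _ := by ring
  have hup : ∀ k, HasSum (fun p => u p k) (∑' p, u p k) := fun k =>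
    (Summable.of_norm_bounded ((summable_geometric_two).mul_left (S * W k))
      fun p => hu p k).hasSum
  refine ⟨fun k => ∑' p, u p k, fun k => ?_, fun k => ?_⟩
  · refine (tsum_of_norm_bounded (hasSum_geometric_two.mul_left (S * W k)) fun p => hu p k).trans
      (le_of_eq (by ring))
  · have hF : Summable fun x : ℕ × ℕ => O k x.1 (u x.2 x.1) := by
      refine Summable.of_norm_bounded
        (((hsum k).mul_of_nonneg (summable_geometric_two.mul_left S)
          (fun j => mul_nonneg (ho k j) (hW j)) (fun p => by positivity))) fun x => ?_
      exact ((O k x.1).le_of_opNorm_le_of_le (hO k x.1) (hu x.2 x.1)).trans (le_of_eq (by ring))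
    have h1 := hF.hasSum.prod_fiberwise (g := fun j => O k j (∑' p, u p j))
      fun j => (hup j).mapL (O k j)
    have h2 := ((Equiv.prodComm ℕ ℕ).hasSum_iff.mpr hF.hasSum).prod_fiberwise
      (g := fun p => u (p + 1) k) fun p => by
        refine (Summable.of_norm_bounded ((hsum k).mul_right (S * (1 / 2) ^ p)) fun j => ?_).hasSum
        exact ((O k j).le_of_opNorm_le_of_le (hO k j) (hu p j)).trans (le_of_eq (by ring))
    have h3 := (hasSum_nat_add_iff' 1).mpr (hup k)
    rw [h2.unique h3] at h1
    simpa [u] using h1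

namespace DiscChain

variable {C : DiscChain} {lam : ℝ}

/-- Solution of the Borel transform of an infinite linear system
`(x² d/dx + dₖ) Qₖ = x sₖ + ∑ⱼ x cₖⱼ Qⱼ` in the space of a chain of discs. In the resonant equations
`dₖ = 0`, the division by `ζ` uses up the gain `1 / lam` of the integration. This is compensated by
the larger weight `Lam * w k` of the resonant unknowns, since these occur in the resonant equations
only with coefficients of valuation at least `2`. -/
theorem exists_solution_of_system (hlam : 0 < lam) (d : ℕ → ℂ) (c : ℕ → ℕ → PowerSeries ℂ)
    (s : ℕ → PowerSeries ℂ) (γ : ℕ → ℕ → ℝ) (σ w δ : ℕ → ℝ) {R B S Lam c₀ : ℝ}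
    (hR : 0 ≤ R) (hRlam : 2 * R ≤ lam) (hS : 0 ≤ S) (hLam : 1 ≤ Lam) (hw : ∀ k, 0 < w k)
    (hc : ∀ k j m, ‖PowerSeries.coeff m (c k j)‖ ≤ γ k j * R ^ m)
    (hs : ∀ k m, ‖PowerSeries.coeff m (s k)‖ ≤ σ k * R ^ m)
    (hc0 : ∀ k j, d k = 0 → d j = 0 → PowerSeries.coeff 0 (c k j) = 0)
    (hs0 : ∀ k, d k = 0 → PowerSeries.coeff 0 (s k) = 0)
    (hδ : ∀ k, d k ≠ 0 → 0 < δ k) (hdδ : ∀ k, d k ≠ 0 → ∀ i, ∀ z ∈ C.disc i, δ k ≤ ‖d k - z‖)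
    (hc₀ : 0 < c₀) (hc₀l : 1 / c₀ ≤ lam)
    (hdc : ∀ k, d k = 0 → ∀ i, ∀ z ∈ C.disc (i + 1), c₀ ≤ ‖z‖)
    (hγ : ∀ k, d k ≠ 0 → ∀ F : Finset ℕ, ∑ j ∈ F, γ k j * w j ≤ B * δ k * w k)
    (hγ0 : ∀ k, d k = 0 → ∀ F : Finset ℕ, ∑ j ∈ F, γ k j * w j ≤ Lam / 4 * w k)
    (hBlam : 4 * Lam * B ≤ lam) (hRLam : R * Lam ≤ lam)
    (hσ : ∀ k, d k ≠ 0 → 2 * σ k ≤ S * δ k * w k)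
    (hσ0 : ∀ k, d k = 0 → 2 * R * σ k ≤ S * w k) :
    ∃ f : ℕ → C.Fun lam, (∀ k, ‖f k‖ ≤ 2 * S * (Lam * w k)) ∧
      ∀ k, HasSum (fun j => PowerSeries.X * c k j * unborel (f j))
        (xxD (unborel (f k)) + PowerSeries.C (d k) * unborel (f k) - PowerSeries.X * s k) := by
  classical
  have hLam0 : 0 < Lam := one_pos.trans_le hLam
  have hγnn : ∀ k j, 0 ≤ γ k j := fun k j => by simpa using (norm_nonneg _).trans (hc k j 0)
  have hσnn : ∀ k, 0 ≤ σ k := fun k => by simpa using (norm_nonneg _).trans (hs k 0)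
  obtain ⟨e, he, heS⟩ := exists_one C hlam
  let J : C.Fun lam →L[ℂ] C.Fun lam := integ hlam
  -- inversion of `d k - ζ`, preceded by an integration if `d k = 0`
  have hP : ∀ k, ∃ P : C.Fun lam →L[ℂ] C.Fun lam,
      (d k ≠ 0 → (∀ x, xxD (unborel (P x)) + PowerSeries.C (d k) * unborel (P x) = unborel x) ∧
        ‖P‖ ≤ 1 / δ k) ∧
      (d k = 0 → (∀ x, xxD (unborel (P x)) = PowerSeries.X * unborel x) ∧ ‖P‖ ≤ 1) := by
    intro k
    by_cases hk : d k = 0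
    · obtain ⟨E, hE, hEn⟩ := exists_average (C := C) hlam hc₀ hc₀l (hdc k hk)
      exact ⟨E, fun h => absurd hk h, fun _ => ⟨fun x => unborel_average hlam (hE x 0), hEn⟩⟩
    · obtain ⟨M, hM, hMn⟩ := exists_divSub (C := C) (lam := lam) (d k) (hδ k hk) (hdδ k hk)
      exact ⟨M, fun _ => ⟨fun x => unborel_divSub (hM x 0), hMn⟩, fun h => absurd h hk⟩
  choose P hPne hP0 using hP
  -- in the resonant equations the source is `x² s'`, one factor `x` being absorbed by `P`
  let s' : ℕ → PowerSeries ℂ := fun k => PowerSeries.mk fun m => PowerSeries.coeff (m + 1) (s k)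
  have hs' : ∀ k m, ‖PowerSeries.coeff m (s' k)‖ ≤ σ k * R * R ^ m := by
    intro k m
    rw [PowerSeries.coeff_mk, mul_assoc, ← pow_succ']
    exact hs k (m + 1)
  have hs'X : ∀ k, d k = 0 → s k = PowerSeries.X * s' k := by
    intro k hk
    ext m
    rcases m with _ | m
    · simp [hs0 k hk]
    · rw [PowerSeries.coeff_succ_X_mul, PowerSeries.coeff_mk]
  let O : ℕ → ℕ → C.Fun lam →L[ℂ] C.Fun lam := fun k j =>
    if d k = 0 then P k ∘L opSeries hlam (c k j) else P k ∘L opSeries hlam (c k j) ∘L (-J)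
  -- the minus sign is that of `unborel e = -x`
  let src : ℕ → C.Fun lam := fun k =>
    if d k = 0 then -P k (opSeries hlam (s' k) e) else -P k (opSeries hlam (s k) e)
  let W : ℕ → ℝ := fun k => if d k = 0 then Lam * w k else w k
  let o : ℕ → ℕ → ℝ := fun k j =>
    if d k = 0 then (if d j = 0 then 2 * γ k j * (R / lam) else 2 * γ k j)
    else 1 / δ k * (2 * γ k j) * (1 / lam)
  have hWle : ∀ k, W k ≤ Lam * w k := by
    intro k
    simp only [W]
    split_ifs
    · exact le_rfl
    · have := hw k
      nlinarith
  have hW : ∀ k, 0 ≤ W k := by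
    intro k
    have := hw k
    simp only [W]
    split_ifs <;> positivity
  have hO : ∀ k j, ‖O k j‖ ≤ o k j := by
    intro k j
    by_cases hk : d k = 0
    · have h1 : ‖(opSeries hlam (c k j) : C.Fun lam →L[ℂ] C.Fun lam)‖ ≤ o k j := by
        simp only [o, if_pos hk]
        split_ifs with hj
        · exact norm_opSeries_le_of_coeff_zero hlam hR hRlam (hc k j) (hc0 k j hk hj)
        · exact norm_opSeries_le hlam hR hRlam (hc k j)
      simp only [O, if_pos hk]
      refine (ContinuousLinearMap.opNorm_comp_le _ _).trans ?_
      calc _ ≤ 1 * o k j := mul_le_mul (hP0 k hk).2 h1 (norm_nonneg _) zero_le_one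
        _ = _ := one_mul _
    · simp only [O, o, if_neg hk]
      have h1 := (hPne k hk).2
      have hδk := hδ k hk
      have h2 := norm_opSeries_le (C := C) hlam hR hRlam (hc k j)
      have h3 : ‖-J‖ ≤ 1 / lam := by rw [norm_neg]; exact norm_integ_le hlam
      refine (ContinuousLinearMap.opNorm_comp_le _ _).trans ?_
      rw [mul_assoc]
      refine mul_le_mul h1 ((ContinuousLinearMap.opNorm_comp_le _ _).trans ?_) (norm_nonneg _)
        (by positivity)
      exact mul_le_mul h2 h3 (norm_nonneg _) ((norm_nonneg _).trans h2)
  have hsrc : ∀ k, ‖src k‖ ≤ S * W k := by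
    intro k
    have hop : ∀ (b : PowerSeries ℂ) (g : ℝ), (∀ m, ‖PowerSeries.coeff m b‖ ≤ g * R ^ m) →
        ‖opSeries hlam b e‖ ≤ 2 * g := by
      intro b g hb
      have h1 := norm_opSeries_le (C := C) hlam hR hRlam hb
      calc _ ≤ 2 * g * 1 := (opSeries hlam b).le_of_opNorm_le_of_le h1 he
        _ = _ := mul_one _
    by_cases hk : d k = 0
    · simp only [src, if_pos hk, norm_neg, W]
      have h1 := (P k).le_of_opNorm_le_of_le (hP0 k hk).2 (hop _ _ (hs' k))
      have h2 := hσ0 k hk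
      have h3 : S * w k ≤ S * (Lam * w k) := by
        refine mul_le_mul_of_nonneg_left ?_ hS
        have := hw k
        nlinarith
      linarith
    · simp only [src, if_neg hk, norm_neg, W]
      have h1 := (P k).le_of_opNorm_le_of_le (hPne k hk).2 (hop _ _ (hs k))
      have h2 := hσ k hk
      refine h1.trans ?_
      rw [one_div_mul_eq_div, div_le_iff₀ (hδ k hk)]
      linarith
  have hoW : ∀ k, ∀ F : Finset ℕ, ∑ j ∈ F, o k j * W j ≤ W k / 2 := by
    intro k F
    by_cases hk : d k = 0
    · have hterm : ∀ j ∈ F, o k j * W j ≤ 2 * (γ k j * w j) := by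
        intro j _
        have hwj := hw j
        have hg := hγnn k j
        simp only [o, W, if_pos hk]
        split_ifs
        · have h1 : R / lam * Lam ≤ 1 := by
            rw [div_mul_eq_mul_div, div_le_iff₀ hlam]
            linarith
          calc 2 * γ k j * (R / lam) * (Lam * w j) = 2 * (γ k j * w j) * (R / lam * Lam) := by ring
            _ ≤ 2 * (γ k j * w j) * 1 := mul_le_mul_of_nonneg_left h1 (by positivity)
            _ = _ := mul_one _
        · exact le_of_eq (by ring)
      refine (Finset.sum_le_sum hterm).trans ?_
      rw [← Finset.mul_sum]
      have := hγ0 k hk F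
      simp only [W, if_pos hk]
      linarith
    · have hδk := hδ k hk
      have hterm : ∀ j ∈ F, o k j * W j ≤ (2 * Lam / (δ k * lam)) * (γ k j * w j) := by
        intro j _
        have hg := hγnn k j
        simp only [o, if_neg hk]
        calc 1 / δ k * (2 * γ k j) * (1 / lam) * W j ≤
            1 / δ k * (2 * γ k j) * (1 / lam) * (Lam * w j) :=
              mul_le_mul_of_nonneg_left (hWle j) (by positivity)
          _ = _ := by field_simp
      refine (Finset.sum_le_sum hterm).trans ?_
      rw [← Finset.mul_sum]
      have h1 := hγ k hk F
      have hwk := hw k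
      simp only [W, if_neg hk]
      calc 2 * Lam / (δ k * lam) * ∑ j ∈ F, γ k j * w j ≤
          2 * Lam / (δ k * lam) * (B * δ k * w k) :=
            mul_le_mul_of_nonneg_left h1 (by positivity)
        _ = (4 * Lam * B) * (w k / 2 / lam) := by field_simp; ring
        _ ≤ lam * (w k / 2 / lam) := mul_le_mul_of_nonneg_right hBlam (by positivity)
        _ = w k / 2 := by field_simp
  obtain ⟨f, hf, hfs⟩ := exists_solution_of_contraction O src o W S hO hW hS hsrc hoW
  refine ⟨f, fun k => (hf k).trans (mul_le_mul_of_nonneg_left (hWle k) (by positivity)),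
    fun k => ?_⟩
  have h1 := hasSum_xxD_add (hasSum_unborel (hfs k)) (d k)
  have hop : ∀ j x, unborel (opSeries hlam (c k j) x) = c k j * unborel x := fun j x =>
    unborel_opSeries (C := C) hlam hR hRlam (hc k j) x
  by_cases hk : d k = 0
  · have hT : ∀ j, xxD (unborel (O k j (f j))) + PowerSeries.C (d k) * unborel (O k j (f j)) =
        PowerSeries.X * c k j * unborel (f j) := by
      intro j
      simp only [O, if_pos hk, ContinuousLinearMap.comp_apply]
      rw [(hP0 k hk).1, hop, hk, map_zero, zero_mul, add_zero, mul_assoc]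
    have hsr : xxD (unborel (src k)) + PowerSeries.C (d k) * unborel (src k) =
        PowerSeries.X * s k := by
      simp only [src, if_pos hk]
      rw [← map_neg, (hP0 k hk).1, hk, map_zero, zero_mul, add_zero, map_neg,
        unborel_opSeries (C := C) hlam hR hRlam (hs' k), heS, hs'X k hk]
      ring
    simp only [hT] at h1
    convert h1 using 1
    rw [map_sub, xxD_sub, mul_sub, ← hsr]
    ring
  · have hT : ∀ j, xxD (unborel (O k j (f j))) + PowerSeries.C (d k) * unborel (O k j (f j)) =
        PowerSeries.X * c k j * unborel (f j) := by
      intro j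
      simp only [O, if_neg hk, ContinuousLinearMap.comp_apply]
      rw [(hPne k hk).1, hop, neg_apply, map_neg, unborel_integ]
      ring
    have hsr : xxD (unborel (src k)) + PowerSeries.C (d k) * unborel (src k) =
        PowerSeries.X * s k := by
      simp only [src, if_neg hk]
      rw [← map_neg, (hPne k hk).1, map_neg,
        unborel_opSeries (C := C) hlam hR hRlam (hs k), heS]
      ring
    simp only [hT] at h1
    convert h1 using 1
    rw [map_sub, xxD_sub, mul_sub, ← hsr]
    ring

end DiscChain

/-- The discs of the chain stay at distance at least `u m` from every integer `m` of `S`, except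
that the first disc may contain the origin. -/
def DiscChain.Avoids (C : DiscChain) (S : Set ℤ) (u : ℤ → ℝ) : Prop :=
  ∀ i, ∀ z ∈ C.disc i, ∀ m ∈ S, (i ≠ 0 ∨ m ≠ 0) → u m ≤ ‖z - m‖

/-! ### Bounds on the coefficients of the vector field -/

/-- The quotient `alpha A p / x`. -/
def alphaX (A : Ser2) (p : ℕ) : PowerSeries ℂ :=
  PowerSeries.mk fun m => PowerSeries.coeff (m + 1) (alpha A p)

theorem X_mul_alphaX {A : Ser2} (hA : IsSaddleNode A) (p : ℕ) :
    PowerSeries.X * alphaX A p = alpha A p := by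
  ext m
  rcases m with _ | m
  · have := X_dvd_alpha hA p
    rw [PowerSeries.X_dvd_iff] at this
    simp [this]
  · rw [PowerSeries.coeff_succ_X_mul, alphaX, PowerSeries.coeff_mk]

theorem coeff_zero_alphaX_one {A : Ser2} (hA : IsSaddleNode A) :
    PowerSeries.coeff 0 (alphaX A 1) = 0 := by
  rw [alphaX, PowerSeries.coeff_mk]
  exact PowerSeries.X_pow_dvd_iff.mp (X_sq_dvd_alpha_one hA) 1 one_lt_two

/-- Cauchy estimates for the vector field. -/
theorem exists_bound_alphaX {A : Ser2} (hA : IsSaddleNode A) :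
    ∃ K R : ℝ, 1 ≤ K ∧ 1 ≤ R ∧
      ∀ p m, ‖PowerSeries.coeff m (alphaX A p)‖ ≤ K * R ^ p * R ^ m := by
  obtain ⟨r, hr, hsum⟩ := hA.convergent
  set T := ∑' d : Fin 2 →₀ ℕ, ‖MvPowerSeries.coeff d A‖ * r ^ (d 0 + d 1) with hT
  have hT0 : 0 ≤ T := tsum_nonneg fun d => by positivity
  set R := max 1 (1 / r) with hR
  have hR1 : 1 ≤ R := le_max_left _ _
  have hRr : 1 ≤ R * r := by
    have : 1 / r * r ≤ R * r := mul_le_mul_of_nonneg_right (le_max_right _ _) hr.le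
    rwa [one_div_mul_cancel hr.ne'] at this
  refine ⟨max 1 T * R, R, ?_, hR1, fun p m => ?_⟩
  · have := le_max_left 1 T
    nlinarith
  · have h1 : ‖MvPowerSeries.coeff (expo (m + 1) p) A‖ * r ^ (m + 1 + p) ≤ T := by
      have := hsum.le_tsum (expo (m + 1) p) fun d _ => by positivity
      simpa using this
    have h2 : ‖MvPowerSeries.coeff (expo (m + 1) p) A‖ ≤ T * R ^ (m + 1 + p) := by
      calc _ ≤ ‖MvPowerSeries.coeff (expo (m + 1) p) A‖ * (R * r) ^ (m + 1 + p) :=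
            le_mul_of_one_le_right (norm_nonneg _) (one_le_pow₀ hRr)
        _ = (‖MvPowerSeries.coeff (expo (m + 1) p) A‖ * r ^ (m + 1 + p)) * R ^ (m + 1 + p) := by
            rw [mul_pow]; ring
        _ ≤ _ := mul_le_mul_of_nonneg_right h1 (by positivity)
    rw [alphaX, PowerSeries.coeff_mk, coeff_alpha]
    simp only [Nat.succ_ne_zero, false_and, if_false, sub_zero]
    calc _ ≤ T * R ^ (m + 1 + p) := h2
      _ ≤ max 1 T * R ^ (m + 1 + p) := mul_le_mul_of_nonneg_right (le_max_right _ _) (by positivity)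
      _ = _ := by ring

/-! ### The series `φₙ` -/

/-- For a given `n`, the series `Θ(y ^ (κ + 1))ₙ - δ`, where `δ` is `1` if `n = κ + 1` and `0`
otherwise, are without constant term and solve a linear system; these are its coefficients, divided
by `x`. -/
def phiCoeff (A : Ser2) (κ ι : ℕ) : PowerSeries ℂ :=
  if κ ≤ ι + 1 then ((κ : ℂ) + 1) • alphaX A (ι + 1 - κ) else 0

/-- The source terms of the system with coefficients `phiCoeff`, divided by `x`. -/
def phiSource (A : Ser2) (n κ : ℕ) : PowerSeries ℂ :=
  if κ ≤ n then ((κ : ℂ) + 1) • alphaX A (n - κ) else 0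

theorem hasSum_phi_system {A : Ser2} (hA : IsSaddleNode A) (n κ : ℕ) :
    HasSum (fun ι => PowerSeries.X * phiCoeff A κ ι *
        (thetaPow A (ι + 1) n - if n = ι + 1 then 1 else 0))
      (xxD (thetaPow A (κ + 1) n - if n = κ + 1 then 1 else 0) +
        PowerSeries.C ((n : ℂ) - 1 - κ) * (thetaPow A (κ + 1) n - if n = κ + 1 then 1 else 0) -
        PowerSeries.X * phiSource A n κ) := by
  have h1 := hasSum_thetaPow_system' hA (κ + 1) n
  have h2 : HasSum (fun j : ℕ => if κ + 1 ≤ j + 1 then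
      ((κ + 1 : ℕ) : ℂ) • (alpha A (j + 1 - (κ + 1)) * if n = j then 1 else 0) else 0)
      (PowerSeries.X * phiSource A n κ) := by
    convert! hasSum_single (f := fun j : ℕ => if κ + 1 ≤ j + 1 then
      ((κ + 1 : ℕ) : ℂ) • (alpha A (j + 1 - (κ + 1)) * if n = j then 1 else 0) else 0) n ?_ using 1
    · simp only [phiSource, add_le_add_iff_right, if_true, mul_one, Nat.add_sub_add_right]
      split_ifs
      · rw [mul_smul_comm, X_mul_alphaX hA]
        push_cast
        rfl
      · rw [mul_zero]
    · intro j hj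
      simp [Ne.symm hj]
  have h3 := (hasSum_nat_add_iff' 1).mpr (h1.sub h2)
  simp only [Finset.range_one, Finset.sum_singleton, thetaPow_zero hA] at h3
  convert! h3 using 1
  · ext1 ι
    simp only [phiCoeff, add_le_add_iff_right, Nat.add_sub_add_right]
    split_ifs
    all_goals first | (rw [mul_zero, zero_mul, sub_zero]) | skip
    all_goals
      rw [mul_smul_comm, X_mul_alphaX hA]
      push_cast
      simp only [smul_mul_assoc, mul_sub]
  · have hn : xxD (if n = κ + 1 then 1 else 0) = 0 := by split_ifs <;> simp
    have hn' : PowerSeries.C ((n : ℂ) - 1 - κ) * (if n = κ + 1 then 1 else 0) = 0 := by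
      split_ifs with h
      · rw [h]; push_cast; simp
      · simp
    rw [xxD_sub, hn, mul_sub, hn', sub_zero, sub_zero]
    have hd : (n : ℂ) - ((κ + 1 : ℕ) : ℂ) = (n : ℂ) - 1 - κ := by push_cast; ring
    rw [hd]
    split_ifs <;> simp_all

theorem phi_system_unique {A : Ser2} (hA : IsSaddleNode A) (n : ℕ) (Q Q' : ℕ → PowerSeries ℂ)
    (h0 : ∀ κ, PowerSeries.coeff 0 (Q κ) = 0) (h0' : ∀ κ, PowerSeries.coeff 0 (Q' κ) = 0)
    (h : ∀ κ, HasSum (fun ι => PowerSeries.X * phiCoeff A κ ι * Q ι)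
      (xxD (Q κ) + PowerSeries.C ((n : ℂ) - 1 - κ) * Q κ - PowerSeries.X * phiSource A n κ))
    (h' : ∀ κ, HasSum (fun ι => PowerSeries.X * phiCoeff A κ ι * Q' ι)
      (xxD (Q' κ) + PowerSeries.C ((n : ℂ) - 1 - κ) * Q' κ - PowerSeries.X * phiSource A n κ)) :
    Q = Q' := by
  funext κ
  refine sub_eq_zero.mp (eq_zero_of_system (fun κ : ℕ => (n : ℂ) - 1 - κ) (fun κ => Q κ - Q' κ)
    (fun κ ι => PowerSeries.X * phiCoeff A κ ι * (Q ι - Q' ι)) ?_ ?_ ?_ ?_ κ)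
  · intro κ; rw [map_sub, h0, h0', sub_zero]
  · intro κ
    convert! (h κ).sub (h' κ) using 1
    · ext1 ι; rw [mul_sub]
    · rw [xxD_sub]; ring
  · intro m hm κ ι
    rw [pow_succ', mul_assoc]
    exact mul_dvd_mul_left _ ((hm ι).mul_left _)
  · intro m κ hκ hm hm' ι
    rw [show m + 2 = (m + 1) + 1 from rfl, pow_succ', mul_assoc]
    refine mul_dvd_mul_left _ ?_
    by_cases hι : (n : ℂ) - 1 - ι = 0
    · have : ι = κ := by
        have : (ι : ℂ) = κ := by linear_combination hκ - hι
        exact_mod_cast this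
      subst this
      have hX : PowerSeries.X ∣ phiCoeff A ι ι := by
        rw [phiCoeff, if_pos (by lia), show ι + 1 - ι = 1 by lia]
        refine dvd_smul_of_dvd ?_ _
        rw [PowerSeries.X_dvd_iff, ← PowerSeries.coeff_zero_eq_constantCoeff_apply]
        exact coeff_zero_alphaX_one hA
      rw [pow_succ']
      exact mul_dvd_mul hX (hm ι)
    · exact (hm' ι hι).mul_left _

theorem sum_half_pow_le (κ : ℕ) (F : Finset ℕ) :
    ∑ ι ∈ F, (if κ ≤ ι + 1 then (1 / 2 : ℝ) ^ (ι + 1 - κ) else 0) ≤ 2 := by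
  rw [← Finset.sum_filter]
  have hinj : Set.InjOn (fun ι => ι + 1 - κ) (F.filter fun ι => κ ≤ ι + 1) := by
    intro a ha b hb h
    simp only [Finset.coe_filter, Set.mem_ofPred_eq] at ha hb
    simp only at h
    lia
  rw [← Finset.sum_image (f := fun p => (1 / 2 : ℝ) ^ p) hinj]
  exact (summable_geometric_two.sum_le_tsum _ fun p _ => by positivity).trans
    tsum_geometric_two.le

theorem coe_succ_le_two_pow (n : ℕ) : (n : ℝ) + 1 ≤ 2 ^ n := by
  have := Nat.lt_two_pow_self (n := n)
  exact_mod_cast this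

/-- Bounds for `φ̂ₙ` on the chains of discs that avoid the integers less than `n`. The `κ`-th
equation of the system involves the division by `n - 1 - κ - ζ`, while its coefficients grow like
`κ + 1`; their ratio is bounded by a multiple of `n + 1`. The resonant equation `κ = n - 1`, whose
coefficients are of the order of `n`, requires another factor `n + 1`, whence the exponent
`n² + 1`. -/
theorem exists_phi_hat {A : Ser2} (hA : IsSaddleNode A) {c : ℝ} (hc : 0 < c) (hc1 : c ≤ 1) :
    ∃ K L M : ℝ, 0 < K ∧ 0 < L ∧ 0 < M ∧ ∀ (n : ℕ) (C : DiscChain),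
      C.Avoids {m | m < (n : ℤ)} (fun m => c * max 1 (-(m : ℝ))) →
        ∃ f : C.Fun (((n : ℝ) ^ 2 + 1) * M), DiscChain.unborel f = phi A n ∧ ‖f‖ ≤ K * L ^ n := by
  obtain ⟨K, R, hK, hR, hα⟩ := exists_bound_alphaX hA
  have hK0 : 0 < K := one_pos.trans_le hK
  have hR0 : 0 < R := one_pos.trans_le hR
  have hcinv : 1 ≤ 1 / c := by rw [le_div_iff₀ hc]; linarith
  refine ⟨64 * R ^ 2 * K ^ 2 / c, 8 * R, 512 * R ^ 2 * K ^ 2 / c, by positivity, by positivity,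
    by positivity, fun n C hC => ?_⟩
  set lam : ℝ := ((n : ℝ) ^ 2 + 1) * (512 * R ^ 2 * K ^ 2 / c) with hlamdef
  have hlam : 0 < lam := by positivity
  have hn0 : (0 : ℝ) ≤ n := Nat.cast_nonneg n
  have hRK : 1 ≤ R ^ 2 * K ^ 2 := by
    have h1 := one_le_pow₀ (n := 2) hR
    have h2 := one_le_pow₀ (n := 2) hK
    nlinarith
  have hlamge : (256 * (R ^ 2 * K ^ 2)) * (((n : ℝ) + 1) ^ 2 * (1 / c)) ≤ lam := by
    have : ((n : ℝ) + 1) ^ 2 ≤ 2 * ((n : ℝ) ^ 2 + 1) := by nlinarith [sq_nonneg ((n : ℝ) - 1)]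
    calc _ ≤ (256 * (R ^ 2 * K ^ 2)) * ((2 * ((n : ℝ) ^ 2 + 1)) * (1 / c)) := by gcongr
      _ = lam := by rw [hlamdef]; ring
  have hlamge1 : (256 * (R ^ 2 * K ^ 2)) * ((n : ℝ) + 1) ≤ lam := by
    refine le_trans ?_ hlamge
    refine mul_le_mul_of_nonneg_left ?_ (by positivity)
    have : ((n : ℝ) + 1) ≤ ((n : ℝ) + 1) ^ 2 := by nlinarith
    nlinarith
  have hdeq : ∀ κ : ℕ, ((n : ℂ) - 1 - κ) = (((n : ℤ) - 1 - κ : ℤ) : ℂ) := by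
    intro κ; push_cast; ring
  have hmem : ∀ κ : ℕ, ((n : ℤ) - 1 - κ) ∈ {m | m < (n : ℤ)} := by
    intro κ; simp only [Set.mem_ofPred_eq]; lia
  -- the growth of the coefficients is compensated by the divisors, up to the factor `n + 1`
  have hκ : ∀ κ : ℕ, (κ : ℝ) + 1 ≤ ((n : ℝ) + 1) * max 1 (-(((n : ℤ) - 1 - κ : ℤ) : ℝ)) := by
    intro κ
    have h1 := le_max_left 1 (-(((n : ℤ) - 1 - κ : ℤ) : ℝ))
    have h2 := le_max_right 1 (-(((n : ℤ) - 1 - κ : ℤ) : ℝ))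
    push_cast at *
    nlinarith
  have key : ∃ f : ℕ → C.Fun lam,
      (∀ κ, ‖f κ‖ ≤ 2 * (2 * ((n : ℝ) + 1) * K * (2 * R) ^ n * R / c) *
        (16 * R * K * ((n : ℝ) + 1) * (1 / (2 * R)) ^ κ)) ∧
      ∀ κ, HasSum (fun ι => PowerSeries.X * phiCoeff A κ ι * DiscChain.unborel (f ι))
        (xxD (DiscChain.unborel (f κ)) + PowerSeries.C ((n : ℂ) - 1 - κ) *
          DiscChain.unborel (f κ) - PowerSeries.X * phiSource A n κ) := by
    refine DiscChain.exists_solution_of_system (C := C) hlam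
      (fun κ => (n : ℂ) - 1 - κ) (phiCoeff A) (phiSource A n)
      (fun κ ι => if κ ≤ ι + 1 then ((κ : ℝ) + 1) * K * R ^ (ι + 1 - κ) else 0)
      (fun κ => if κ ≤ n then ((κ : ℝ) + 1) * K * R ^ (n - κ) else 0)
      (fun κ => (1 / (2 * R)) ^ κ)
      (fun κ => c * max 1 (-(((n : ℤ) - 1 - κ : ℤ) : ℝ)))
      (R := R) (B := 4 * R * K * ((n : ℝ) + 1) / c)
      (S := 2 * ((n : ℝ) + 1) * K * (2 * R) ^ n * R / c) (Lam := 16 * R * K * ((n : ℝ) + 1))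
      (c₀ := c) hR0.le ?_ (by positivity) ?_ (fun κ => by positivity) ?_ ?_ ?_ ?_
      (fun κ _ => by positivity) ?_ hc ?_ ?_ ?_ ?_ ?_ ?_ ?_ ?_
    · refine le_trans ?_ hlamge1
      have h1 : R ≤ R ^ 2 := by nlinarith
      have h2 : 1 ≤ K ^ 2 := one_le_pow₀ hK
      have h3 : R ^ 2 ≤ R ^ 2 * K ^ 2 := le_mul_of_one_le_right (by positivity) h2
      have h4 : R ^ 2 * K ^ 2 ≤ R ^ 2 * K ^ 2 * ((n : ℝ) + 1) :=
        le_mul_of_one_le_right (by positivity) (by linarith)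
      nlinarith
    · have : 1 ≤ R * K := by nlinarith
      nlinarith
    · intro κ ι m
      simp only [phiCoeff]
      split_ifs
      · rw [map_smul, smul_eq_mul, norm_mul]
        have : ‖(κ : ℂ) + 1‖ = (κ : ℝ) + 1 := by
          have := Complex.norm_natCast (κ + 1)
          push_cast at this
          exact this
        rw [this]
        calc _ ≤ ((κ : ℝ) + 1) * (K * R ^ (ι + 1 - κ) * R ^ m) :=
              mul_le_mul_of_nonneg_left (hα _ _) (by positivity)
          _ = _ := by ring
      · simp
    · intro κ m
      simp only [phiSource]
      split_ifs
      · rw [map_smul, smul_eq_mul, norm_mul]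
        have : ‖(κ : ℂ) + 1‖ = (κ : ℝ) + 1 := by
          have := Complex.norm_natCast (κ + 1)
          push_cast at this
          exact this
        rw [this]
        calc _ ≤ ((κ : ℝ) + 1) * (K * R ^ (n - κ) * R ^ m) :=
              mul_le_mul_of_nonneg_left (hα _ _) (by positivity)
          _ = _ := by ring
      · simp
    · intro κ ι h1 h2
      have : ι = κ := by
        have : (ι : ℂ) = κ := by linear_combination h1 - h2
        exact_mod_cast this
      subst this
      rw [phiCoeff, if_pos (by lia), show ι + 1 - ι = 1 by lia, map_smul, coeff_zero_alphaX_one hA,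
        smul_zero]
    · intro κ h1
      have : n = κ + 1 := by
        have : (n : ℂ) = ((κ + 1 : ℕ) : ℂ) := by push_cast; linear_combination h1
        exact_mod_cast this
      subst this
      rw [phiSource, if_pos (by lia), show κ + 1 - κ = 1 by lia, map_smul, coeff_zero_alphaX_one hA,
        smul_zero]
    · intro κ hne i z hz
      rw [hdeq] at hne ⊢
      have := hC i z hz _ (hmem κ) (Or.inr (by exact_mod_cast hne))
      rwa [norm_sub_rev]
    · refine le_trans ?_ hlamge
      have : 1 ≤ ((n : ℝ) + 1) ^ 2 := one_le_pow₀ (by linarith)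
      have h2 : 1 / c ≤ ((n : ℝ) + 1) ^ 2 * (1 / c) := le_mul_of_one_le_left (by positivity) this
      nlinarith
    · intro κ h0 i z hz
      rw [hdeq] at h0
      have h0' : (n : ℤ) - 1 - κ = 0 := by exact_mod_cast h0
      have := hC (i + 1) z hz 0 (by rw [← h0']; exact hmem κ) (Or.inl (Nat.succ_ne_zero i))
      simpa using this
    · intro κ _ F
      have hterm : ∀ ι ∈ F, (if κ ≤ ι + 1 then ((κ : ℝ) + 1) * K * R ^ (ι + 1 - κ) else 0) *
          (1 / (2 * R)) ^ ι = ((κ : ℝ) + 1) * K * (2 * R) * (1 / (2 * R)) ^ κ *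
            (if κ ≤ ι + 1 then (1 / 2 : ℝ) ^ (ι + 1 - κ) else 0) := by
        intro ι _
        split_ifs with h
        · obtain ⟨p, hp⟩ := Nat.exists_eq_add_of_le h
          have e : (1 / (2 * R)) ^ ι = (2 * R) * (1 / (2 * R)) ^ (ι + 1) := by
            rw [pow_succ]; field_simp
          rw [e, hp, Nat.add_sub_cancel_left, pow_add]
          have : R ^ p * (1 / (2 * R)) ^ p = (1 / 2) ^ p := by
            rw [← mul_pow]; congr 1; field_simp
          rw [← this]; ring
        · ring
      rw [Finset.sum_congr rfl hterm, ← Finset.mul_sum]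
      calc _ ≤ ((κ : ℝ) + 1) * K * (2 * R) * (1 / (2 * R)) ^ κ * 2 :=
            mul_le_mul_of_nonneg_left (sum_half_pow_le κ F) (by positivity)
        _ = ((κ : ℝ) + 1) * (4 * K * R * (1 / (2 * R)) ^ κ) := by ring
        _ ≤ (((n : ℝ) + 1) * max 1 (-(((n : ℤ) - 1 - κ : ℤ) : ℝ))) *
              (4 * K * R * (1 / (2 * R)) ^ κ) :=
            mul_le_mul_of_nonneg_right (hκ κ) (by positivity)
        _ = _ := by field_simp
    · intro κ h0 F
      have hκn : (κ : ℝ) + 1 = n := by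
        have : (n : ℂ) = ((κ + 1 : ℕ) : ℂ) := by push_cast; linear_combination h0
        have : n = κ + 1 := by exact_mod_cast this
        rw [this]; push_cast; ring
      have hterm : ∀ ι ∈ F, (if κ ≤ ι + 1 then ((κ : ℝ) + 1) * K * R ^ (ι + 1 - κ) else 0) *
          (1 / (2 * R)) ^ ι = ((κ : ℝ) + 1) * K * (2 * R) * (1 / (2 * R)) ^ κ *
            (if κ ≤ ι + 1 then (1 / 2 : ℝ) ^ (ι + 1 - κ) else 0) := by
        intro ι _
        split_ifs with h
        · obtain ⟨p, hp⟩ := Nat.exists_eq_add_of_le h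
          have e : (1 / (2 * R)) ^ ι = (2 * R) * (1 / (2 * R)) ^ (ι + 1) := by
            rw [pow_succ]; field_simp
          rw [e, hp, Nat.add_sub_cancel_left, pow_add]
          have : R ^ p * (1 / (2 * R)) ^ p = (1 / 2) ^ p := by
            rw [← mul_pow]; congr 1; field_simp
          rw [← this]; ring
        · ring
      rw [Finset.sum_congr rfl hterm, ← Finset.mul_sum]
      calc _ ≤ ((κ : ℝ) + 1) * K * (2 * R) * (1 / (2 * R)) ^ κ * 2 :=
            mul_le_mul_of_nonneg_left (sum_half_pow_le κ F) (by positivity)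
        _ = (n : ℝ) * (4 * K * R * (1 / (2 * R)) ^ κ) := by rw [hκn]; ring
        _ ≤ ((n : ℝ) + 1) * (4 * K * R * (1 / (2 * R)) ^ κ) := by gcongr; linarith
        _ = _ := by ring
    · refine le_trans (le_of_eq ?_) hlamge
      ring
    · refine le_trans ?_ hlamge1
      have : K ≤ K ^ 2 := by nlinarith
      calc R * (16 * R * K * ((n : ℝ) + 1)) = 16 * (R ^ 2 * K) * ((n : ℝ) + 1) := by ring
        _ ≤ 16 * (R ^ 2 * K ^ 2) * ((n : ℝ) + 1) := by gcongr
        _ ≤ _ := by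
          refine mul_le_mul_of_nonneg_right ?_ (by positivity)
          nlinarith
    all_goals
      have hRn : ∀ κ ≤ n, R ^ (n - κ) ≤ (2 * R) ^ n * (1 / (2 * R)) ^ κ := by
        intro κ hκn
        obtain ⟨p, rfl⟩ := Nat.exists_eq_add_of_le hκn
        rw [Nat.add_sub_cancel_left, pow_add]
        have : (2 * R) ^ κ * (1 / (2 * R)) ^ κ = 1 := by
          rw [← mul_pow, mul_one_div_cancel (by positivity), one_pow]
        calc R ^ p ≤ (2 * R) ^ p := by gcongr; linarith
          _ = ((2 * R) ^ κ * (1 / (2 * R)) ^ κ) * (2 * R) ^ p := by rw [this, one_mul]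
          _ = _ := by ring
    · intro κ _
      split_ifs with h
      · calc 2 * (((κ : ℝ) + 1) * K * R ^ (n - κ)) ≤
            2 * ((((n : ℝ) + 1) * max 1 (-(((n : ℤ) - 1 - κ : ℤ) : ℝ))) * K *
              ((2 * R) ^ n * (1 / (2 * R)) ^ κ)) := by
              gcongr
              · exact hκ κ
              · exact hRn κ h
          _ = (2 * ((n : ℝ) + 1) * max 1 (-(((n : ℤ) - 1 - κ : ℤ) : ℝ)) * K *
              (2 * R) ^ n * (1 / (2 * R)) ^ κ) * 1 := by ring
          _ ≤ (2 * ((n : ℝ) + 1) * max 1 (-(((n : ℤ) - 1 - κ : ℤ) : ℝ)) * K *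
              (2 * R) ^ n * (1 / (2 * R)) ^ κ) * R := by gcongr
          _ = _ := by field_simp
      · rw [mul_zero]; positivity
    · intro κ h0
      have hκn : (κ : ℝ) + 1 = n := by
        have : (n : ℂ) = ((κ + 1 : ℕ) : ℂ) := by push_cast; linear_combination h0
        have : n = κ + 1 := by exact_mod_cast this
        rw [this]; push_cast; ring
      split_ifs with h
      · rw [hκn]
        calc 2 * R * ((n : ℝ) * K * R ^ (n - κ)) ≤
            2 * R * (((n : ℝ) + 1) * K * ((2 * R) ^ n * (1 / (2 * R)) ^ κ)) := by
              gcongr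
              · linarith
              · exact hRn κ h
          _ ≤ 2 * R * (((n : ℝ) + 1) * K * ((2 * R) ^ n * (1 / (2 * R)) ^ κ)) * (1 / c) :=
              le_mul_of_one_le_right (by positivity) hcinv
          _ = _ := by ring
      · rw [mul_zero]; positivity
  obtain ⟨f, hfn, hf⟩ := key
  have hfun : (fun κ => DiscChain.unborel (f κ)) =
      fun κ => thetaPow A (κ + 1) n - if n = κ + 1 then 1 else 0 := by
    refine phi_system_unique hA n _ _ (fun κ => by simp) (fun κ => ?_) hf
      (hasSum_phi_system hA n)
    rw [map_sub, coeff_zero_thetaPow hA]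
    by_cases h : n = κ + 1
    · simp [h]
    · simp [h, Ne.symm h]
  refine ⟨f 0, ?_, ?_⟩
  · have := congrFun hfun 0
    simpa [phi] using this
  · refine (hfn 0).trans ?_
    have h1 : ((n : ℝ) + 1) ^ 2 ≤ 4 ^ n := by
      have := pow_le_pow_left₀ (by positivity) (coe_succ_le_two_pow n) 2
      rwa [← pow_mul, mul_comm n, pow_mul, show (2 : ℝ) ^ 2 = 4 by norm_num] at this
    calc _ = 64 * R ^ 2 * K ^ 2 / c * (((n : ℝ) + 1) ^ 2 * (2 * R) ^ n) := by
          rw [pow_zero]; ring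
      _ ≤ 64 * R ^ 2 * K ^ 2 / c * (4 ^ n * (2 * R) ^ n) := by gcongr
      _ = _ := by rw [← mul_pow]; congr 2; ring

theorem DiscChain.Avoids.mono {C : DiscChain} {S S' : Set ℤ} {u u' : ℤ → ℝ} (h : C.Avoids S' u')
    (hS : S ⊆ S') (hu : ∀ m, u m ≤ u' m) : C.Avoids S u :=
  fun i z hz m hm him => (hu m).trans (h i z hz m (hS hm) him)

/-! ### The series `ψₙ` -/

/-- The coefficients of the system for the series `ψ_(κ + 1)`, divided by `x`. -/
def psiCoeff (A : Ser2) (κ ι : ℕ) : PowerSeries ℂ :=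
  if ι ≤ κ + 1 then (-((ι : ℂ) + 1)) • alphaX A (κ + 1 - ι) else 0

/-- The system for the series `Q κ = ψ_(κ + 1)`. It consists of the coefficients of `y ^ (κ + 1)` in
the equation `X g = g`, where `g = y + ∑ ψₙ yⁿ`. The unknown `ψ₀` does not occur in it, because
`∂/∂y` kills the term of degree `0`. -/
structure IsPsiSystem (A : Ser2) (Q : ℕ → PowerSeries ℂ) : Prop where
  coeff_zero : ∀ κ, PowerSeries.coeff 0 (Q κ) = 0
  hasSum : ∀ κ, HasSum (fun ι => PowerSeries.X * psiCoeff A κ ι * Q ι)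
    (xxD (Q κ) + PowerSeries.C (κ : ℂ) * Q κ - PowerSeries.X * -alphaX A (κ + 1))

theorem IsPsiSystem.unique {A : Ser2} (hA : IsSaddleNode A) {Q Q' : ℕ → PowerSeries ℂ}
    (h : IsPsiSystem A Q) (h' : IsPsiSystem A Q') : Q = Q' := by
  funext κ
  refine sub_eq_zero.mp (eq_zero_of_system (fun κ : ℕ => (κ : ℂ)) (fun κ => Q κ - Q' κ)
    (fun κ ι => PowerSeries.X * psiCoeff A κ ι * (Q ι - Q' ι)) ?_ ?_ ?_ ?_ κ)
  · intro κ; rw [map_sub, h.coeff_zero, h'.coeff_zero, sub_zero]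
  · intro κ
    convert! (h.hasSum κ).sub (h'.hasSum κ) using 1
    · ext1 ι; rw [mul_sub]
    · rw [xxD_sub]; ring
  · intro m hm κ ι
    rw [pow_succ', mul_assoc]
    exact mul_dvd_mul_left _ ((hm ι).mul_left _)
  · intro m κ hκ hm hm' ι
    have hκ0 : κ = 0 := by exact_mod_cast hκ
    subst hκ0
    rw [show m + 2 = (m + 1) + 1 from rfl, pow_succ', mul_assoc]
    refine mul_dvd_mul_left _ ?_
    by_cases hι : (ι : ℂ) = 0
    · have hι0 : ι = 0 := by exact_mod_cast hι
      subst hι0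
      have hX : PowerSeries.X ∣ psiCoeff A 0 0 := by
        rw [psiCoeff, if_pos (by lia)]
        refine dvd_smul_of_dvd ?_ _
        rw [PowerSeries.X_dvd_iff, ← PowerSeries.coeff_zero_eq_constantCoeff_apply]
        exact coeff_zero_alphaX_one hA
      rw [pow_succ']
      exact mul_dvd_mul hX (hm 0)
    · exact (hm' ι hι).mul_left _

theorem sum_half_pow_sub_le (N : ℕ) (F : Finset ℕ) :
    ∑ ι ∈ F, (if ι ≤ N then (1 / 2 : ℝ) ^ (N - ι) else 0) ≤ 2 := by
  rw [← Finset.sum_filter]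
  have hinj : Set.InjOn (fun ι => N - ι) (F.filter fun ι => ι ≤ N) := by
    intro a ha b hb h
    simp only [Finset.coe_filter, Set.mem_ofPred_eq] at ha hb
    simp only at h
    lia
  rw [← Finset.sum_image (f := fun p => (1 / 2 : ℝ) ^ p) hinj]
  exact (summable_geometric_two.sum_le_tsum _ fun p _ => by positivity).trans
    tsum_geometric_two.le

/-- Solutions of the system for the series `ψ_(κ + 1)`, on the chains of discs that avoid the
non-negative integers. The growth of the coefficients like `κ + 1` is compensated by the divisors
`κ - ζ`, so that the exponential type does not depend on `κ`. -/
theorem exists_psi_hat_succ {A : Ser2} (hA : IsSaddleNode A) {c : ℝ} (hc : 0 < c) (hc1 : c ≤ 1)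
    {K R : ℝ} (hK : 1 ≤ K) (hR : 1 ≤ R)
    (hα : ∀ p m, ‖PowerSeries.coeff m (alphaX A p)‖ ≤ K * R ^ p * R ^ m) {C : DiscChain}
    (hC : C.Avoids {m | 0 ≤ m} fun m => c * max 1 |(m : ℝ)|) :
    ∃ f : ℕ → C.Fun (1536 * R ^ 2 * K ^ 2 / c), IsPsiSystem A (fun κ => DiscChain.unborel (f κ)) ∧
      ∀ κ, ‖f κ‖ ≤ 128 * R ^ 3 * K ^ 2 / c * (2 * R) ^ κ := by
  have hK0 : 0 < K := one_pos.trans_le hK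
  have hR0 : 0 < R := one_pos.trans_le hR
  have hcinv : 1 ≤ 1 / c := by rw [le_div_iff₀ hc]; linarith
  set lam : ℝ := 1536 * R ^ 2 * K ^ 2 / c with hlamdef
  have hlam : 0 < lam := by positivity
  have hRR : R ≤ R ^ 2 := by nlinarith
  have hKK : K ≤ K ^ 2 := by nlinarith
  have hlamge : 1536 * (R ^ 2 * K ^ 2) * (1 / c) = lam := by rw [hlamdef]; ring
  have hlamge1 : 1536 * (R ^ 2 * K ^ 2) ≤ lam := by
    rw [← hlamge]
    exact le_mul_of_one_le_right (by positivity) hcinv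
  have hR2 : 1 ≤ R ^ 2 := one_le_pow₀ hR
  have hK2 : 1 ≤ K ^ 2 := one_le_pow₀ hK
  have hRK : 1 ≤ R * K := by nlinarith
  have hterm : ∀ κ : ℕ, ∀ F : Finset ℕ,
      ∑ ι ∈ F, (if ι ≤ κ + 1 then ((ι : ℝ) + 1) * K * R ^ (κ + 1 - ι) else 0) * (2 * R) ^ ι ≤
        ((κ : ℝ) + 2) * (4 * R * K * (2 * R) ^ κ) := by
    intro κ F
    calc _ ≤ ∑ ι ∈ F, ((κ : ℝ) + 2) * K * (2 * R) ^ (κ + 1) *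
          (if ι ≤ κ + 1 then (1 / 2 : ℝ) ^ (κ + 1 - ι) else 0) := by
          refine Finset.sum_le_sum fun ι _ => ?_
          split_ifs with h
          · obtain ⟨p, hp⟩ := Nat.exists_eq_add_of_le h
            have hι : (ι : ℝ) + 1 ≤ (κ : ℝ) + 2 := by
              have : (ι : ℝ) ≤ ((κ + 1 : ℕ) : ℝ) := by exact_mod_cast h
              push_cast at this
              linarith
            rw [hp, Nat.add_sub_cancel_left]
            have e : (2 * R) ^ (ι + p) * (1 / 2 : ℝ) ^ p = R ^ p * (2 * R) ^ ι := by
              rw [pow_add, mul_assoc, ← mul_pow]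
              rw [show 2 * R * (1 / 2) = R by ring]
              ring
            calc ((ι : ℝ) + 1) * K * R ^ p * (2 * R) ^ ι =
                ((ι : ℝ) + 1) * (K * (R ^ p * (2 * R) ^ ι)) := by ring
              _ ≤ ((κ : ℝ) + 2) * (K * (R ^ p * (2 * R) ^ ι)) := by gcongr
              _ = _ := by rw [← e]; ring
          · simp
      _ ≤ ((κ : ℝ) + 2) * K * (2 * R) ^ (κ + 1) * 2 := by
          rw [← Finset.mul_sum]
          exact mul_le_mul_of_nonneg_left (sum_half_pow_sub_le (κ + 1) F) (by positivity)
      _ = _ := by ring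
  have key : ∃ f : ℕ → C.Fun lam,
      (∀ κ, ‖f κ‖ ≤ 2 * (2 * R ^ 2 * K / c) * (32 * R * K * (2 * R) ^ κ)) ∧
      ∀ κ, HasSum (fun ι => PowerSeries.X * psiCoeff A κ ι * DiscChain.unborel (f ι))
        (xxD (DiscChain.unborel (f κ)) + PowerSeries.C (κ : ℂ) * DiscChain.unborel (f κ) -
          PowerSeries.X * -alphaX A (κ + 1)) := by
    refine DiscChain.exists_solution_of_system (C := C) hlam (fun κ : ℕ => (κ : ℂ)) (psiCoeff A)
      (fun κ => -alphaX A (κ + 1))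
      (fun κ ι => if ι ≤ κ + 1 then ((ι : ℝ) + 1) * K * R ^ (κ + 1 - ι) else 0)
      (fun κ => K * R ^ (κ + 1)) (fun κ => (2 * R) ^ κ)
      (fun κ => c * max 1 |((κ : ℤ) : ℝ)|)
      (R := R) (B := 12 * R * K / c) (S := 2 * R ^ 2 * K / c) (Lam := 32 * R * K)
      (c₀ := c) hR0.le ?_ (by positivity) ?_ (fun κ => by positivity) ?_ ?_ ?_ ?_
      (fun κ _ => by positivity) ?_ hc ?_ ?_ ?_ ?_ ?_ ?_ ?_ ?_
    · nlinarith
    · nlinarith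
    · intro κ ι m
      simp only [psiCoeff]
      split_ifs
      · rw [map_smul, smul_eq_mul, norm_mul, norm_neg]
        have : ‖(ι : ℂ) + 1‖ = (ι : ℝ) + 1 := by
          have := Complex.norm_natCast (ι + 1)
          push_cast at this
          exact this
        rw [this]
        calc _ ≤ ((ι : ℝ) + 1) * (K * R ^ (κ + 1 - ι) * R ^ m) :=
              mul_le_mul_of_nonneg_left (hα _ _) (by positivity)
          _ = _ := by ring
      · simp
    · intro κ m
      rw [map_neg, norm_neg]
      exact hα _ _
    · intro κ ι h1 h2
      have h1' : κ = 0 := by exact_mod_cast h1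
      have h2' : ι = 0 := by exact_mod_cast h2
      subst h1' h2'
      rw [psiCoeff, if_pos (by lia), map_smul, coeff_zero_alphaX_one hA, smul_zero]
    · intro κ h1
      have h1' : κ = 0 := by exact_mod_cast h1
      subst h1'
      rw [map_neg, coeff_zero_alphaX_one hA, neg_zero]
    · intro κ hne i z hz
      have := hC i z hz (κ : ℤ) (by simp) (Or.inr (by exact_mod_cast hne))
      rwa [norm_sub_rev, Int.cast_natCast] at this
    · rw [← hlamge]
      refine le_mul_of_one_le_left (by positivity) ?_
      nlinarith
    · intro κ h0 i z hz
      have := hC (i + 1) z hz 0 (by simp) (Or.inl (Nat.succ_ne_zero i))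
      simpa using this
    · intro κ _ F
      refine (hterm κ F).trans ?_
      have h1 := le_max_left 1 |((κ : ℤ) : ℝ)|
      have h2 := (le_abs_self _).trans (le_max_right 1 |((κ : ℤ) : ℝ)|)
      have h3 : (κ : ℝ) + 2 ≤ 3 * max 1 |((κ : ℤ) : ℝ)| := by
        push_cast at *
        linarith
      calc _ ≤ (3 * max 1 |((κ : ℤ) : ℝ)|) * (4 * R * K * (2 * R) ^ κ) := by gcongr
        _ = _ := by field_simp; ring
    · intro κ h0 F
      refine (hterm κ F).trans (le_of_eq ?_)
      have h0' : κ = 0 := by exact_mod_cast h0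
      subst h0'
      push_cast
      ring
    · rw [← hlamge]
      refine le_of_eq ?_
      ring
    · nlinarith
    · intro κ _
      have h1 := le_max_left 1 |((κ : ℤ) : ℝ)|
      calc 2 * (K * R ^ (κ + 1)) = 2 * R * K * (1 * R ^ κ) := by ring
        _ ≤ 2 * R ^ 2 * K * (max 1 |((κ : ℤ) : ℝ)| * (2 * R) ^ κ) := by
            gcongr
            linarith
        _ = _ := by field_simp
    · intro κ h0
      have h0' : κ = 0 := by exact_mod_cast h0
      subst h0'
      calc 2 * R * (K * R ^ (0 + 1)) = 2 * R ^ 2 * K := by ring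
        _ ≤ 2 * R ^ 2 * K * (1 / c) := le_mul_of_one_le_right (by positivity) hcinv
        _ = _ := by ring
  obtain ⟨f, hfn, hf⟩ := key
  refine ⟨f, ⟨fun κ => DiscChain.coeff_zero_unborel _, hf⟩, fun κ => (hfn κ).trans (le_of_eq ?_)⟩
  ring

/-- A chain of discs whose first disc is `|ζ| < s`, all the others being the disc of centre `s / 2`
and radius `s / 4`. -/
def standardChain (s : ℝ) (hs : 0 < s) : DiscChain where
  o i := if i = 0 then 0 else ((s / 2 : ℝ) : ℂ)
  r i := if i = 0 then s else s / 4
  b i := if i = 0 then 0 else ((s / 2 : ℝ) : ℂ)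
  o_zero := rfl
  b_zero := rfl
  b_mem i := by
    refine Metric.mem_ball_self ?_
    split_ifs <;> linarith
  b_succ_mem i := by
    rw [if_neg (Nat.succ_ne_zero i)]
    split_ifs
    · rw [mem_ball_zero_iff, Complex.norm_real, Real.norm_of_nonneg (by linarith)]
      linarith
    · exact Metric.mem_ball_self (by linarith)

theorem one_le_abs_intCast {m : ℤ} (hm : m ≠ 0) : 1 ≤ |(m : ℝ)| := by
  exact_mod_cast Int.one_le_abs hm

theorem norm_intCast_complex (m : ℤ) : ‖(m : ℂ)‖ = |(m : ℝ)| := by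
  rw [Complex.norm_intCast]

theorem standardChain_avoids {s : ℝ} (hs : 0 < s) (hs1 : s < 1) :
    (standardChain s hs).Avoids Set.univ
      fun m => min (s / 4) (1 - s) * max 1 |(m : ℝ)| := by
  have hc0 : 0 ≤ min (s / 4) (1 - s) := le_min (by linarith) (by linarith)
  -- away from the origin it suffices to know that `|z| < s`
  have key : ∀ z : ℂ, ‖z‖ < s → ∀ m : ℤ, m ≠ 0 →
      min (s / 4) (1 - s) * max 1 |(m : ℝ)| ≤ ‖z - m‖ := by
    intro z hz m hm
    have h1 := one_le_abs_intCast hm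
    have h2 : |(m : ℝ)| - ‖z‖ ≤ ‖z - m‖ := by
      rw [← norm_intCast_complex, norm_sub_rev]
      exact norm_sub_norm_le _ _
    rw [max_eq_right h1]
    calc _ ≤ (1 - s) * |(m : ℝ)| := by gcongr; exact min_le_right _ _
      _ ≤ _ := by nlinarith
  intro i z hz m _ him
  simp only
  have hz' : z ∈ Metric.ball (if i = 0 then (0 : ℂ) else ((s / 2 : ℝ) : ℂ))
    (if i = 0 then s else s / 4) := hz
  by_cases hi : i = 0
  · rw [if_pos hi, if_pos hi, mem_ball_zero_iff] at hz'
    exact key z hz' m (him.resolve_left fun h => h hi)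
  · rw [if_neg hi, if_neg hi, mem_ball_iff_norm] at hz'
    have hn : ‖((s / 2 : ℝ) : ℂ)‖ = s / 2 := by
      rw [Complex.norm_real, Real.norm_of_nonneg (by linarith)]
    by_cases hm : m = 0
    · subst hm
      have := norm_sub_norm_le ((s / 2 : ℝ) : ℂ) (((s / 2 : ℝ) : ℂ) - z)
      rw [sub_sub_cancel, norm_sub_rev _ z, hn] at this
      rw [Int.cast_zero, Int.cast_zero, sub_zero, abs_zero, max_eq_left zero_le_one, mul_one]
      exact (min_le_left _ _).trans (by linarith)
    · refine key z ?_ m hm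
      have := norm_add_le (z - ((s / 2 : ℝ) : ℂ)) ((s / 2 : ℝ) : ℂ)
      rw [sub_add_cancel, hn] at this
      linarith

theorem exists_isPsiSystem {A : Ser2} (hA : IsSaddleNode A) : ∃ Q, IsPsiSystem A Q := by
  obtain ⟨K, R, hK, hR, hα⟩ := exists_bound_alphaX hA
  have h := (standardChain_avoids (s := 1 / 2) (by norm_num) (by norm_num)).mono
    (Set.subset_univ {m | 0 ≤ m}) fun _ => le_rfl
  obtain ⟨f, hf, -⟩ := exists_psi_hat_succ hA (by norm_num) (by norm_num) hK hR hα h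
  exact ⟨_, hf⟩

/-- The series `ψₙ`: for `n ≥ 1` they solve the system of `IsPsiSystem`, and `ψ₀` is then obtained
from the equation `(x² d/dx - 1) ψ₀ = - a₋₁ (1 + ψ₁)`. The choice involved is immaterial by
`IsPsiSystem.unique`. -/
def psi {A : Ser2} (hA : IsSaddleNode A) (n : ℕ) : PowerSeries ℂ :=
  if n = 0 then solve (-1) (-(alpha A 0 * (1 + (exists_isPsiSystem hA).choose 0)))
  else (exists_isPsiSystem hA).choose (n - 1)

theorem isPsiSystem_psi {A : Ser2} (hA : IsSaddleNode A) :
    IsPsiSystem A fun κ => psi hA (κ + 1) :=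
  (exists_isPsiSystem hA).choose_spec

theorem coeff_zero_alpha {A : Ser2} (hA : IsSaddleNode A) (p : ℕ) :
    PowerSeries.coeff 0 (alpha A p) = 0 := by
  rw [PowerSeries.coeff_zero_eq_constantCoeff_apply, ← PowerSeries.X_dvd_iff]
  exact X_dvd_alpha hA p

theorem psi_zero_spec {A : Ser2} (hA : IsSaddleNode A) :
    PowerSeries.coeff 0 (psi hA 0) = 0 ∧
      xxD (psi hA 0) + PowerSeries.C (-1) * psi hA 0 = -(alpha A 0 * (1 + psi hA 1)) := by
  have := solve_spec (-1) (-(alpha A 0 * (1 + psi hA 1)))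
    (by
      rw [map_neg, PowerSeries.coeff_zero_eq_constantCoeff_apply, map_mul,
        ← PowerSeries.coeff_zero_eq_constantCoeff_apply, coeff_zero_alpha hA, zero_mul, neg_zero])
    (by simp)
  exact this

theorem coeff_zero_psi {A : Ser2} (hA : IsSaddleNode A) (n : ℕ) :
    PowerSeries.constantCoeff (psi hA n) = 0 := by
  rw [← PowerSeries.coeff_zero_eq_constantCoeff_apply]
  rcases n with _ | n
  · exact (psi_zero_spec hA).1
  · exact (isPsiSystem_psi hA).coeff_zero n

/-- The transformation with components `x` and `y + ∑ ψₙ yⁿ` is a left inverse of `θ`. -/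
theorem subst_transf_psi {A : Ser2} (hA : IsSaddleNode A) :
    MvPowerSeries.subst (transf (phi A)) (transf (psi hA) 1) = MvPowerSeries.X 1 := by
  have h1 : transf (psi hA) 1 = ySeries fun n => (if n = 1 then 1 else 0) + psi hA n := by
    simp [transf, X_one_add_ySeries]
  rw [h1]
  refine subst_transf_phi_of_system hA _ ?_ ?_
  · intro n
    rw [map_add, PowerSeries.coeff_zero_eq_constantCoeff_apply (psi hA n), coeff_zero_psi, add_zero]
    split_ifs <;> simp
  · intro n
    rcases n with _ | κ
    · have := (psi_zero_spec hA).2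
      simp only [zero_ne_one, if_false, zero_add, Finset.sum_range_succ, Finset.sum_range_zero]
      simp only [Nat.cast_zero, zero_smul, zero_add, zero_sub, if_true, Nat.cast_one, one_smul,
        Nat.sub_self]
      exact this
    · have h := (isPsiSystem_psi hA).hasSum κ
      have hfin : HasSum (fun ι => PowerSeries.X * psiCoeff A κ ι * psi hA (ι + 1))
          (∑ ι ∈ Finset.range (κ + 2), PowerSeries.X * psiCoeff A κ ι * psi hA (ι + 1)) := by
        refine hasSum_sum_of_ne_finset_zero fun ι hι => ?_
        rw [Finset.mem_range] at hι
        rw [psiCoeff, if_neg (by lia), mul_zero, zero_mul]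
      have e := h.unique hfin
      have hs : ∀ ι ∈ Finset.range (κ + 2), PowerSeries.X * psiCoeff A κ ι * psi hA (ι + 1) =
          -(((ι + 1 : ℕ) : ℂ) • (alpha A (κ + 1 + 1 - (ι + 1)) * psi hA (ι + 1))) := by
        intro ι hι
        rw [Finset.mem_range] at hι
        rw [psiCoeff, if_pos (by lia), mul_smul_comm, X_mul_alphaX hA, Nat.add_sub_add_right]
        push_cast
        rw [smul_mul_assoc, neg_smul]
      rw [Finset.sum_congr rfl hs, Finset.sum_neg_distrib, sub_eq_iff_eq_add, mul_neg,
        X_mul_alphaX hA] at e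
      rw [Finset.sum_range_succ', Nat.cast_zero, zero_smul, add_zero]
      simp only [mul_add, smul_add, Finset.sum_add_distrib]
      have hd : ∑ k ∈ Finset.range (κ + 1 + 1), ((k + 1 : ℕ) : ℂ) •
          (alpha A (κ + 1 + 1 - (k + 1)) * if k + 1 = 1 then 1 else 0) = alpha A (κ + 1) := by
        rw [Finset.sum_eq_single 0]
        · simp
        · intro k _ hk
          simp [hk]
        · simp
      rw [hd, xxD_add]
      have h0 : xxD (if κ + 1 = 1 then 1 else 0) +
          PowerSeries.C (((κ + 1 : ℕ) : ℂ) - 1) * (if κ + 1 = 1 then 1 else 0) = 0 := by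
        split_ifs with hκ
        · have : κ = 0 := by lia
          subst this
          simp
        · simp
      have hcast : ((κ + 1 : ℕ) : ℂ) - 1 = κ := by push_cast; ring
      rw [hcast] at h0 ⊢
      linear_combination h0 + e

/-- The Borel transform carries `x² d/dx` to the multiplication by `-ζ`. -/
theorem hat_sub_xxD (v : PowerSeries ℂ) : hat (v - xxD v) = (PowerSeries.X + 1) * hat v := by
  ext n
  rw [add_mul, one_mul, map_add]
  simp only [hat, borel, tilde, PowerSeries.coeff_mk, PowerSeries.coeff_rescale, map_sub,
    coeff_succ_xxD]
  rcases n with _ | n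
  · simp
  · rw [PowerSeries.coeff_succ_X_mul, PowerSeries.coeff_mk, Nat.factorial_succ]
    have h1 : ((n : ℂ) + 1) ≠ 0 := by exact_mod_cast Nat.succ_ne_zero n
    have h2 : (n.factorial : ℂ) ≠ 0 := by exact_mod_cast n.factorial_ne_zero
    push_cast
    field_simp
    ring

/-- Bounds for `ψ̂ₙ`, `n ≥ 1`, and for `(ζ + 1) ψ̂₀` on the chains of discs that avoid the
non-negative integers. -/
theorem exists_psi_hat {A : Ser2} (hA : IsSaddleNode A) {c : ℝ} (hc : 0 < c) (hc1 : c ≤ 1) :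
    ∃ K L M : ℝ, 0 < K ∧ 0 < L ∧ 0 < M ∧ ∀ C : DiscChain,
      C.Avoids {m | 0 ≤ m} (fun m => c * max 1 |(m : ℝ)|) →
      (∀ n, 1 ≤ n → ∃ f : C.Fun M, DiscChain.unborel f = psi hA n ∧ ‖f‖ ≤ K * L ^ n) ∧
      ∃ f : C.Fun M, DiscChain.unborel f = psi hA 0 - xxD (psi hA 0) ∧ ‖f‖ ≤ K := by
  obtain ⟨K, R, hK, hR, hα⟩ := exists_bound_alphaX hA
  have hK0 : 0 < K := one_pos.trans_le hK
  have hR0 : 0 < R := one_pos.trans_le hR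
  have hcinv : 1 ≤ 1 / c := by rw [le_div_iff₀ hc]; linarith
  set M : ℝ := 1536 * R ^ 2 * K ^ 2 / c with hMdef
  set T : ℝ := 128 * R ^ 3 * K ^ 2 / c with hT
  have hM0 : 0 < M := by positivity
  have hT0 : 0 < T := by positivity
  have hRK : 1 ≤ R ^ 2 * K ^ 2 := one_le_mul_of_one_le_of_one_le (one_le_pow₀ hR) (one_le_pow₀ hK)
  have hM2 : 2 * R ≤ M := by
    have h1 : 1536 * (R ^ 2 * K ^ 2) * (1 / c) = M := by rw [hMdef]; ring
    have h2 : 1536 * (R ^ 2 * K ^ 2) ≤ 1536 * (R ^ 2 * K ^ 2) * (1 / c) :=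
      le_mul_of_one_le_right (by positivity) hcinv
    have h3 : R ≤ R ^ 2 := by nlinarith
    have h4 : R ^ 2 ≤ R ^ 2 * K ^ 2 := le_mul_of_one_le_right (by positivity) (one_le_pow₀ hK)
    nlinarith
  have hM1 : 1 ≤ M := by linarith
  refine ⟨2 * K * (1 + T), 2 * R, M, by positivity, by positivity, by positivity, fun C hC => ?_⟩
  obtain ⟨f, hf, hfn⟩ := exists_psi_hat_succ hA hc hc1 hK hR hα hC
  have hfψ : ∀ κ, DiscChain.unborel (f κ) = psi hA (κ + 1) :=
    congrFun (hf.unique hA (isPsiSystem_psi hA))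
  refine ⟨fun n hn => ?_, ?_⟩
  · obtain ⟨κ, rfl⟩ := Nat.exists_eq_add_of_le' hn
    refine ⟨f κ, hfψ κ, (hfn κ).trans ?_⟩
    have : (2 * R) ^ κ ≤ (2 * R) ^ (κ + 1) := pow_le_pow_right₀ (by linarith) κ.le_succ
    refine mul_le_mul ?_ this (by positivity) (by positivity)
    nlinarith
  · obtain ⟨e, hen, he⟩ := DiscChain.exists_one C hM0
    have hb : ∀ m, ‖PowerSeries.coeff m (alphaX A 0)‖ ≤ K * R ^ m := fun m => by
      simpa using hα 0 m
    refine ⟨-DiscChain.opSeries hM0 (alphaX A 0) (e + DiscChain.integ hM0 (f 0)), ?_, ?_⟩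
    · rw [map_neg, DiscChain.unborel_opSeries hM0 hR0.le hM2 hb, map_add, he,
        DiscChain.unborel_integ, hfψ, zero_add]
      have h1 := (psi_zero_spec hA).2
      rw [← X_mul_alphaX hA, map_neg, map_one] at h1
      linear_combination h1
    · rw [norm_neg]
      have h1 := DiscChain.norm_opSeries_le (C := C) hM0 hR0.le hM2 hb
      refine (ContinuousLinearMap.le_of_opNorm_le _ h1 _).trans ?_
      refine mul_le_mul_of_nonneg_left ?_ (by positivity)
      refine (norm_add_le _ _).trans (add_le_add hen ?_)
      refine (ContinuousLinearMap.le_of_opNorm_le _ (DiscChain.norm_integ_le hM0) _).trans ?_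
      have h2 : ‖f 0‖ ≤ T := by simpa using hfn 0
      have h3 : 1 / M ≤ 1 := by rw [div_le_one hM0]; exact hM1
      calc 1 / M * ‖f 0‖ ≤ 1 * T := mul_le_mul h3 h2 (norm_nonneg _) zero_le_one
        _ = T := one_mul T

/-- `ψ̂₀` itself is defined on the chains of discs that also avoid `-1`. -/
theorem exists_psi_zero_hat {A : Ser2} (hA : IsSaddleNode A) {c : ℝ} (hc : 0 < c) (hc1 : c ≤ 1)
    {C : DiscChain} (hC : C.Avoids {m | -1 ≤ m} fun m => c * max 1 |(m : ℝ)|) :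
    ∃ (M : ℝ) (f : C.Fun M), DiscChain.unborel f = psi hA 0 := by
  obtain ⟨K, L, M, hK, hL, hM, H⟩ := exists_psi_hat hA hc hc1
  obtain ⟨-, f, hf, -⟩ := H C (hC.mono (fun m (hm : 0 ≤ m) => (by lia : -1 ≤ m)) fun _ => le_rfl)
  obtain ⟨D, hD, -⟩ := DiscChain.exists_divSub (C := C) (lam := M) (-1) hc (fun i z hz => by
    have := hC i z hz (-1) (by simp) (Or.inr (by simp))
    rw [norm_sub_rev]
    simpa using this)
  refine ⟨M, D (-f), solve_unique (-1) _ _ (DiscChain.coeff_zero_unborel _) (psi_zero_spec hA).1 ?_⟩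
  rw [DiscChain.unborel_divSub fun z hz => hD _ 0 z hz, map_neg, hf, map_neg, map_one]
  ring

/-! ### Analytic continuation along a path -/

theorem IsContinuation.mono_congr {φ : PowerSeries ℂ} {γ γ' : ℝ → ℂ} {I J : Set ℝ}
    {F : ℝ → ℂ → ℂ} (h : IsContinuation φ γ I F) (hJ : J ⊆ I) (hγ : ∀ t ∈ J, γ t = γ' t) :
    IsContinuation φ γ' J F where
  analytic t ht := hγ t ht ▸ h.analytic t (hJ ht)
  initial := h.initial
  compat t ht := by
    filter_upwards [nhdsWithin_mono t hJ (h.compat t (hJ ht)), self_mem_nhdsWithin] with s hs hsJ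
    rwa [hγ s hsJ] at hs

/-- Two continuations of a series along the same path agree. -/
theorem IsContinuation.eventuallyEq {φ : PowerSeries ℂ} {γ : ℝ → ℂ} {F G : ℝ → ℂ → ℂ}
    (hF : IsContinuation φ γ (Set.Icc 0 1) F) (hG : IsContinuation φ γ (Set.Icc 0 1) G)
    (hγ : ContinuousOn γ (Set.Icc 0 1)) (h0 : γ 0 = 0) {t : ℝ} (ht : t ∈ Set.Icc (0 : ℝ) 1) :
    F t =ᶠ[𝓝 (γ t)] G t := by
  have hstart : F 0 =ᶠ[𝓝 (γ 0)] G 0 := by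
    have h := hF.initial.sub hG.initial
    rw [sub_self] at h
    rw [h0]
    filter_upwards [h.eventually_eq_zero] with z hz
    exact sub_eq_zero.mp hz
  refine (isPreconnected_Icc.induction₂ (s := Set.Icc (0 : ℝ) 1)
    (fun s t => (F s =ᶠ[𝓝 (γ s)] G s) ↔ (F t =ᶠ[𝓝 (γ t)] G t)) ?_
    (fun _ _ _ _ _ _ h h' => h.trans h')
    (fun _ _ _ _ h => h.symm) (Set.left_mem_Icc.mpr zero_le_one) ht).mp hstart
  intro t ht
  obtain ⟨r, hr, hball⟩ := Metric.eventually_nhds_iff_ball.mp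
    ((hF.analytic t ht).eventually_analyticAt.and (hG.analytic t ht).eventually_analyticAt)
  have hFa : AnalyticOnNhd ℂ (F t) (Metric.ball (γ t) r) := fun z hz => (hball z hz).1
  have hGa : AnalyticOnNhd ℂ (G t) (Metric.ball (γ t) r) := fun z hz => (hball z hz).2
  filter_upwards [hF.compat t ht, hG.compat t ht, hγ t ht (Metric.ball_mem_nhds _ hr)]
    with s hsF hsG hs
  have hsb : γ s ∈ Metric.ball (γ t) r := hs
  have hpre : IsPreconnected (Metric.ball (γ t) r) := (convex_ball _ _).isPreconnected
  constructor
  · intro h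
    have := hFa.eqOn_of_preconnected_of_eventuallyEq hGa hpre (Metric.mem_ball_self hr) h
    have h' : F t =ᶠ[𝓝 (γ s)] G t := this.eventuallyEq_of_mem (Metric.isOpen_ball.mem_nhds hsb)
    exact hsF.trans (h'.trans hsG.symm)
  · intro h
    have h' : F t =ᶠ[𝓝 (γ s)] G t := hsF.symm.trans (h.trans hsG)
    have := hFa.eqOn_of_preconnected_of_eventuallyEq hGa hpre hsb h'
    exact this.eventuallyEq_of_mem (Metric.ball_mem_nhds _ hr)

namespace DiscChain

/-- The path `γ` runs through the discs of the chain: `τ` is an increasing subdivision of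
`[0, +∞)` and `γ` stays in `Dᵢ` between the times `τ i` and `τ (i + 1)`. -/
structure Follows (C : DiscChain) (γ : ℝ → ℂ) (τ : ℕ → ℝ) : Prop where
  zero : τ 0 = 0
  strictMono : StrictMono τ
  tendsto : Tendsto τ atTop atTop
  cont : ContinuousOn γ (Set.Ici 0)
  mem : ∀ i, ∀ t ∈ Set.Icc (τ i) (τ (i + 1)), γ t ∈ C.disc i

variable {C : DiscChain} {γ : ℝ → ℂ} {τ : ℕ → ℝ} {lam : ℝ}

theorem Follows.exists_lt (h : C.Follows γ τ) (t : ℝ) : ∃ i, t < τ (i + 1) :=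
  ((h.tendsto.comp (tendsto_add_atTop_nat 1)).eventually_gt_atTop t).exists

open Classical in
/-- The index `i` such that `τ i ≤ t < τ (i + 1)`. -/
def Follows.idx (h : C.Follows γ τ) (t : ℝ) : ℕ := Nat.find (h.exists_lt t)

theorem Follows.idx_lt (h : C.Follows γ τ) (t : ℝ) : t < τ (h.idx t + 1) := by
  classical
  exact Nat.find_spec (h.exists_lt t)

theorem Follows.le_of_idx (h : C.Follows γ τ) {t : ℝ} (ht : 0 ≤ t) : τ (h.idx t) ≤ t := by
  classical
  rcases hi : h.idx t with _ | j
  · rwa [h.zero]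
  · exact not_lt.mp (Nat.find_min (h.exists_lt t) (m := j) (by
      change j < h.idx t
      lia))

theorem Follows.idx_eq (h : C.Follows γ τ) {t : ℝ} (ht : 0 ≤ t) {i : ℕ} (h1 : τ i ≤ t)
    (h2 : t < τ (i + 1)) : h.idx t = i := by
  have h3 := h.strictMono.lt_iff_lt.mp ((h.le_of_idx ht).trans_lt h2)
  have h4 := h.strictMono.lt_iff_lt.mp (h1.trans_lt (h.idx_lt t))
  lia

theorem Follows.mem_disc (h : C.Follows γ τ) {t : ℝ} (ht : 0 ≤ t) : γ t ∈ C.disc (h.idx t) :=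
  h.mem _ t ⟨h.le_of_idx ht, (h.idx_lt t).le⟩

/-- A function on a chain of discs provides an analytic continuation along the paths that run
through the chain. -/
theorem Follows.isContinuation (h : C.Follows γ τ) (x : C.Fun lam) :
    IsContinuation (hat (unborel x)) γ (Set.Ici 0) fun t => val x (h.idx t) where
  analytic t ht := analyticAt_val x (h.mem_disc ht)
  initial := by
    have h0 : h.idx 0 = 0 := h.idx_eq le_rfl h.zero.le (by
      rw [← h.zero]
      exact h.strictMono zero_lt_one)
    simp only [h0]
    exact hasFPowerSeriesAt_val x
  compat t ht := by
    have hcont := h.cont t ht ((C.isOpen_disc _).mem_nhds (h.mem_disc ht))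
    have hlt : ∀ᶠ s in 𝓝[Set.Ici 0] t, s < τ (h.idx t + 1) :=
      nhdsWithin_le_nhds (gt_mem_nhds (h.idx_lt t))
    have hgt : ∀ᶠ s in 𝓝[Set.Ici 0] t, ∀ j, h.idx t = j + 1 → τ j < s := by
      rcases hi : h.idx t with _ | j
      · exact Eventually.of_forall fun s j hj => by lia
      · have : τ j < t := (h.strictMono (Nat.lt_succ_self j)).trans_le
          (by have := h.le_of_idx ht; rwa [hi] at this)
        filter_upwards [nhdsWithin_le_nhds (lt_mem_nhds this)] with s hs k hk
        rwa [← Nat.succ_injective hk]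
    filter_upwards [hcont, hlt, hgt, self_mem_nhdsWithin] with s hs hs1 hs2 (hs0 : 0 ≤ s)
    have hs' : γ s ∈ C.disc (h.idx t) := hs
    -- the index of `s` is that of `t` or the preceding one
    by_cases hst : τ (h.idx t) ≤ s
    · rw [h.idx_eq hs0 hst hs1]
    · rcases hi : h.idx t with _ | j
      · rw [hi, h.zero] at hst
        exact absurd hs0 hst
      · rw [hi] at hst hs'
        have hsj : h.idx s = j := h.idx_eq hs0 (hs2 j hi).le (not_le.mp hst)
        have hsd : γ s ∈ C.disc j := hsj ▸ h.mem_disc hs0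
        rw [hsj]
        filter_upwards [(C.isOpen_disc j).mem_nhds hsd, (C.isOpen_disc (j + 1)).mem_nhds hs']
          with z h1 h2
        exact (isHolo_val x).compat j z h1 h2

theorem exists_follows {o : ℕ → ℂ} {r : ℕ → ℝ} (ho : o 0 = 0) (h0 : γ 0 = 0) (hτ0 : τ 0 = 0)
    (hτ : StrictMono τ) (hτ' : Tendsto τ atTop atTop) (hγ : ContinuousOn γ (Set.Ici 0))
    (hmem : ∀ i, ∀ t ∈ Set.Icc (τ i) (τ (i + 1)), γ t ∈ Metric.ball (o i) (r i)) :
    ∃ C : DiscChain, (∀ i, C.disc i = Metric.ball (o i) (r i)) ∧ (∀ i, C.b i = γ (τ i)) ∧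
      C.Follows γ τ := by
  let C : DiscChain :=
    { o := o
      r := r
      b := fun i => γ (τ i)
      o_zero := ho
      b_zero := by rw [hτ0, h0]
      b_mem := fun i => hmem i _ ⟨le_rfl, hτ.monotone i.le_succ⟩
      b_succ_mem := fun i => hmem i _ ⟨hτ.monotone i.le_succ, le_rfl⟩ }
  exact ⟨C, fun i => rfl, fun i => rfl, ⟨hτ0, hτ, hτ', hγ, hmem⟩⟩

end DiscChain

/-- The subdivision `0, a, a + h, a + 2 h, …`. -/
def mesh (a h : ℝ) : ℕ → ℝ
  | 0 => 0
  | i + 1 => a + i * h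

theorem mesh_strictMono {a h : ℝ} (ha : 0 < a) (hh : 0 < h) : StrictMono (mesh a h) := by
  refine strictMono_nat_of_lt_succ fun i => ?_
  rcases i with _ | i
  · simpa [mesh] using ha
  · simp only [mesh]
    push_cast
    linarith

theorem tendsto_mesh {a h : ℝ} (hh : 0 < h) : Tendsto (mesh a h) atTop atTop := by
  rw [← tendsto_add_atTop_iff_nat 1]
  exact tendsto_atTop_add_const_left _ _ (tendsto_natCast_atTop_atTop.atTop_mul_const hh)

/-! ### Adapted paths -/

/-- Adapted paths are parametrised by arc length, hence `1`-Lipschitz. -/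
theorem IsAdapted.norm_sub_le {ρ : ℝ} {P : Set ℂ} {γ : ℝ → ℂ} (hγ : IsAdapted ρ P γ) {s t : ℝ}
    (hs : 0 ≤ s) (hst : s ≤ t) : ‖γ t - γ s‖ ≤ t - s := by
  rcases hst.eq_or_lt with rfl | hlt
  · simp
  have ht : 0 < t := hs.trans_lt hlt
  have hac : AbsolutelyContinuousOnInterval γ s t := (hγ.abs_cont t ht).mono (by
    rw [Set.uIcc_of_le hst, Set.uIcc_of_le ht.le]
    exact Set.Icc_subset_Icc_left hs)
  -- it suffices to integrate the component of the velocity in the direction of `γ t - γ s`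
  set L : ℂ →L[ℝ] ℝ := innerSL ℝ (γ t - γ s) with hL
  have hLac : AbsolutelyContinuousOnInterval (fun u => L (γ u)) s t := by
    refine squeeze_zero (fun E => Finset.sum_nonneg fun _ _ => dist_nonneg)
      (fun E => ?_) (by simpa using Tendsto.const_mul ‖L‖ hac)
    rw [Finset.mul_sum]
    refine Finset.sum_le_sum fun i _ => ?_
    rw [dist_eq_norm, dist_eq_norm, ← map_sub]
    exact L.le_opNorm _
  have hint := hLac.integral_deriv_eq_sub
  have hderiv : ∀ᵐ u, u ∈ Set.uIoc s t → ‖deriv (fun u => L (γ u)) u‖ ≤ ‖γ t - γ s‖ := by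
    have := hγ.unit_speed
    rw [ae_restrict_iff' measurableSet_Ioi] at this
    filter_upwards [this] with u hu hut
    rw [Set.uIoc_of_le hst] at hut
    have hu1 := hu (hs.trans_lt hut.1)
    have hd : DifferentiableAt ℝ γ u := by
      by_contra hd
      rw [deriv_zero_of_not_differentiableAt hd, norm_zero] at hu1
      exact zero_ne_one hu1
    have hd' : HasDerivAt (fun u => L (γ u)) (L (deriv γ u)) u :=
      L.hasFDerivAt.comp_hasDerivAt u hd.hasDerivAt
    rw [hd'.deriv]
    have := L.le_opNorm (deriv γ u)
    rwa [hu1, mul_one, hL, innerSL_apply_norm] at this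
  have hle := intervalIntegral.norm_integral_le_of_norm_le_const_ae hderiv
  rw [hint, abs_of_pos (sub_pos.mpr hlt), ← map_sub, hL, innerSL_apply_apply,
    real_inner_self_eq_norm_sq, Real.norm_of_nonneg (by positivity), sq] at hle
  by_contra hcon
  push Not at hcon
  have : 0 < ‖γ t - γ s‖ := (sub_pos.mpr hlt).trans hcon
  nlinarith

/-- If the segment from the origin to `ζ` stays at distance `ρ` from `N e`, then, by homothety, `ζ`
stays at distance `ρ k / N` from `k e` for `k ≥ N`. -/
theorem le_norm_sub_of_segment {ρ : ℝ} (hρ : 0 < ρ) {N : ℕ} (hN : 1 ≤ N) {e : ℂ}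
    {ζ : ℂ} (h : ∀ w ∈ segment ℝ 0 ζ, ρ ≤ ‖w - N * e‖) {k : ℝ} (hk : ρ ≤ ‖ζ - k * e‖) :
    ρ / N * max 1 k ≤ ‖ζ - k * e‖ := by
  have hN0 : (0 : ℝ) < N := by exact_mod_cast hN
  have hN1 : (1 : ℝ) ≤ N := by exact_mod_cast hN
  rcases le_total k N with hkN | hkN
  · refine le_trans ?_ hk
    rw [div_mul_eq_mul_div, div_le_iff₀ hN0]
    exact mul_le_mul_of_nonneg_left (max_le hN1 hkN) hρ.le
  · have hk0 : 0 < k := hN0.trans_le hkN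
    rw [max_eq_right (hN1.trans hkN)]
    have hmem : ((N / k : ℝ) : ℂ) * ζ ∈ segment ℝ 0 ζ := by
      rw [segment_eq_image]
      exact ⟨N / k, ⟨by positivity, (div_le_one hk0).mpr hkN⟩, by simp⟩
    have := h _ hmem
    have e1 : ((N / k : ℝ) : ℂ) * ζ - N * e = ((N / k : ℝ) : ℂ) * (ζ - k * e) := by
      have : (k : ℂ) ≠ 0 := by exact_mod_cast hk0.ne'
      push_cast
      field_simp
    rw [e1, norm_mul, Complex.norm_real, Real.norm_of_nonneg (by positivity)] at this
    calc ρ / N * k ≤ (N / k * ‖ζ - k * e‖) / N * k := by gcongr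
      _ = _ := by field_simp

/-- An adapted path runs through a chain of discs which stay away from the integers, and the
polygonal line of the chain is not longer than the path. The exponential bounds on the chain
therefore become bounds along the path. -/
theorem IsAdapted.exists_chain {ρ : ℝ} (hρ : 0 < ρ) (hρ' : ρ < 1 / 2) {P : Set ℂ} {γ : ℝ → ℂ}
    (hγ : IsAdapted ρ P γ) {S : Set ℤ} {u : ℤ → ℝ} (hu : ∀ m, m ≠ 0 → u m ≤ |(m : ℝ)|)
    (hP : ∀ ζ ∈ P, ∀ m ∈ S, ρ ≤ ‖ζ - m‖ ∧ u m ≤ ‖ζ - m‖) :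
    ∃ C : DiscChain, C.Avoids S (fun m => u m / 2) ∧ ∀ lam : ℝ, 0 ≤ lam → ∀ x : C.Fun lam,
      ∃ F, IsContinuation (hat (DiscChain.unborel x)) γ (Set.Ici 0) F ∧
        ∀ t, 0 ≤ t → ‖F t (γ t)‖ ≤ ‖x‖ * Real.exp (lam * t) := by
  have hcont : ContinuousOn γ (Set.Ici 0) := by
    refine LipschitzOnWith.continuousOn (K := 1) (LipschitzOnWith.of_dist_le_mul ?_)
    intro s hs t ht
    rw [NNReal.coe_one, one_mul, dist_eq_norm, Real.dist_eq]
    rcases le_total s t with h | h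
    · rw [norm_sub_rev, abs_sub_comm, abs_of_nonneg (sub_nonneg.mpr h)]
      exact hγ.norm_sub_le hs h
    · rw [abs_of_nonneg (sub_nonneg.mpr h)]
      exact hγ.norm_sub_le ht h
  have hτ := mesh_strictMono hρ (h := ρ / 4) (by positivity)
  have hτ0 : ∀ i, 0 ≤ mesh ρ (ρ / 4) i := fun i => by
    have := hτ.monotone (Nat.zero_le i)
    simpa [mesh] using this
  obtain ⟨C, hdisc, hb, hC⟩ := DiscChain.exists_follows (γ := γ) (τ := mesh ρ (ρ / 4))
    (o := fun i => if i = 0 then 0 else γ (mesh ρ (ρ / 4) i))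
    (r := fun i => if i = 0 then 1 / 2 else ρ / 2) rfl hγ.start rfl hτ
    (tendsto_mesh (by positivity)) hcont (by
      rintro (_ | i) t ht
      · have ht' : t ∈ Set.Icc 0 ρ := by simpa [mesh] using ht
        simp only [if_true, mem_ball_zero_iff]
        rw [hγ.initial t ht'.1 ht'.2]
        exact ht'.2.trans_lt hρ'
      · simp only [Nat.succ_ne_zero, if_false, mem_ball_iff_norm]
        refine (hγ.norm_sub_le (hτ0 _) ht.1).trans_lt ?_
        have := ht.2
        simp only [mesh] at this ⊢
        push_cast at this
        linarith)
  refine ⟨C, ?_, fun lam hlam x => ⟨_, hC.isContinuation x, fun t ht => ?_⟩⟩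
  · -- the point `γ ρ` is covered by continuity
    have hafter : ∀ t, ρ ≤ t → ∀ m ∈ S, ρ ≤ ‖γ t - m‖ ∧ u m ≤ ‖γ t - m‖ := by
      intro t ht m hm
      have htend : Tendsto (fun s => ‖γ s - m‖) (𝓝[>] t) (𝓝 ‖γ t - m‖) := by
        have h1 : Tendsto γ (𝓝[>] t) (𝓝 (γ t)) :=
          (hcont t (hρ.le.trans ht)).mono_left (nhdsWithin_mono t fun s (hs : t < s) =>
            (hρ.le.trans ht).trans hs.le)
        exact (h1.sub_const _).norm
      constructor
      · refine ge_of_tendsto htend ?_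
        filter_upwards [self_mem_nhdsWithin] with s (hs : t < s)
        exact (hP _ (hγ.after s (ht.trans_lt hs)) m hm).1
      · refine ge_of_tendsto htend ?_
        filter_upwards [self_mem_nhdsWithin] with s (hs : t < s)
        exact (hP _ (hγ.after s (ht.trans_lt hs)) m hm).2
    rintro i z hz m hm him
    rw [hdisc] at hz
    rcases i with _ | i
    · have hm0 : m ≠ 0 := him.resolve_left fun h => h rfl
      simp only [if_true, mem_ball_zero_iff] at hz
      have h1 := one_le_abs_intCast hm0
      have h2 : |(m : ℝ)| - ‖z‖ ≤ ‖z - m‖ := by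
        rw [← norm_intCast_complex, norm_sub_rev]
        exact norm_sub_norm_le _ _
      have := hu m hm0
      linarith
    · simp only [Nat.succ_ne_zero, if_false, mem_ball_iff_norm] at hz
      have hge : ρ ≤ mesh ρ (ρ / 4) (i + 1) := by
        simp only [mesh]
        have : (0 : ℝ) ≤ i := Nat.cast_nonneg i
        nlinarith
      obtain ⟨h1, h2⟩ := hafter _ hge m hm
      have h3 := norm_sub_le_norm_sub_add_norm_sub (γ (mesh ρ (ρ / 4) (i + 1))) z (m : ℂ)
      rw [norm_sub_rev _ z] at h3
      linarith
  · refine (DiscChain.norm_val_le x _ _).trans ?_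
    refine mul_le_mul_of_nonneg_left (Real.exp_le_exp.mpr ?_) (norm_nonneg _)
    refine mul_le_mul_of_nonneg_left ?_ hlam
    have hlen : ∀ i, C.len i ≤ mesh ρ (ρ / 4) i := by
      intro i
      induction i with
      | zero => exact le_rfl
      | succ i ih =>
        have := hγ.norm_sub_le (hτ0 i) (hτ.monotone i.le_succ)
        simp only [DiscChain.len, hb]
        linarith
    have h1 := hlen (hC.idx t)
    have h2 := hγ.norm_sub_le (hτ0 _) (hC.le_of_idx ht)
    simp only [DiscChain.ell, hb]
    linarith

/-! ### Paths avoiding the integers -/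

/-- For bounded `z`, a positive distance to the integers is comparable to their moduli. -/
theorem div_mul_max_le {ε B : ℝ} (hε : 0 < ε) (hB : 0 ≤ B) {z : ℂ} {k : ℤ} (hz : ‖z‖ ≤ B)
    (hk : ε ≤ ‖z - k‖) : ε / (1 + ε + B) * max 1 |(k : ℝ)| ≤ ‖z - k‖ := by
  have h1 : |(k : ℝ)| ≤ ‖z - k‖ + B := by
    rw [← norm_intCast_complex]
    have := norm_sub_le_norm_sub_add_norm_sub (k : ℂ) z 0
    rw [sub_zero, sub_zero, norm_sub_rev] at this
    linarith
  have h2 : max 1 |(k : ℝ)| ≤ 1 + B + ‖z - k‖ := max_le (by linarith [norm_nonneg (z - k)])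
    (by linarith)
  rw [div_mul_eq_mul_div, div_le_iff₀ (by positivity)]
  calc ε * max 1 |(k : ℝ)| ≤ ε * (1 + B + ‖z - k‖) := by gcongr
    _ ≤ _ := by nlinarith

theorem IsZPath.continuousOn {γ : ℝ → ℂ} (hγ : IsZPath γ) : ContinuousOn γ (Set.Icc 0 1) := by
  have := hγ.abs_cont.continuousOn
  rwa [Set.uIcc_of_le zero_le_one] at this

/-- A path which does not end at the origin leaves it for good after some time; it stays close to
the origin until then, and at a positive distance from the integers afterwards. -/
theorem IsZPath.exists_split {γ : ℝ → ℂ} (hγ : IsZPath γ) (h1 : γ 1 ≠ 0) :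
    ∃ a ε : ℝ, 0 < a ∧ a < 1 ∧ 0 < ε ∧ (∀ t ∈ Set.Icc 0 a, ‖γ t‖ < 1 / 2) ∧
      ∀ t ∈ Set.Icc a 1, ∀ k : ℤ, ε ≤ ‖γ t - k‖ := by
  have hcont := hγ.continuousOn
  set Z : Set ℝ := {t ∈ Set.Icc (0 : ℝ) 1 | γ t = 0} with hZ
  have hZ0 : (0 : ℝ) ∈ Z := ⟨⟨le_rfl, zero_le_one⟩, hγ.start⟩
  have hZc : IsClosed Z := hcont.preimage_isClosed_of_isClosed isClosed_Icc isClosed_singleton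
  have hZb : BddAbove Z := ⟨1, fun t ht => ht.1.2⟩
  have hT : sSup Z ∈ Z := hZc.csSup_mem ⟨0, hZ0⟩ hZb
  have hT1 : sSup Z < 1 := lt_of_le_of_ne hT.1.2 fun h => h1 (h ▸ hT.2)
  have hord : ∀ t, 0 ≤ t → t ≤ sSup Z → γ t = 0 := fun t h0 ht =>
    (hγ.conn.isPreconnected.Icc_subset hZ0 hT ⟨h0, ht⟩).2
  -- the path is still close to the origin shortly after it has left it
  have hnear : ∀ᶠ s in 𝓝[Set.Icc 0 1] (sSup Z), ‖γ s‖ < 1 / 2 := by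
    have := (hcont _ hT.1).norm
    refine this.eventually_lt_const ?_
    simp only [hT.2, norm_zero]
    norm_num
  obtain ⟨η, hη, hball⟩ := Metric.mem_nhdsWithin_iff.mp hnear
  set a : ℝ := min (sSup Z + η / 2) ((sSup Z + 1) / 2) with ha
  have haZ : sSup Z < a := lt_min (by linarith) (by linarith)
  have ha1 : a < 1 := (min_le_right _ _).trans_lt (by linarith)
  have ha0 : 0 < a := hT.1.1.trans_lt haZ
  have hpos : ∀ t ∈ Set.Icc a 1,
      0 < Metric.infDist (γ t) (Set.range ((↑) : ℤ → ℂ)) := by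
    intro t ht
    have ht0 : 0 ≤ t := ha0.le.trans ht.1
    refine (Complex.isClosed_range_intCast.notMem_iff_infDist_pos (Set.range_nonempty _)).mp ?_
    rintro ⟨k, hk⟩
    by_cases hk0 : k = 0
    · rw [hk0, Int.cast_zero] at hk
      have : t ∈ Z := ⟨⟨ht0, ht.2⟩, hk.symm⟩
      exact absurd (le_csSup hZb this) (not_le.mpr (haZ.trans_le ht.1))
    · exact hγ.avoid t ⟨ht0, ht.2⟩ k hk0 hk.symm
  obtain ⟨t₀, ht₀, hmin⟩ := (isCompact_Icc (a := a) (b := 1)).exists_isMinOn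
    (Set.nonempty_Icc.mpr ha1.le)
    ((Metric.continuous_infDist_pt (Set.range ((↑) : ℤ → ℂ))).comp_continuousOn
      (hcont.mono (Set.Icc_subset_Icc_left ha0.le)))
  refine ⟨a, _, ha0, ha1, hpos t₀ ht₀, fun t ht => ?_, fun t ht k => ?_⟩
  · rcases le_total t (sSup Z) with h | h
    · rw [hord t ht.1 h, norm_zero]
      norm_num
    · refine hball ⟨?_, ht.1, ht.2.trans ha1.le⟩
      rw [Metric.mem_ball, Real.dist_eq, abs_of_nonneg (sub_nonneg.mpr h)]
      have : t ≤ sSup Z + η / 2 := ht.2.trans (min_le_left _ _)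
      linarith
  · rw [← dist_eq_norm]
    exact (hmin ht).trans (Metric.infDist_le_dist_of_mem (Set.mem_range_self k))

/-- A path that does not end at the origin runs through a chain of discs which ends with any
prescribed disc containing the end point. -/
theorem IsZPath.exists_chain {γ : ℝ → ℂ} (hγ : IsZPath γ) (h1 : γ 1 ≠ 0) {p : ℂ} {s : ℝ}
    (hp : γ 1 ∈ Metric.ball p s) {S : Set ℤ} {ε : ℝ} (hε : 0 < ε)
    (hS : ∀ z ∈ Metric.ball p s, ∀ k ∈ S, ε ≤ ‖z - k‖) :
    ∃ c : ℝ, 0 < c ∧ c ≤ 1 ∧ ∃ (C : DiscChain) (τ : ℕ → ℝ) (j : ℕ),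
      C.Avoids S (fun k => c * max 1 |(k : ℝ)|) ∧ C.Follows (fun t => γ (min t 1)) τ ∧
        τ j ≤ 1 ∧ 1 < τ (j + 1) ∧ C.disc j = Metric.ball p s := by
  obtain ⟨a, ε₁, ha0, ha1, hε₁, hnear, hfar⟩ := hγ.exists_split h1
  have hcont := hγ.continuousOn
  obtain ⟨B₀, hB₀⟩ := (isCompact_Icc (a := (0 : ℝ)) (b := 1)).exists_bound_of_continuousOn hcont
  have hunif := (isCompact_Icc (a := (0 : ℝ)) (b := 1)).uniformContinuousOn_of_continuous hcont
  obtain ⟨δ, hδ, hmod⟩ := Metric.uniformContinuousOn_iff.mp hunif (ε₁ / 2) (by positivity)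
  obtain ⟨M, hM⟩ := exists_nat_gt ((1 - a) / δ)
  have hM0 : (0 : ℝ) < M := lt_of_le_of_lt (div_nonneg (by linarith) hδ.le) hM
  set h : ℝ := (1 - a) / M with hh
  have hh0 : 0 < h := div_pos (by linarith) hM0
  have hhδ : h < δ := by
    rw [hh, div_lt_iff₀ hM0]
    rwa [div_lt_iff₀ hδ, mul_comm] at hM
  have hMh : a + M * h = 1 := by
    rw [hh]
    field_simp
    ring
  have hτ := mesh_strictMono ha0 hh0
  have hτM : mesh a h (M + 1) = 1 := hMh
  have hτ0 : ∀ i, 0 ≤ mesh a h i := fun i => by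
    have := hτ.monotone (Nat.zero_le i)
    simpa [mesh] using this
  have hτa : ∀ i, a ≤ mesh a h (i + 1) := fun i => by
    simp only [mesh]
    have : (0 : ℝ) ≤ i := Nat.cast_nonneg i
    nlinarith
  have hτ1 : ∀ i, i < M + 1 → mesh a h (i + 1) ≤ 1 := fun i hi =>
    hτM ▸ hτ.monotone (by lia)
  let o : ℕ → ℂ := fun i => if i = 0 then 0 else if i < M + 1 then γ (mesh a h i) else p
  let r : ℕ → ℝ := fun i => if i = 0 then 1 / 2 else if i < M + 1 then ε₁ / 2 else s
  have hγc : ContinuousOn (fun t => γ (min t 1)) (Set.Ici 0) :=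
    hcont.comp (continuous_id.min continuous_const).continuousOn
      fun t ht => ⟨le_min ht zero_le_one, min_le_right _ _⟩
  obtain ⟨C, hdisc, -, hC⟩ := DiscChain.exists_follows (γ := fun t => γ (min t 1))
    (τ := mesh a h) (o := o) (r := r) rfl (by simpa using hγ.start) rfl hτ
    (tendsto_mesh hh0) hγc (by
      rintro (_ | i) t ht
      · have ht' : t ∈ Set.Icc 0 a := by simpa [mesh] using ht
        simp only [o, r, if_true, mem_ball_zero_iff, min_eq_left (ht'.2.trans ha1.le)]
        exact hnear t ht'
      · by_cases hi : i + 1 < M + 1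
        · have ht1 : t ≤ 1 := ht.2.trans (hτ1 _ hi)
          simp only [o, r, Nat.succ_ne_zero, if_false, hi, if_true, min_eq_left ht1]
          refine hmod t ⟨(hτ0 _).trans ht.1, ht1⟩ _ ⟨hτ0 _, ht.1.trans ht1⟩ ?_
          rw [Real.dist_eq, abs_of_nonneg (sub_nonneg.mpr ht.1)]
          have := ht.2
          simp only [mesh] at this ⊢
          push_cast at this
          linarith
        · have ht1 : 1 ≤ t := by
            rw [← hτM]
            exact (hτ.monotone (not_lt.mp hi)).trans ht.1
          simp only [o, r, Nat.succ_ne_zero, if_false, hi, min_eq_right ht1]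
          exact hp)
  set ε' : ℝ := min (1 / 2) (min (ε₁ / 2) ε) with hε'
  have hε'0 : 0 < ε' := lt_min (by norm_num) (lt_min (by positivity) hε)
  set B : ℝ := max 1 (max (B₀ + ε₁) (‖p‖ + s)) with hB
  have hB0 : 0 ≤ B := zero_le_one.trans (le_max_left _ _)
  refine ⟨ε' / (1 + ε' + B), by positivity, by
    rw [div_le_one (by positivity)]; linarith, C, mesh a h, M + 1, ?_, hC, hτM.le, ?_, ?_⟩
  · intro i z hz k hk hik
    rw [hdisc] at hz
    rcases i with _ | i
    · have hk0 : k ≠ 0 := hik.resolve_left fun h => h rfl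
      simp only [o, r, if_true, mem_ball_zero_iff] at hz
      refine div_mul_max_le hε'0 hB0 (hz.le.trans ?_) ((min_le_left _ _).trans ?_)
      · exact le_trans (by norm_num) (le_max_left _ _)
      · have h1 := one_le_abs_intCast hk0
        have h2 : |(k : ℝ)| - ‖z‖ ≤ ‖z - k‖ := by
          rw [← norm_intCast_complex, norm_sub_rev]
          exact norm_sub_norm_le _ _
        linarith
    · by_cases hi : i + 1 < M + 1
      · simp only [o, r, Nat.succ_ne_zero, if_false, hi, if_true, mem_ball_iff_norm] at hz
        have hmem : mesh a h (i + 1) ≤ 1 := hτ1 i (by lia)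
        have hb := hB₀ _ ⟨hτ0 (i + 1), hmem⟩
        have hd := hfar _ ⟨hτa i, hmem⟩ k
        refine div_mul_max_le hε'0 hB0 ?_ (((min_le_right _ _).trans (min_le_left _ _)).trans ?_)
        · refine le_trans ?_ ((le_max_left _ _).trans (le_max_right _ _))
          have := norm_sub_le_norm_sub_add_norm_sub z (γ (mesh a h (i + 1))) 0
          rw [sub_zero, sub_zero] at this
          linarith
        · have h3 := norm_sub_le_norm_sub_add_norm_sub (γ (mesh a h (i + 1))) z (k : ℂ)
          rw [norm_sub_rev _ z] at h3
          linarith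
      · simp only [o, r, Nat.succ_ne_zero, if_false, hi] at hz
        refine div_mul_max_le hε'0 hB0 ?_
          (((min_le_right _ _).trans (min_le_right _ _)).trans (hS z hz k hk))
        refine le_trans ?_ ((le_max_right _ _).trans (le_max_right _ _))
        rw [mem_ball_iff_norm] at hz
        have := norm_sub_le_norm_sub_add_norm_sub z p 0
        rw [sub_zero, sub_zero] at this
        linarith
  · rw [← hτM]
    exact hτ (Nat.lt_succ_self _)
  · rw [hdisc]
    simp [o, r]

/-- For every path avoiding the integers there is a chain of discs such that the functions on the
chain provide analytic continuations along the path, the final germ extending to a prescribed disc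
around the end point. -/
theorem IsZPath.exists_chain_continuation {γ : ℝ → ℂ} (hγ : IsZPath γ) {p : ℂ} {s : ℝ}
    (hp : γ 1 ∈ Metric.ball p s) (h0 : γ 1 = 0 → p = 0 ∧ s < 1) {S : Set ℤ} {ε : ℝ} (hε : 0 < ε)
    (hS : γ 1 ≠ 0 → ∀ z ∈ Metric.ball p s, ∀ k ∈ S, ε ≤ ‖z - k‖) :
    ∃ c : ℝ, 0 < c ∧ c ≤ 1 ∧ ∃ C : DiscChain, C.Avoids S (fun k => c * max 1 |(k : ℝ)|) ∧
      ∀ (lam : ℝ) (x : C.Fun lam), ∃ F,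
        IsContinuation (hat (DiscChain.unborel x)) γ (Set.Icc 0 1) F ∧
          ∃ g, DifferentiableOn ℂ g (Metric.ball p s) ∧ F 1 = g := by
  by_cases h1 : γ 1 = 0
  · obtain ⟨rfl, hs1⟩ := h0 h1
    have hs : 0 < s := dist_nonneg.trans_lt hp
    have hγ0 : ∀ t ∈ Set.Icc (0 : ℝ) 1, γ t = 0 := fun t ht =>
      (hγ.conn.isPreconnected.Icc_subset ⟨⟨le_rfl, zero_le_one⟩, hγ.start⟩
        ⟨⟨zero_le_one, le_rfl⟩, h1⟩ ht).2
    refine ⟨min (s / 4) (1 - s), lt_min (by positivity) (by linarith),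
      (min_le_right _ _).trans (by linarith), standardChain s hs,
      (standardChain_avoids hs hs1).mono (Set.subset_univ _) fun _ => le_rfl, fun lam x =>
      ⟨fun _ => DiscChain.val x 0, ⟨fun t ht => ?_, DiscChain.hasFPowerSeriesAt_val x,
        fun t _ => Eventually.of_forall fun _ => EventuallyEq.rfl⟩, _,
        (DiscChain.isHolo_val x).diff 0, rfl⟩⟩
    rw [hγ0 t ht]
    exact DiscChain.analyticAt_val x (DiscChain.zero_mem_disc _)
  · obtain ⟨c, hc, hc1, C, τ, j, hC, hfol, hj1, hj2, hdisc⟩ := hγ.exists_chain h1 hp hε (hS h1)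
    refine ⟨c, hc, hc1, C, hC, fun lam x => ⟨_, (hfol.isContinuation x).mono_congr
      (fun t ht => ht.1) fun t ht => by rw [min_eq_left ht.2], DiscChain.val x j, ?_, ?_⟩⟩
    · rw [← hdisc]
      exact (DiscChain.isHolo_val x).diff j
    · rw [hfol.idx_eq zero_le_one hj1 hj2]

/-! ### Resurgence and regularity of the branches -/

/-- Resurgence follows from the existence of functions on the chains of discs avoiding `ℤ`. -/
theorem mem_holR_of_chain {φ : PowerSeries ℂ} (H : ∀ c : ℝ, 0 < c → c ≤ 1 → ∀ C : DiscChain,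
    C.Avoids Set.univ (fun k => c * max 1 |(k : ℝ)|) →
      ∃ (lam : ℝ) (x : C.Fun lam), hat (DiscChain.unborel x) = φ) : φ ∈ holR := by
  intro γ hγ
  obtain ⟨s, hs, h0, ε, hε, hS⟩ : ∃ s : ℝ, 0 < s ∧ (γ 1 = 0 → γ 1 = 0 ∧ s < 1) ∧ ∃ ε : ℝ, 0 < ε ∧
      (γ 1 ≠ 0 → ∀ z ∈ Metric.ball (γ 1) s, ∀ k ∈ (Set.univ : Set ℤ), ε ≤ ‖z - k‖) := by
    by_cases h1 : γ 1 = 0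
    · exact ⟨1 / 2, by norm_num, fun _ => ⟨h1, by norm_num⟩, 1, one_pos, fun h => absurd h1 h⟩
    · obtain ⟨a, ε, -, ha1, hε, -, hfar⟩ := hγ.exists_split h1
      refine ⟨ε / 2, by positivity, fun h => absurd h h1, ε / 2, by positivity,
        fun _ z hz k _ => ?_⟩
      have h2 := hfar 1 ⟨ha1.le, le_rfl⟩ k
      rw [mem_ball_iff_norm] at hz
      have h3 := norm_sub_le_norm_sub_add_norm_sub (γ 1) z (k : ℂ)
      rw [norm_sub_rev _ z] at h3
      linarith
  obtain ⟨c, hc, hc1, C, hC, hF⟩ := hγ.exists_chain_continuation (Metric.mem_ball_self hs) h0 hε hS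
  obtain ⟨lam, x, rfl⟩ := H c hc hc1 C hC
  obtain ⟨F, hF, -⟩ := hF lam x
  exact ⟨F, hF⟩

/-- Regularity at `m` follows from the existence of functions on the chains of discs which avoid a
set of integers that does not contain `m`. -/
theorem branchesRegularAt_of_chain {φ : PowerSeries ℂ} {m : ℤ} {S : Set ℤ} (hm : m ∉ S)
    (H : ∀ c : ℝ, 0 < c → c ≤ 1 → ∀ C : DiscChain,
      C.Avoids S (fun k => c * max 1 |(k : ℝ)|) →
        ∃ (lam : ℝ) (x : C.Fun lam), hat (DiscChain.unborel x) = φ) : BranchesRegularAt φ m := by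
  intro γ hγ hend F hF
  -- holomorphic extensions to all the discs of radius `s < 1`
  have hs : ∀ s : ℝ, ‖γ 1 - m‖ < s → s < 1 → ∃ g : ℂ → ℂ,
      DifferentiableOn ℂ g (Metric.ball (m : ℂ) s) ∧ F 1 =ᶠ[𝓝 (γ 1)] g := by
    intro s hs hs1
    obtain ⟨c, hc, hc1, C, hC, hG⟩ := hγ.exists_chain_continuation (p := (m : ℂ)) (s := s) (S := S)
      (mem_ball_iff_norm.mpr hs) (fun h1 => by
        refine ⟨?_, hs1⟩
        rw [h1, zero_sub, norm_neg, norm_intCast_complex] at hend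
        by_contra hm0
        exact absurd hend (not_lt.mpr (one_le_abs_intCast fun h => hm0 (by rw [h, Int.cast_zero]))))
      (ε := 1 - s) (by linarith) (fun _ z hz k hk => by
        have hmk : m - k ≠ 0 := fun h => hm (by rwa [sub_eq_zero.mp h])
        have h1 := one_le_abs_intCast hmk
        rw [← norm_intCast_complex] at h1
        rw [mem_ball_iff_norm] at hz
        push_cast at h1
        have h3 := norm_sub_le_norm_sub_add_norm_sub (m : ℂ) z (k : ℂ)
        rw [norm_sub_rev _ z] at h3
        linarith)
    obtain ⟨lam, x, rfl⟩ := H c hc hc1 C hC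
    obtain ⟨G, hG, g, hg, hGg⟩ := hG lam x
    refine ⟨g, hg, ?_⟩
    rw [← hGg]
    exact hF.eventuallyEq hG hγ.continuousOn hγ.start (Set.right_mem_Icc.mpr zero_le_one)
  choose! g hg hFg using hs
  have hagree : ∀ s s', ‖γ 1 - m‖ < s → s ≤ s' → s' < 1 →
      ∀ z ∈ Metric.ball (m : ℂ) s, g s z = g s' z := by
    intro s s' h1 h2 h3
    refine AnalyticOnNhd.eqOn_of_preconnected_of_eventuallyEq
      ((hg s h1 (h2.trans_lt h3)).analyticOnNhd Metric.isOpen_ball)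
      (((hg s' (h1.trans_le h2) h3).mono (Metric.ball_subset_ball h2)).analyticOnNhd
        Metric.isOpen_ball) (convex_ball _ _).isPreconnected (mem_ball_iff_norm.mpr h1) ?_
    exact (hFg s h1 (h2.trans_lt h3)).symm.trans (hFg s' (h1.trans_le h2) h3)
  set e := ‖γ 1 - m‖ with he
  let σ : ℂ → ℝ := fun z => (max e ‖z - m‖ + 1) / 2
  have hσ : ∀ z ∈ Metric.ball (m : ℂ) 1, e < σ z ∧ σ z < 1 ∧ ‖z - m‖ < σ z := by
    intro z hz
    rw [mem_ball_iff_norm] at hz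
    have h1 : max e ‖z - m‖ < 1 := max_lt hend hz
    have h2 := le_max_left e ‖z - m‖
    have h3 := le_max_right e ‖z - m‖
    refine ⟨?_, ?_, ?_⟩ <;> simp only [σ] <;> linarith
  have hlocal : ∀ z ∈ Metric.ball (m : ℂ) 1, ∀ᶠ w in 𝓝 z, g (σ w) w = g (σ z) w := by
    intro z hz
    obtain ⟨h1, h2, h3⟩ := hσ z hz
    filter_upwards [Metric.isOpen_ball.mem_nhds hz,
      Metric.isOpen_ball.mem_nhds (mem_ball_iff_norm.mpr h3)] with w hw hw'
    obtain ⟨h1', h2', h3'⟩ := hσ w hw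
    rcases le_total (σ w) (σ z) with h | h
    · exact hagree _ _ h1' h h2 w (mem_ball_iff_norm.mpr h3')
    · exact (hagree _ _ h1 h h2' w hw').symm
  have hend' : γ 1 ∈ Metric.ball (m : ℂ) 1 := mem_ball_iff_norm.mpr hend
  refine ⟨fun z => g (σ z) z, fun z hz => ?_, ?_⟩
  · obtain ⟨h1, h2, h3⟩ := hσ z hz
    have hd := (hg _ h1 h2).differentiableAt
      (Metric.isOpen_ball.mem_nhds (mem_ball_iff_norm.mpr h3))
    exact (hd.congr_of_eventuallyEq (hlocal z hz)).differentiableWithinAt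
  · obtain ⟨h1, h2, -⟩ := hσ _ hend'
    exact (hFg _ h1 h2).trans (EventuallyEq.symm (hlocal _ hend'))

/-- The products of the germs of a continuation of `φ` by `ζ + 1` continue `(ζ + 1) φ`. -/
theorem IsContinuation.X_add_one_mul {φ : PowerSeries ℂ} {γ : ℝ → ℂ} {I : Set ℝ}
    {F : ℝ → ℂ → ℂ} (h : IsContinuation φ γ I F) :
    IsContinuation ((PowerSeries.X + 1) * φ) γ I fun t z => (z + 1) * F t z where
  analytic t ht := (analyticAt_id.add analyticAt_const).mul (h.analytic t ht)
  initial := by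
    have h0 := h.initial
    rw [hasFPowerSeriesAt_iff] at h0 ⊢
    filter_upwards [h0] with z hz
    simp only [FormalMultilinearSeries.coeff_ofScalars, smul_eq_mul, zero_add] at hz ⊢
    have h1 : HasSum (fun n => z ^ n * PowerSeries.coeff n (PowerSeries.X * φ)) (z * F 0 z) := by
      refine (hasSum_nat_add_iff' 1).mp ?_
      simp only [Finset.range_one, Finset.sum_singleton, PowerSeries.coeff_succ_X_mul,
        PowerSeries.coeff_zero_X_mul, mul_zero, sub_zero]
      convert! hz.mul_left z using 2 with n
      ring
    rw [show (z + 1) * F 0 z = z * F 0 z + F 0 z by ring]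
    convert! h1.add hz using 1
    ext1 n
    rw [add_mul, one_mul, map_add, mul_add]
  compat t ht := by
    filter_upwards [h.compat t ht] with s hs
    filter_upwards [hs] with z hz
    rw [hz]

theorem branchesSimplePoleAt_neg_one {φ : PowerSeries ℂ}
    (h : BranchesRegularAt ((PowerSeries.X + 1) * φ) (-1)) : BranchesSimplePoleAt φ (-1) := by
  intro γ hγ hend F hF
  obtain ⟨g, hg, hFg⟩ := h γ hγ hend _ hF.X_add_one_mul
  refine ⟨g, hg, ?_⟩
  simpa using hFg

theorem regionMinus_bound {ρ : ℝ} (hρ : 0 < ρ) {N n : ℕ} (hN : 1 ≤ N) {ζ : ℂ}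
    (hζ : ζ ∈ regionMinus ρ N n) {m : ℤ} (hm : m < n) :
    ρ / N * max 1 (-(m : ℝ)) ≤ ‖ζ - m‖ := by
  have := le_norm_sub_of_segment hρ hN (e := -1) (ζ := ζ) (k := -(m : ℝ))
    (fun w hw => by simpa using hζ.2 w hw) (by simpa using hζ.1 m hm)
  simpa using this

theorem regionPlus_bound {ρ : ℝ} (hρ : 0 < ρ) {N : ℕ} (hN : 1 ≤ N) {ζ : ℂ}
    (hζ : ζ ∈ regionPlus ρ N) {m : ℤ} (hm : 0 ≤ m) :
    ρ / N * max 1 |(m : ℝ)| ≤ ‖ζ - m‖ := by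
  have h0 : (0 : ℝ) ≤ m := by exact_mod_cast hm
  have := le_norm_sub_of_segment hρ hN (e := 1) (ζ := ζ) (k := m)
    (fun w hw => by simpa using hζ.2 w hw) (by simpa using hζ.1 m hm)
  rw [abs_of_nonneg h0]
  simpa using this

theorem phi_mem_chain {A : Ser2} (hA : IsSaddleNode A) (n : ℕ) {c : ℝ} (hc : 0 < c) (hc1 : c ≤ 1)
    {C : DiscChain} (hC : C.Avoids {m | m < (n : ℤ)} fun m => c * max 1 |(m : ℝ)|) :
    ∃ (lam : ℝ) (x : C.Fun lam), hat (DiscChain.unborel x) = hat (phi A n) := by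
  obtain ⟨K, L, M, -, -, -, H⟩ := exists_phi_hat hA hc hc1
  obtain ⟨f, hf, -⟩ := H n C (hC.mono subset_rfl fun m =>
    mul_le_mul_of_nonneg_left (max_le_max le_rfl (neg_le_abs _)) hc.le)
  exact ⟨_, f, by rw [hf]⟩

theorem psi_mem_chain {A : Ser2} (hA : IsSaddleNode A) {n : ℕ} (hn : 1 ≤ n) {c : ℝ} (hc : 0 < c)
    (hc1 : c ≤ 1) {C : DiscChain} (hC : C.Avoids {m | 0 ≤ m} fun m => c * max 1 |(m : ℝ)|) :
    ∃ (lam : ℝ) (x : C.Fun lam), hat (DiscChain.unborel x) = hat (psi hA n) := by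
  obtain ⟨K, L, M, -, -, -, H⟩ := exists_psi_hat hA hc hc1
  obtain ⟨f, hf, -⟩ := (H C hC).1 n hn
  exact ⟨_, f, by rw [hf]⟩

end

end SaddleNode

theorem mainTheorem2 (A : SaddleNode.Ser2) (hA : SaddleNode.IsSaddleNode A) :
    ∃ φ ψ : ℕ → PowerSeries ℂ,
      -- the formal transformation `θ(x,y) = (x, y + ∑ φₙ(x) yⁿ)` with substitution operator `Θ`
      (∀ n, PowerSeries.constantCoeff (φ n) = 0) ∧
      (∀ f : SaddleNode.Ser2,
        SaddleNode.IsThetaValue A f (MvPowerSeries.subst (SaddleNode.transf φ) f)) ∧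
      -- its inverse `θ⁻¹(x,y) = (x, y + ∑ ψₙ(x) yⁿ)`
      (∀ n, PowerSeries.constantCoeff (ψ n) = 0) ∧
      SaddleNode.compTransf (SaddleNode.transf φ) (SaddleNode.transf ψ) = MvPowerSeries.X ∧
      SaddleNode.compTransf (SaddleNode.transf ψ) (SaddleNode.transf φ) = MvPowerSeries.X ∧
      -- resurgence
      (∀ n, SaddleNode.tilde (φ n) ∈ SaddleNode.resurgentZ) ∧
      (∀ n, SaddleNode.tilde (ψ n) ∈ SaddleNode.resurgentZ) ∧
      -- (i)
      (∀ (n : ℕ) (m : ℤ), (n : ℤ) ≤ m → SaddleNode.BranchesRegularAt (SaddleNode.hat (φ n)) m) ∧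
      -- (ii)
      (∀ (n : ℕ) (m : ℤ), m ≤ -1 → ¬ (n = 0 ∧ m = -1) →
        SaddleNode.BranchesRegularAt (SaddleNode.hat (ψ n)) m) ∧
      SaddleNode.BranchesSimplePoleAt (SaddleNode.hat (ψ 0)) (-1) ∧
      -- (iii)
      ∀ (ρ : ℝ) (N : ℕ), 0 < ρ → ρ < 1 / 2 → 1 ≤ N →
        ∃ K L C : ℝ, 0 < K ∧ 0 < L ∧ 0 < C ∧
          (∀ (n : ℕ) (γ : ℝ → ℂ),
            SaddleNode.IsAdapted ρ (SaddleNode.regionMinus ρ N n) γ →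
              ∃ F, SaddleNode.IsContinuation (SaddleNode.hat (φ n)) γ (Set.Ici 0) F ∧
                ∀ t : ℝ, 0 ≤ t →
                  ‖F t (γ t)‖ ≤ K * L ^ n * Real.exp (((n : ℝ) ^ 2 + 1) * C * t)) ∧
          (∀ γ : ℝ → ℂ, SaddleNode.IsAdapted ρ (SaddleNode.regionPlus ρ N) γ →
            (∀ n : ℕ, 1 ≤ n →
              ∃ F, SaddleNode.IsContinuation (SaddleNode.hat (ψ n)) γ (Set.Ici 0) F ∧
                ∀ t : ℝ, 0 ≤ t → ‖F t (γ t)‖ ≤ K * L ^ n * Real.exp (C * t)) ∧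
            -- the continuation of `(ζ + 1) ψ̂₀(ζ)`
            ∃ F, SaddleNode.IsContinuation
                ((PowerSeries.X + 1) * SaddleNode.hat (ψ 0)) γ (Set.Ici 0) F ∧
              ∀ t : ℝ, 0 ≤ t → ‖F t (γ t)‖ ≤ K * Real.exp (C * t)) := by
  open SaddleNode in
  obtain ⟨hcomp, hcomp'⟩ := compTransf_eq_X hA (psi hA) (coeff_zero_psi hA) (subst_transf_psi hA)
  refine ⟨phi A, psi hA, coeff_zero_phi hA, isThetaValue_subst hA, coeff_zero_psi hA, hcomp, hcomp',
    ?_, ?_, ?_, ?_, ?_, ?_⟩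
  · intro n
    exact mem_holR_of_chain fun c hc hc1 C hC =>
      phi_mem_chain hA n hc hc1 (hC.mono (Set.subset_univ _) fun _ => le_rfl)
  · intro n
    refine mem_holR_of_chain fun c hc hc1 C hC => ?_
    rcases Nat.eq_zero_or_pos n with rfl | hn
    · obtain ⟨M, f, hf⟩ := exists_psi_zero_hat hA hc hc1
        (hC.mono (Set.subset_univ _) fun _ => le_rfl)
      exact ⟨M, f, by rw [hf]; rfl⟩
    · exact psi_mem_chain hA hn hc hc1 (hC.mono (Set.subset_univ _) fun _ => le_rfl)
  · intro n m hm
    exact branchesRegularAt_of_chain (S := {k | k < (n : ℤ)}) (not_lt.mpr hm)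
      fun c hc hc1 C hC => phi_mem_chain hA n hc hc1 hC
  · intro n m hm hne
    rcases Nat.eq_zero_or_pos n with rfl | hn
    · refine branchesRegularAt_of_chain (S := {k | -1 ≤ k})
        (fun h : -1 ≤ m => hne ⟨rfl, le_antisymm hm h⟩) fun c hc hc1 C hC => ?_
      obtain ⟨M, f, hf⟩ := exists_psi_zero_hat hA hc hc1 hC
      exact ⟨M, f, by rw [hf]⟩
    · exact branchesRegularAt_of_chain (S := {k | 0 ≤ k}) (fun h : 0 ≤ m => by lia)
        fun c hc hc1 C hC => psi_mem_chain hA hn hc hc1 hC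
  · refine branchesSimplePoleAt_neg_one (branchesRegularAt_of_chain (S := {k | 0 ≤ k})
      (by simp) fun c hc hc1 C hC => ?_)
    obtain ⟨K, L, M, -, -, -, H⟩ := exists_psi_hat hA hc hc1
    obtain ⟨f, hf, -⟩ := (H C hC).2
    exact ⟨M, f, by rw [hf, hat_sub_xxD]⟩
  · intro ρ N hρ hρ' hN
    have hN1 : (1 : ℝ) ≤ N := by exact_mod_cast hN
    have hc : 0 < ρ / N / 2 := by positivity
    have hρN : ρ / N ≤ 1 := (div_le_one (by positivity)).mpr (by linarith)
    have hc1 : ρ / N / 2 ≤ 1 := by linarith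
    obtain ⟨K, L, M, hK, hL, hM, H⟩ := exists_phi_hat hA hc hc1
    obtain ⟨K', L', M', hK', hL', hM', H'⟩ := exists_psi_hat hA hc hc1
    have hmax : ∀ {k m : ℝ}, 1 ≤ m → k ≤ m → ρ / N * max 1 k ≤ m := fun {k m} h1 h2 =>
      (mul_le_of_le_one_left (by positivity) hρN).trans (max_le h1 h2)
    refine ⟨max K K', max L L', max M M', by positivity, by positivity, by positivity, ?_, ?_⟩
    · intro n γ hγ
      obtain ⟨C, hC, hF⟩ := hγ.exists_chain hρ hρ' (S := {m | m < (n : ℤ)})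
        (u := fun m => ρ / N * max 1 (-(m : ℝ)))
        (fun m hm => hmax (one_le_abs_intCast hm) (neg_le_abs _))
        (fun ζ hζ m hm => ⟨hζ.1 m hm, regionMinus_bound hρ hN hζ hm⟩)
      obtain ⟨f, hf, hfn⟩ := H n C (hC.mono subset_rfl fun m => by
        rw [div_mul_eq_mul_div])
      obtain ⟨F, hF, hFb⟩ := hF _ (by positivity) f
      rw [hf] at hF
      refine ⟨F, hF, fun t ht => (hFb t ht).trans ?_⟩
      gcongr
      · refine hfn.trans ?_
        gcongr
        · exact le_max_left _ _
        · exact le_max_left _ _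
      · exact le_max_left _ _
    · intro γ hγ
      obtain ⟨C, hC, hF⟩ := hγ.exists_chain hρ hρ' (S := {m | 0 ≤ m})
        (u := fun m => ρ / N * max 1 |(m : ℝ)|)
        (fun m hm => hmax (one_le_abs_intCast hm) le_rfl)
        (fun ζ hζ m hm => ⟨hζ.1 m hm, regionPlus_bound hρ hN hζ hm⟩)
      obtain ⟨H1, f₀, hf₀, hfn₀⟩ := H' C (hC.mono subset_rfl fun m => by
        rw [div_mul_eq_mul_div])
      refine ⟨fun n hn => ?_, ?_⟩
      · obtain ⟨f, hf, hfn⟩ := H1 n hn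
        obtain ⟨F, hF, hFb⟩ := hF _ hM'.le f
        rw [hf] at hF
        refine ⟨F, hF, fun t ht => (hFb t ht).trans ?_⟩
        gcongr
        · refine hfn.trans ?_
          gcongr
          · exact le_max_right _ _
          · exact le_max_right _ _
        · exact le_max_right _ _
      · obtain ⟨F, hF, hFb⟩ := hF _ hM'.le f₀
        rw [hf₀, hat_sub_xxD] at hF
        refine ⟨F, hF, fun t ht => (hFb t ht).trans ?_⟩
        gcongr
        · exact hfn₀.trans (le_max_right _ _)
        · exact le_max_right _ _
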